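/- **Setting.** Let $d\ge 1$, $\omega\in\mathbb R^d$, $\mathbb T^d=(\mathbb R/\mathbb Z)^d$, $2\mathbb T^d=(\mathbb R/2\mathbb Z)^d$, and let $a,b,c\in C^\omega(\mathbb T^d,\mathbb R)$ be real-analytic. Consider on $\mathbb R$ the Schrödinger equation $$ i\,\partial_t u = L^W(\omega t)\,u,\qquad L^W(\theta)=\tfrac12\bigl(a(\theta)\,x^2+b(\theta)\,x\cdot(-i\partial_x)+b(\theta)\,(-i\partial_x)\cdot x+c(\theta)\,(-i\partial_x)^2\bigr),\qquad (1)$$ the Weyl quantization of the symbol $\frac12(a x^2+b\,x\xi+b\,\xi x+c\,\xi^2)$. A solution of (1) is a function $u\in C([0,\infty),L^2(\mathbb R))$ such that $i\frac{d}{dt}\langle\varphi,u(t)\rangle=\langle L^W(\omega t)\varphi,u(t)\rangle$ for every Schwartz function $\varphi$ and all $t\ge 0$ (one-sided derivative at $t=0$). Let $H_0=-\partial_x^2+x^2$, and for $s\ge0$ let $\mathcal H^s=\{\psi\in L^2(\mathbb R): H_0^{s/2}\psi\in L^2(\mathbb R)\}$ with norm $\|\psi\|_s=\|H_0^{s/2}\psi\|_{L^2}$;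 that is, $\|\psi\|_s^2=\sum_{n\ge0}(2n+1)^s|\langle h_n,\psi\rangle|^2$ with $(h_n)$ the orthonormal basis of Hermite functions. Put $A=\begin{pmatrix} b&c\\-a&-b\end{pmatrix}$. **Assumption.** There are $B\in \mathrm{sl}(2,\mathbb R)$ and $Z_0,\dots,Z_K\in C^\omega(2\mathbb T^d,\mathrm{sl}(2,\mathbb R))$ such that $Y=e^{Z_0}e^{Z_1}\cdots e^{Z_K}$ satisfies $$\frac{d}{dt}Y(\omega t)=A(\omega t)\,Y(\omega t)-Y(\omega t)\,B\qquad\text{for all }t\in\mathbb R.$$ **Theorem 3.2.** Under this assumption, let $s\ge0$ and $0\ne u_0\in\mathcal H^s$. Then (1) has a unique solution $u$ with $u(0)=u_0$, one has $u(t)\in\mathcal H^s$ for all $t\ge0$, and the following hold. 1. If $\det B>0$ or $B=0$, there are constants $c,C>0$ such that $c\le\|u(t)\|_s\le C$ for all $t\ge0$. 2. If $\det B<0$, there are constants $c,C>0$ such that $c\,e^{\sqrt{-\det B}\,s t}\le\|u(t)\|_s\le C\,e^{\sqrt{-\det B}\,s t}$ for all $t\ge0$. 3. If $B$ is similar (over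 $\mathbb R$) to $\begin{pmatrix}0&0\\ \kappa&0\end{pmatrix}$ with $\kappa\ne0$, there are constants $c,C>0$ such that $c\,|\kappa|^s t^s\le\|u(t)\|_s\le C\,|\kappa|^s(1+t^2)^{s/2}$ for all $t\ge0$ (with $0^0=1$ when $s=t=0$). The constants $c,C$ depend on $s$ and $u_0$, and on the fixed data of the equation and its reduction ($\omega,a,b,c,B,Z_j$ and, in case 3, $\kappa$), but not on $t$. -/

import Mathlib

open MeasureTheory Set
open scoped SchwartzMap

noncomputable section

namespace QuadraticSchrodinger

/-- The Hilbert space `L²(ℝ) = L²(ℝ, ℂ)`. -/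
abbrev L2R : Type := Lp ℂ 2 (volume : Measure ℝ)

/-- The `L²` pairing `⟨f, ψ⟩ = ∫ conj (f x) ψ(x) dx` of a function `f` with `ψ ∈ L²(ℝ)`.
It is only used for Schwartz functions `f`, where the integral converges absolutely. -/
def pairing (f : ℝ → ℂ) (ψ : L2R) : ℂ :=
  ∫ x, (starRingEnd ℂ) (f x) * ψ x

/-! ### The harmonic oscillator `H₀ = -∂ₓ² + x²` and its Sobolev scale -/

/-- The `n`-th normalised Hermite function
`hₙ(x) = (n! √π)^(-1/2) Heₙ(√2 x) e^(-x²/2)`, where `Heₙ` is the probabilists' Hermite polynomial;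
equivalently `hₙ(x) = (2ⁿ n! √π)^(-1/2) Hₙ(x) e^(-x²/2)` with the physicists' polynomial `Hₙ`.
These functions form an orthonormal basis of `L²(ℝ)` of eigenfunctions of the harmonic oscillator,
`H₀ hₙ = (2n + 1) hₙ`. -/
def hermiteFun (n : ℕ) (x : ℝ) : ℝ :=
  Polynomial.aeval (Real.sqrt 2 * x) (Polynomial.hermite n) * Real.exp (-x ^ 2 / 2) /
    Real.sqrt (n.factorial * Real.sqrt Real.pi)

/-- The `n`-th Hermite coefficient `⟨hₙ, ψ⟩` of `ψ ∈ L²(ℝ)`. -/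
def hermiteCoeff (ψ : L2R) (n : ℕ) : ℂ :=
  pairing (fun x => (hermiteFun n x : ℂ)) ψ

/-- The space `ℋˢ = {ψ ∈ L²(ℝ) : H₀^(s/2) ψ ∈ L²(ℝ)}`. By the spectral decomposition of `H₀`,
`H₀^(s/2) ψ = ∑ₙ (2n+1)^(s/2) ⟨hₙ, ψ⟩ hₙ`, and this belongs to `L²(ℝ)` if and only if its
coefficients are square summable. -/
def sobolevSpace (s : ℝ) : Set L2R :=
  {ψ | Summable fun n : ℕ => (2 * (n : ℝ) + 1) ^ s * ‖hermiteCoeff ψ n‖ ^ 2}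

/-- The Sobolev norm `‖ψ‖ₛ = ‖H₀^(s/2) ψ‖_{L²}` of `ψ ∈ ℋˢ`. -/
def sobolevNorm (s : ℝ) (ψ : L2R) : ℝ :=
  Real.sqrt (∑' n : ℕ, (2 * (n : ℝ) + 1) ^ s * ‖hermiteCoeff ψ n‖ ^ 2)

/-! ### The Schrödinger equation with quadratic symbol -/

/-- The momentum operator `-i ∂ₓ`. -/
def momentum (f : ℝ → ℂ) (x : ℝ) : ℂ :=
  -Complex.I * deriv f x

/-- The position operator, multiplication by `x`. -/
def position (f : ℝ → ℂ) (x : ℝ) : ℂ :=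
  (x : ℂ) * f x

/-- The Weyl quantization `½ (a x² + b x·(-i∂ₓ) + b (-i∂ₓ)·x + c (-i∂ₓ)²)` of the symbol
`½ (a x² + b x·ξ + b ξ·x + c ξ²)`. -/
def weylOp (a b c : ℝ) (f : ℝ → ℂ) (x : ℝ) : ℂ :=
  (1 / 2 : ℂ) * ((a : ℂ) * position (position f) x + (b : ℂ) * position (momentum f) x +
    (b : ℂ) * momentum (position f) x + (c : ℂ) * momentum (momentum f) x)

/-- `u` is a (weak) solution, continuous in time with values in `L²(ℝ)`, of
`i ∂ₜ u = Lᵂ(ωt, x, -i∂ₓ) u` for `t ≥ 0`: for every Schwartz function `φ`,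
`i d/dt ⟨φ, u(t)⟩ = ⟨Lᵂ(ωt) φ, u(t)⟩` (the operator `Lᵂ` is symmetric). -/
def IsSolution {d : ℕ} (ω : Fin d → ℝ) (a b c : (Fin d → ℝ) → ℝ) (u : ℝ → L2R) : Prop :=
  ContinuousOn u (Ici 0) ∧
    ∀ φ : 𝓢(ℝ, ℂ), ∀ t : ℝ, 0 ≤ t →
      HasDerivWithinAt (fun τ => pairing φ (u τ))
        (-Complex.I * pairing (weylOp (a (t • ω)) (b (t • ω)) (c (t • ω)) φ) (u t)) (Ici 0) t

/-! ### Quasi-periodic linear systems -/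

/-- `f ∈ C^ω((ℝ/pℤ)^d, ℝ)`: a real-analytic function on `ℝ^d` with period `p` in every variable.
`p = 1` gives `C^ω(𝕋^d, ℝ)` and `p = 2` gives `C^ω(2𝕋^d, ℝ)`. -/
def IsAnalyticPeriodic {d : ℕ} (p : ℝ) (f : (Fin d → ℝ) → ℝ) : Prop :=
  AnalyticOnNhd ℝ f univ ∧ ∀ (θ : Fin d → ℝ) (n : Fin d → ℤ), f (θ + fun i => p * n i) = f θ

/-- `Z ∈ C^ω(2𝕋^d, sl(2,ℝ))`. -/
def IsAnalyticSl {d : ℕ} (Z : (Fin d → ℝ) → Matrix (Fin 2) (Fin 2) ℝ) : Prop :=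
  (∀ i j, IsAnalyticPeriodic 2 fun θ => Z θ i j) ∧ ∀ θ, (Z θ).trace = 0

/-- The matrix `A = (b, c; -a, -b)` of the classical linear system. -/
def systemMatrix {d : ℕ} (a b c : (Fin d → ℝ) → ℝ) (θ : Fin d → ℝ) : Matrix (Fin 2) (Fin 2) ℝ :=
  !![b θ, c θ; -a θ, -b θ]

/-- `(ω, A₁(·))` is conjugated to `(ω, A₂(·))` by `Y`:
`d/dt Y(ωt) = A₁(ωt) Y(ωt) - Y(ωt) A₂(ωt)` for all `t ∈ ℝ`, entry by entry. -/
def IsConjugatedBy {d : ℕ} (ω : Fin d → ℝ) (A₁ A₂ Y : (Fin d → ℝ) → Matrix (Fin 2) (Fin 2) ℝ) :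
    Prop :=
  ∀ (t : ℝ) (i j : Fin 2), HasDerivAt (fun τ : ℝ => Y (τ • ω) i j)
    ((A₁ (t • ω) * Y (t • ω) - Y (t • ω) * A₂ (t • ω)) i j) t

/-- The ordered product `e^{Z₀} e^{Z₁} ⋯ e^{Z_K}`. -/
def expProd {d K : ℕ} (Z : Fin (K + 1) → (Fin d → ℝ) → Matrix (Fin 2) (Fin 2) ℝ)
    (θ : Fin d → ℝ) : Matrix (Fin 2) (Fin 2) ℝ :=
  (List.ofFn fun j => NormedSpace.exp (Z j θ)).prod

/-- Similarity of real `2 × 2` matrices. -/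
def IsSimilar (M N : Matrix (Fin 2) (Fin 2) ℝ) : Prop :=
  ∃ P : Matrix (Fin 2) (Fin 2) ℝ, IsUnit P.det ∧ M = P * N * P⁻¹

end QuadraticSchrodinger

end

/-!
The equation is the quantization of the linear Hamiltonian system `Φ' = A(ωt) Φ` in the plane, and
its propagator is the metaplectic operator attached to the fundamental matrix. So the proof has two
halves: the norm `‖u(t)‖ₛ` is comparable to `‖Φ(t)‖ˢ`, and `‖Φ(t)‖` is comparable to `‖e^{tB}‖`.

**Propagator.** Write `Φ ∈ SL(2, ℝ)` as a lower triangular matrix times a rotation. The triangular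
factor is quantized by a dilation followed by multiplication with a chirp (`dil`), the rotation by
`e^(-iθH₀/2)`, which is diagonal in the Hermite basis (`rot`). Along the flow the three parameters
satisfy explicit differential equations (`isIwasawaFlow_of_matrix`), and the image of a Hermite
function is a polynomial times a Gaussian, for which the equation is verified directly
(`hasDerivAt_stateS`). Unitarity and density extend this to all initial data
(`isWeakSol_metaplectic`). A weak solution has a constant pairing with each of the transported
Hermite functions, which form a basis, so it is unique (`eq_metaplectic_of_isWeakSol`).

**Sobolev norms.** Rotations preserve `‖·‖ₛ`. By the Cartan decomposition a metaplectic operator is,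
up to rotations on both sides, a dilation by some `ρ ≥ 1` comparable to `‖Φ‖`
(`exists_rot_metaplectic_eq_dil`); that rotations compose with metaplectic operators as the matrices
do follows from uniqueness for the harmonic oscillator. It remains to bound a dilation.

* From above, `‖dil f‖ₛ ≤ C ρˢ ‖f‖ₛ` (`exists_sobolevNorm_dil_le`). For integer exponents it
  follows by induction from the fact that a dilation mixes the creation and annihilation operators
  with coefficients `cosh ℓ` and `sinh ℓ`, `ρ = e^ℓ`. Real exponents are reached by interpolation:
  the estimate for a large integer controls the tails of the Hermite coefficients, and these are
  integrated against `s E^(s-1) dE` (`sum_rpow_le_of_tail_le`).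
* From below, `‖dil (rot f)‖ₛ ≥ m ρˢ`, uniformly in the rotation (`exists_sobolevNorm_dil_rot_ge`).
  The rotations of `f ≠ 0` form a compact set, so they all carry a definite mass away from the
  origin, and after dilation this mass sits at distances of order `ρ` or more. The span of the Hermite
  functions of index below `κ ρ²`, with `κ` small, cannot carry so much mass there, because `x²` is
  bounded by `2 κ ρ²` on it. Hence a definite part of the mass has energy at least `κ ρ²`.

**Matrices.** The reduction gives `Φ(t) = Y(ωt) e^{tB} Y(0)⁻¹`, where `Y` and `Y⁻¹` are bounded
because they are continuous and periodic. Since `B² = -det B`, the exponential `e^{tB}` is an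
explicit combination of `1` and `B`, and the three cases are read off.
-/

namespace QuadraticSchrodinger

/-! ### Polynomials times Gaussians -/

open Polynomial in
/-- The function `P(x) e^(-β x²/2)` for a complex polynomial `P` and `β ∈ ℂ`. -/
noncomputable def polyGauss (P : ℂ[X]) (β : ℂ) (x : ℝ) : ℂ :=
  P.eval (x : ℂ) * Complex.exp (-β * (x : ℂ) ^ 2 / 2)

theorem hasDerivAt_polyGauss (P : Polynomial ℂ) (β : ℂ) (x : ℝ) :
    HasDerivAt (polyGauss P β)
      (polyGauss (Polynomial.derivative P - Polynomial.C β * Polynomial.X * P) β x) x := by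
  have h1 : HasDerivAt (fun y : ℝ => P.eval (y : ℂ)) (P.derivative.eval (x : ℂ)) x :=
    (P.hasDerivAt (x : ℂ)).comp_ofReal
  have h2 : HasDerivAt (fun z : ℂ => Complex.exp (-β * z ^ 2 / 2))
      (Complex.exp (-β * (x : ℂ) ^ 2 / 2) * (-β * (2 * (x : ℂ)) / 2)) (x : ℂ) := by
    have := (((hasDerivAt_pow 2 (x : ℂ)).const_mul (-β)).div_const 2).cexp
    simpa using this
  convert! h1.mul h2.comp_ofReal using 1
  simp only [polyGauss, Polynomial.eval_sub, Polynomial.eval_mul, Polynomial.eval_C,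
    Polynomial.eval_X]
  ring

theorem deriv_polyGauss (P : Polynomial ℂ) (β : ℂ) :
    deriv (polyGauss P β) =
      polyGauss (Polynomial.derivative P - Polynomial.C β * Polynomial.X * P) β :=
  funext fun x => (hasDerivAt_polyGauss P β x).deriv

theorem contDiff_polyGauss (P : Polynomial ℂ) (β : ℂ) {n : WithTop ℕ∞} :
    ContDiff ℝ n (polyGauss P β) := by
  have h : ContDiff ℝ n (fun x : ℝ => (x : ℂ)) := Complex.ofRealCLM.contDiff
  have hP : ContDiff ℝ n (fun x : ℝ => P.eval (x : ℂ)) := by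
    have : ContDiff ℝ n (fun z : ℂ => P.eval z) := by
      simpa using (Polynomial.contDiff_aeval P n (𝕜 := ℂ)).restrict_scalars ℝ
    exact this.comp h
  have he : ContDiff ℝ n (fun x : ℝ => Complex.exp (-β * (x : ℂ) ^ 2 / 2)) := by
    fun_prop
  exact hP.mul he

theorem exists_iteratedDeriv_polyGauss (P : Polynomial ℂ) (β : ℂ) (n : ℕ) :
    ∃ Q : Polynomial ℂ, iteratedDeriv n (polyGauss P β) = polyGauss Q β := by
  induction n with
  | zero => exact ⟨P, by simp⟩
  | succ n ih =>
    obtain ⟨Q, hQ⟩ := ih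
    exact ⟨_, by rw [iteratedDeriv_succ, hQ, deriv_polyGauss]⟩

/-- Monomials are dominated by Gaussians of any width. -/
theorem exists_pow_le_exp_sq (k : ℕ) {b : ℝ} (hb : 0 < b) :
    ∃ C : ℝ, 0 < C ∧ ∀ x : ℝ, |x| ^ k ≤ C * Real.exp (b * x ^ 2) := by
  refine ⟨1 + k.factorial / b ^ k, by positivity, fun x => ?_⟩
  have h1 : |x| ^ k ≤ 1 + (x ^ 2) ^ k := by
    have : (x ^ 2) ^ k = (|x| ^ k) ^ 2 := by rw [← sq_abs]; ring
    rw [this]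
    nlinarith [sq_nonneg (|x| ^ k - 1), pow_nonneg (abs_nonneg x) k]
  have h2 : (b * x ^ 2) ^ k / k.factorial ≤ Real.exp (b * x ^ 2) :=
    Real.pow_div_factorial_le_exp _ (by positivity) _
  have h3 : (1 : ℝ) ≤ Real.exp (b * x ^ 2) := Real.one_le_exp (by positivity)
  have h4 : (x ^ 2) ^ k = k.factorial / b ^ k * ((b * x ^ 2) ^ k / k.factorial) := by
    rw [mul_pow]; field_simp
  calc |x| ^ k ≤ 1 + (x ^ 2) ^ k := h1
    _ ≤ Real.exp (b * x ^ 2) + k.factorial / b ^ k * Real.exp (b * x ^ 2) := by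
        rw [h4]; gcongr
    _ = _ := by ring

theorem exists_polynomial_le_exp_sq (P : Polynomial ℂ) {b : ℝ} (hb : 0 < b) :
    ∃ C : ℝ, 0 < C ∧ ∀ x : ℝ, ‖P.eval (x : ℂ)‖ ≤ C * Real.exp (b * x ^ 2) := by
  induction P using Polynomial.induction_on' with
  | add p q hp hq =>
    obtain ⟨C, hC, h⟩ := hp
    obtain ⟨D, hD, h'⟩ := hq
    refine ⟨C + D, by positivity, fun x => ?_⟩
    rw [Polynomial.eval_add, add_mul]
    exact (norm_add_le _ _).trans (add_le_add (h x) (h' x))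
  | monomial n a =>
    obtain ⟨C, hC, h⟩ := exists_pow_le_exp_sq n hb
    refine ⟨(‖a‖ + 1) * C, by positivity, fun x => ?_⟩
    rw [Polynomial.eval_monomial, norm_mul, norm_pow, Complex.norm_real, Real.norm_eq_abs, mul_assoc]
    have := h x
    gcongr
    linarith

theorem norm_exp_gauss (β : ℂ) (x : ℝ) :
    ‖Complex.exp (-β * (x : ℂ) ^ 2 / 2)‖ = Real.exp (-β.re * x ^ 2 / 2) := by
  rw [Complex.norm_exp]
  congr 1
  have : (-β * (x : ℂ) ^ 2 / 2) = ((x ^ 2 / 2 : ℝ) : ℂ) * (-β) := by push_cast; ring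
  rw [this, Complex.re_ofReal_mul, Complex.neg_re]
  ring

theorem exists_polyGauss_le (P : Polynomial ℂ) {β : ℂ} (hβ : 0 < β.re) :
    ∃ C : ℝ, 0 < C ∧ ∀ x : ℝ, ‖polyGauss P β x‖ ≤ C * Real.exp (-β.re / 4 * x ^ 2) := by
  obtain ⟨C, hC, h⟩ := exists_polynomial_le_exp_sq P (b := β.re / 4) (by positivity)
  refine ⟨C, hC, fun x => ?_⟩
  rw [polyGauss, norm_mul, norm_exp_gauss]
  calc _ ≤ C * Real.exp (β.re / 4 * x ^ 2) * Real.exp (-β.re * x ^ 2 / 2) := by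
        gcongr; exact h x
    _ = _ := by rw [mul_assoc, ← Real.exp_add]; congr 2; ring

/-- `P(x) e^(-β x²/2)` with `Re β > 0` as a Schwartz function. -/
noncomputable def polyGaussS (P : Polynomial ℂ) (β : ℂ) (hβ : 0 < β.re) : 𝓢(ℝ, ℂ) where
  toFun := polyGauss P β
  smooth' := contDiff_polyGauss P β
  decay' k n := by
    obtain ⟨Q, hQ⟩ := exists_iteratedDeriv_polyGauss P β n
    obtain ⟨C, hC, h⟩ := exists_polyGauss_le (Polynomial.X ^ k * Q) hβ
    refine ⟨C, fun x => ?_⟩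
    rw [norm_iteratedFDeriv_eq_norm_iteratedDeriv, hQ]
    have h1 : ‖x‖ ^ k * ‖polyGauss Q β x‖ = ‖polyGauss (Polynomial.X ^ k * Q) β x‖ := by
      simp [polyGauss, mul_assoc]
    rw [h1]
    refine (h x).trans (mul_le_of_le_one_right hC.le ?_)
    rw [Real.exp_le_one_iff]
    nlinarith [sq_nonneg x]

@[simp]
theorem polyGaussS_apply (P : Polynomial ℂ) (β : ℂ) (hβ : 0 < β.re) (x : ℝ) :
    polyGaussS P β hβ x = polyGauss P β x := rfl

/-! ### Hermite functions and the ladder operators -/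

theorem sqrt_factorial_succ (n : ℕ) :
    Real.sqrt ((n + 1).factorial * Real.sqrt Real.pi) =
      Real.sqrt (n + 1) * Real.sqrt (n.factorial * Real.sqrt Real.pi) := by
  rw [← Real.sqrt_mul (by positivity), Nat.factorial_succ]
  push_cast
  ring_nf

theorem derivative_hermite_succ (n : ℕ) :
    Polynomial.derivative (Polynomial.hermite (n + 1)) =
      ((n : Polynomial ℤ) + 1) * Polynomial.hermite n := by
  induction n with
  | zero => simp
  | succ n ih =>
    rw [Polynomial.hermite_succ (n + 1), Polynomial.derivative_sub, Polynomial.derivative_mul, ih,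
      Polynomial.derivative_mul, Polynomial.hermite_succ n]
    simp
    ring

/-- The derivative of `hₙ` is `x hₙ - √(2(n+1)) hₙ₊₁`, i.e. `x - ∂ₓ` raises the index. -/
theorem hasDerivAt_hermiteFun (n : ℕ) (x : ℝ) :
    HasDerivAt (hermiteFun n)
      (x * hermiteFun n x - Real.sqrt (2 * (n + 1)) * hermiteFun (n + 1) x) x := by
  have h1 : HasDerivAt (fun y : ℝ => Polynomial.aeval (Real.sqrt 2 * y) (Polynomial.hermite n))
      (Polynomial.aeval (Real.sqrt 2 * x) (Polynomial.derivative (Polynomial.hermite n)) *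
        Real.sqrt 2) x := by
    have h2 : HasDerivAt (fun y : ℝ => Real.sqrt 2 * y) (Real.sqrt 2) x := by
      simpa using (hasDerivAt_id x).const_mul (Real.sqrt 2)
    exact ((Polynomial.hermite n).hasDerivAt_aeval (Real.sqrt 2 * x)).comp x h2
  have h3 : HasDerivAt (fun y : ℝ => Real.exp (-y ^ 2 / 2)) (Real.exp (-x ^ 2 / 2) * (-x)) x := by
    have := (((hasDerivAt_pow 2 x).neg).div_const 2).exp
    convert! this using 1
    simp
    ring
  have h4 := (h1.mul h3).div_const (Real.sqrt (n.factorial * Real.sqrt Real.pi))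
  convert! h4 using 1
  have hs : Real.sqrt (n + 1) ≠ 0 := by positivity
  have hs2 : Real.sqrt (n.factorial * Real.sqrt Real.pi) ≠ 0 := by positivity
  have h5 : Real.sqrt (2 * (n + 1)) = Real.sqrt 2 * Real.sqrt (n + 1) :=
    Real.sqrt_mul (by norm_num) _
  simp only [hermiteFun, Polynomial.hermite_succ, map_sub, map_mul, Polynomial.aeval_X,
    sqrt_factorial_succ, h5]
  have h7 : Real.sqrt 2 ^ 2 = 2 := Real.sq_sqrt (by norm_num)
  generalize Polynomial.aeval (Real.sqrt 2 * x) (Polynomial.hermite n) = A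
  generalize Polynomial.aeval (Real.sqrt 2 * x) (Polynomial.derivative (Polynomial.hermite n)) = B
  field_simp
  linear_combination (-x * A) * h7

/-- The three-term recurrence of the Hermite functions, with the index shifted by one. -/
theorem hermiteFun_recurrence (n : ℕ) (x : ℝ) :
    2 * x * hermiteFun (n + 1) x = Real.sqrt (2 * (n + 2)) * hermiteFun (n + 2) x +
      Real.sqrt (2 * (n + 1)) * hermiteFun n x := by
  have hs : Real.sqrt (n + 1) ≠ 0 := by positivity
  have hs' : Real.sqrt (n + 2) ≠ 0 := by positivity
  have hs2 : Real.sqrt (n.factorial * Real.sqrt Real.pi) ≠ 0 := by positivity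
  have h5 : Real.sqrt (2 * (n + 1)) = Real.sqrt 2 * Real.sqrt (n + 1) :=
    Real.sqrt_mul (by norm_num) _
  have h5' : Real.sqrt (2 * (n + 2)) = Real.sqrt 2 * Real.sqrt (n + 2) :=
    Real.sqrt_mul (by norm_num) _
  have h6 : Real.sqrt 2 ^ 2 = 2 := Real.sq_sqrt (by norm_num)
  have h7 : Real.sqrt (n + 1) ^ 2 = n + 1 := Real.sq_sqrt (by positivity)
  have h8 : Real.sqrt ((n + 2).factorial * Real.sqrt Real.pi) =
      Real.sqrt (n + 2) * (Real.sqrt (n + 1) * Real.sqrt (n.factorial * Real.sqrt Real.pi)) := by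
    rw [sqrt_factorial_succ (n + 1), sqrt_factorial_succ n]
    congr 2
    push_cast; ring
  have h9 : (Polynomial.aeval (Real.sqrt 2 * x)) (Polynomial.derivative (Polynomial.hermite (n + 1)))
      = (n + 1) * (Polynomial.aeval (Real.sqrt 2 * x)) (Polynomial.hermite n) := by
    rw [derivative_hermite_succ]; simp
  have h10 : (Polynomial.aeval (Real.sqrt 2 * x)) (Polynomial.hermite (n + 2)) =
      Real.sqrt 2 * x * (Polynomial.aeval (Real.sqrt 2 * x)) (Polynomial.hermite (n + 1))
      - (n + 1) * (Polynomial.aeval (Real.sqrt 2 * x)) (Polynomial.hermite n) := by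
    rw [Polynomial.hermite_succ (n + 1), map_sub, h9]; simp
  simp only [hermiteFun, h10, h8, sqrt_factorial_succ, h5, h5']
  generalize (Polynomial.aeval (Real.sqrt 2 * x)) (Polynomial.hermite (n + 1)) = A
  generalize (Polynomial.aeval (Real.sqrt 2 * x)) (Polynomial.hermite n) = B
  field_simp
  linear_combination (-x * A) * h6 - Real.sqrt 2 * B * h7

theorem hermiteFun_recurrence_zero (x : ℝ) :
    2 * x * hermiteFun 0 x = Real.sqrt 2 * hermiteFun 1 x := by
  have h6 : Real.sqrt 2 ^ 2 = 2 := Real.sq_sqrt (by norm_num)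
  simp [hermiteFun]
  linear_combination (-x * Real.exp (-x ^ 2 / 2) / √(√Real.pi)) * h6

/-- Complex polynomial `Pₙ` with `hₙ(x) = Pₙ(x) e^(-x²/2)`. -/
noncomputable def hermitePoly (n : ℕ) : Polynomial ℂ :=
  Polynomial.C ((Real.sqrt (n.factorial * Real.sqrt Real.pi) : ℂ))⁻¹ *
    ((Polynomial.hermite n).map (Int.castRingHom ℂ)).comp
      (Polynomial.C (Real.sqrt 2 : ℂ) * Polynomial.X)

theorem hermitePoly_eval (n : ℕ) (x : ℝ) :
    (hermitePoly n).eval (x : ℂ) =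
      (Polynomial.aeval (Real.sqrt 2 * x) (Polynomial.hermite n) /
        Real.sqrt (n.factorial * Real.sqrt Real.pi) : ℝ) := by
  have h : ((Polynomial.aeval (Real.sqrt 2 * x) (Polynomial.hermite n) : ℝ) : ℂ) =
      Polynomial.aeval ((Real.sqrt 2 * x : ℝ) : ℂ) (Polynomial.hermite n) := by
    have := Polynomial.aeval_algebraMap_apply (A := ℝ) ℂ (Real.sqrt 2 * x) (Polynomial.hermite n)
    simpa using this.symm
  rw [hermitePoly, Polynomial.eval_mul, Polynomial.eval_C, Polynomial.eval_comp,
    Polynomial.eval_mul, Polynomial.eval_C, Polynomial.eval_X, Polynomial.eval_map]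
  push_cast
  rw [h, Polynomial.aeval_def]
  push_cast
  rw [div_eq_inv_mul]
  simp [Polynomial.eval₂_eq_sum]

/-- The Hermite function `hₙ` as a Schwartz function. -/
noncomputable def hermiteS (n : ℕ) : 𝓢(ℝ, ℂ) :=
  polyGaussS (hermitePoly n) 1 (by simp)

theorem hermiteS_apply (n : ℕ) (x : ℝ) : hermiteS n x = (hermiteFun n x : ℂ) := by
  rw [hermiteS, polyGaussS_apply, polyGauss, hermitePoly_eval, hermiteFun]
  have : Complex.exp (-1 * (x : ℂ) ^ 2 / 2) = (Real.exp (-x ^ 2 / 2) : ℝ) := by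
    push_cast; ring_nf
  rw [this, ← Complex.ofReal_mul]
  congr 1
  ring

/-- Multiplication by `x` on Schwartz functions. -/
noncomputable def posS : 𝓢(ℝ, ℂ) →L[ℂ] 𝓢(ℝ, ℂ) :=
  SchwartzMap.smulLeftCLM ℂ (fun x : ℝ => (x : ℂ))

@[simp]
theorem posS_apply (f : 𝓢(ℝ, ℂ)) (x : ℝ) : posS f x = (x : ℂ) * f x := by
  rw [posS, SchwartzMap.smulLeftCLM_apply_apply Function.Complex.hasTemperateGrowth_ofReal, smul_eq_mul]

/-- Differentiation on Schwartz functions. -/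
noncomputable def derS : 𝓢(ℝ, ℂ) →L[ℂ] 𝓢(ℝ, ℂ) := SchwartzMap.derivCLM ℂ ℂ

@[simp]
theorem derS_apply (f : 𝓢(ℝ, ℂ)) (x : ℝ) : derS f x = deriv f x := rfl

theorem derS_hermiteS (n : ℕ) :
    derS (hermiteS n) =
      posS (hermiteS n) - (Real.sqrt (2 * (n + 1)) : ℂ) • hermiteS (n + 1) := by
  ext x
  have h : (hermiteS n : ℝ → ℂ) = fun x => (hermiteFun n x : ℂ) := funext (hermiteS_apply n)
  rw [derS_apply, h, (hasDerivAt_hermiteFun n x).ofReal_comp.deriv]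
  simp [hermiteS_apply]

theorem two_posS_hermiteS_succ (n : ℕ) :
    (2 : ℂ) • posS (hermiteS (n + 1)) = (Real.sqrt (2 * (n + 2)) : ℂ) • hermiteS (n + 2) +
      (Real.sqrt (2 * (n + 1)) : ℂ) • hermiteS n := by
  ext x
  have := congrArg (fun y : ℝ => (y : ℂ)) (hermiteFun_recurrence n x)
  simp only [Complex.ofReal_add, Complex.ofReal_mul] at this
  simp [hermiteS_apply]
  simpa [mul_assoc] using this

theorem two_posS_hermiteS_zero :
    (2 : ℂ) • posS (hermiteS 0) = (Real.sqrt 2 : ℂ) • hermiteS 1 := by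
  ext x
  have := congrArg (fun y : ℝ => (y : ℂ)) (hermiteFun_recurrence_zero x)
  simp only [Complex.ofReal_mul] at this
  simp [hermiteS_apply]
  simpa [mul_assoc] using this

/-- The creation operator `x - ∂ₓ` maps `hₙ` to `√(2(n+1)) hₙ₊₁`. -/
theorem creation_hermiteS (n : ℕ) :
    posS (hermiteS n) - derS (hermiteS n) = (Real.sqrt (2 * (n + 1)) : ℂ) • hermiteS (n + 1) := by
  rw [derS_hermiteS]; abel

/-- The annihilation operator `x + ∂ₓ` maps `hₙ₊₁` to `√(2(n+1)) hₙ`. -/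
theorem annihilation_hermiteS (n : ℕ) :
    posS (hermiteS (n + 1)) + derS (hermiteS (n + 1)) =
      (Real.sqrt (2 * (n + 1)) : ℂ) • hermiteS n := by
  have h := two_posS_hermiteS_succ n
  rw [derS_hermiteS]
  have h2 : ((n + 1 : ℕ) : ℝ) + 1 = n + 2 := by push_cast; ring
  rw [h2, ← add_sub_assoc, ← two_smul ℂ, h]
  abel

theorem annihilation_hermiteS_zero :
    posS (hermiteS 0) + derS (hermiteS 0) = 0 := by
  have h := two_posS_hermiteS_zero
  rw [derS_hermiteS, ← add_sub_assoc, ← two_smul ℂ, h]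
  simp

/-- The `L²` class of a Schwartz function. -/
noncomputable def toL2 (f : 𝓢(ℝ, ℂ)) : L2R := f.toLp 2 volume

theorem coeFn_toL2 (f : 𝓢(ℝ, ℂ)) : toL2 f =ᵐ[volume] f := f.coeFn_toLp 2 volume

theorem toL2_add (f g : 𝓢(ℝ, ℂ)) : toL2 (f + g) = toL2 f + toL2 g := rfl
theorem toL2_sub (f g : 𝓢(ℝ, ℂ)) : toL2 (f - g) = toL2 f - toL2 g := rfl
theorem toL2_smul (c : ℂ) (f : 𝓢(ℝ, ℂ)) : toL2 (c • f) = c • toL2 f := rfl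
theorem toL2_zero : toL2 0 = 0 := rfl

theorem pairing_eq_inner (f : 𝓢(ℝ, ℂ)) (ψ : L2R) : pairing f ψ = inner ℂ (toL2 f) ψ := by
  rw [pairing, L2.inner_def]
  apply integral_congr_ae
  filter_upwards [coeFn_toL2 f] with x hx
  rw [RCLike.inner_apply', hx]

theorem inner_toL2 (f g : 𝓢(ℝ, ℂ)) :
    inner ℂ (toL2 f) (toL2 g) = ∫ x, (starRingEnd ℂ) (f x) * g x := by
  refine (SchwartzMap.inner_toL2_toL2_eq f g volume).trans ?_
  simp only [RCLike.inner_apply']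

theorem inner_posS (f g : 𝓢(ℝ, ℂ)) :
    inner ℂ (toL2 (posS f)) (toL2 g) = inner ℂ (toL2 f) (toL2 (posS g)) := by
  rw [inner_toL2, inner_toL2]
  congr 1
  ext x
  simp
  ring

theorem inner_derS (f g : 𝓢(ℝ, ℂ)) :
    inner ℂ (toL2 (derS f)) (toL2 g) = -inner ℂ (toL2 f) (toL2 (derS g)) := by
  rw [inner_toL2, inner_toL2]
  have := SchwartzMap.integral_bilinear_deriv_right_eq_neg_left f g
    ((ContinuousLinearMap.mul ℝ ℂ).comp (Complex.conjCLE : ℂ →L[ℝ] ℂ))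
  simp at this
  simp [this]

theorem inner_creation (f g : 𝓢(ℝ, ℂ)) :
    inner ℂ (toL2 (posS f - derS f)) (toL2 g) = inner ℂ (toL2 f) (toL2 (posS g + derS g)) := by
  rw [toL2_sub, toL2_add, inner_sub_left, inner_add_right, inner_posS, inner_derS]
  ring

theorem inner_annihilation (f g : 𝓢(ℝ, ℂ)) :
    inner ℂ (toL2 (posS f + derS f)) (toL2 g) = inner ℂ (toL2 f) (toL2 (posS g - derS g)) := by
  rw [toL2_sub, toL2_add, inner_sub_right, inner_add_left, inner_posS, inner_derS]
  ring

theorem inner_hermite_zero : inner ℂ (toL2 (hermiteS 0)) (toL2 (hermiteS 0)) = 1 := by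
  rw [inner_toL2]
  have h1 : ∀ x : ℝ, (starRingEnd ℂ) (hermiteS 0 x) * hermiteS 0 x =
      ((Real.sqrt Real.pi)⁻¹ * Real.exp (-1 * x ^ 2) : ℝ) := by
    intro x
    rw [hermiteS_apply, Complex.conj_ofReal, ← Complex.ofReal_mul]
    congr 1
    have h2 : Real.sqrt (Real.sqrt Real.pi) * Real.sqrt (Real.sqrt Real.pi) = Real.sqrt Real.pi :=
      Real.mul_self_sqrt (by positivity)
    have h3 : Real.exp (-1 * x ^ 2) = Real.exp (-x ^ 2 / 2) * Real.exp (-x ^ 2 / 2) := by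
      rw [← Real.exp_add]; congr 1; ring
    simp only [hermiteFun, Polynomial.hermite_zero, map_one, Nat.factorial_zero, Nat.cast_one,
      one_mul]
    rw [div_mul_div_comm, h2, h3]
    ring
  simp_rw [h1]
  rw [integral_complex_ofReal, integral_const_mul, integral_gaussian, div_one,
    inv_mul_cancel₀ (by positivity), Complex.ofReal_one]

theorem inner_hermite (m n : ℕ) :
    inner ℂ (toL2 (hermiteS m)) (toL2 (hermiteS n)) = if m = n then 1 else 0 := by
  have hs : ∀ k : ℕ, (Real.sqrt (2 * (k + 1)) : ℂ) ≠ 0 := fun k => by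
    rw [Complex.ofReal_ne_zero]; positivity
  induction n generalizing m with
  | zero =>
    cases m with
    | zero => simpa using inner_hermite_zero
    | succ m =>
      have h := inner_creation (hermiteS m) (hermiteS 0)
      rw [creation_hermiteS, annihilation_hermiteS_zero, toL2_smul, inner_smul_left, toL2_zero,
        inner_zero_right, Complex.conj_ofReal] at h
      simpa using (mul_eq_zero.mp h).resolve_left (hs m)
  | succ n ih =>
    cases m with
    | zero =>
      have h := inner_annihilation (hermiteS 0) (hermiteS n)
      rw [creation_hermiteS, annihilation_hermiteS_zero, toL2_smul, inner_smul_right, toL2_zero,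
        inner_zero_left] at h
      have := (mul_eq_zero.mp h.symm).resolve_left (hs n)
      simpa using this
    | succ m =>
      have h := inner_annihilation (hermiteS (m + 1)) (hermiteS n)
      rw [creation_hermiteS, annihilation_hermiteS, toL2_smul, toL2_smul, inner_smul_right,
        inner_smul_left, ih, Complex.conj_ofReal] at h
      have h2 := mul_left_cancel₀ (hs n) (b := inner ℂ (toL2 (hermiteS (m + 1)))
        (toL2 (hermiteS (n + 1)))) (c := if m = n then 1 else 0) (by
          rw [← h]
          by_cases hmn : m = n
          · simp [hmn]
          · simp [hmn])
      simpa using h2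

/-! ### Completeness of the Hermite functions -/

theorem posS_hermiteS_succ (n : ℕ) :
    posS (hermiteS (n + 1)) = (2⁻¹ * Real.sqrt (2 * (n + 2)) : ℂ) • hermiteS (n + 2) +
      (2⁻¹ * Real.sqrt (2 * (n + 1)) : ℂ) • hermiteS n := by
  have h := congrArg (fun f => (2⁻¹ : ℂ) • f) (two_posS_hermiteS_succ n)
  simpa [smul_smul] using h

theorem posS_hermiteS_zero :
    posS (hermiteS 0) = (2⁻¹ * Real.sqrt 2 : ℂ) • hermiteS 1 := by
  have h := congrArg (fun f => (2⁻¹ : ℂ) • f) two_posS_hermiteS_zero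
  simpa only [smul_smul, inv_mul_cancel₀ (two_ne_zero' ℂ), one_smul] using h

/-- A function orthogonal to all Hermite functions is orthogonal to all `xᵏ hₙ`. -/
theorem inner_posS_pow_hermiteS_eq_zero (f : L2R) (hf : ∀ n, inner ℂ (toL2 (hermiteS n)) f = 0)
    (k n : ℕ) : inner ℂ (toL2 ((posS ^ k) (hermiteS n))) f = 0 := by
  induction k generalizing n with
  | zero => simpa using hf n
  | succ k ih =>
    rw [pow_succ, mul_apply_eq_comp]
    cases n with
    | zero => rw [posS_hermiteS_zero, map_smul, toL2_smul, inner_smul_left, ih, mul_zero]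
    | succ n =>
      rw [posS_hermiteS_succ, map_add, map_smul, map_smul, toL2_add, toL2_smul, toL2_smul,
        inner_add_left, inner_smul_left, inner_smul_left, ih, ih, mul_zero, mul_zero, add_zero]

theorem posS_pow_apply (k : ℕ) (f : 𝓢(ℝ, ℂ)) (x : ℝ) :
    (posS ^ k) f x = (x : ℂ) ^ k * f x := by
  induction k with
  | zero => simp
  | succ k ih => rw [pow_succ', mul_apply_eq_comp, posS_apply, ih]; ring

open scoped ContDiff in
/-- An integrable function with vanishing Fourier transform vanishes almost everywhere. -/
theorem ae_eq_zero_of_fourier_eq_zero (g : ℝ → ℂ) (hg : Integrable g)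
    (h : ∀ ξ : ℝ, FourierTransform.fourier g ξ = 0) : g =ᵐ[volume] 0 := by
  apply ae_eq_zero_of_integral_contDiff_smul_eq_zero hg.locallyIntegrable
  intro χ hχ hχc
  have h1 : HasCompactSupport (Complex.ofRealCLM ∘ χ) := hχc.comp_left rfl
  have h2 : ContDiff ℝ ∞ (Complex.ofRealCLM ∘ χ) := by fun_prop
  set η : 𝓢(ℝ, ℂ) := h1.toSchwartzMap h2
  set ζ : 𝓢(ℝ, ℂ) := FourierTransformInv.fourierInv η
  have h3 : ∫ ξ, FourierTransform.fourier g ξ * ζ ξ = ∫ x, g x * FourierTransform.fourier (ζ : ℝ → ℂ) x := by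
    simpa using! VectorFourier.integral_bilin_fourierIntegral_eq_flip
      (ContinuousLinearMap.mul ℂ ℂ) (L := innerₗ ℝ) Real.continuous_fourierChar continuous_inner
      hg ζ.integrable
  have h4 : FourierTransform.fourier (ζ : ℝ → ℂ) = η := by
    rw [← SchwartzMap.fourier_coe]
    simp [ζ]
  rw [h4] at h3
  simp only [h, zero_mul, integral_zero] at h3
  rw [h3]
  congr 1
  ext x
  simp [η, mul_comm]

theorem memLp_exp_mul_gauss (A : ℝ) :
    MemLp (fun x : ℝ => Real.exp (A * |x|) * Real.exp (-x ^ 2 / 2)) 2 := by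
  have h := (polyGaussS 1 (1 / 2) (by norm_num)).memLp 2 (volume : Measure ℝ)
  refine (h.const_mul (Real.exp (A ^ 2) : ℂ)).of_le (by fun_prop) (ae_of_all _ fun x => ?_)
  rw [norm_mul, norm_mul, polyGaussS_apply, polyGauss, Polynomial.eval_one, one_mul,
    norm_exp_gauss, Complex.norm_real]
  simp only [Real.norm_eq_abs, Real.abs_exp]
  rw [← Real.exp_add, ← Real.exp_add, Real.exp_le_exp]
  norm_num
  rw [← sq_abs x]
  nlinarith [sq_nonneg (|x| / 2 - A)]

theorem hermiteFun_zero (x : ℝ) :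
    hermiteFun 0 x = (Real.sqrt (Real.sqrt Real.pi))⁻¹ * Real.exp (-x ^ 2 / 2) := by
  simp [hermiteFun]; ring

/-- The Hermite functions are complete: the Fourier transform of `h₀ f` has vanishing Taylor
coefficients, and it is given by its Taylor series since `h₀` decays faster than exponentially. -/
theorem eq_zero_of_inner_hermiteS_eq_zero (f : L2R)
    (hf : ∀ n, inner ℂ (toL2 (hermiteS n)) f = 0) : f = 0 := by
  have hfm : MemLp (f : ℝ → ℂ) 2 volume := Lp.memLp f
  set g : ℝ → ℂ := fun x => (hermiteFun 0 x : ℂ) * f x with hg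
  have hdom : ∀ A : ℝ, Integrable (fun x => Real.exp (A * |x|) * ‖g x‖) := by
    intro A
    have h1 := (memLp_exp_mul_gauss A).integrable_mul hfm.norm
    refine (h1.const_mul (Real.sqrt (Real.sqrt Real.pi))⁻¹).congr (ae_of_all _ fun x => ?_)
    simp only [Pi.mul_apply, hg, norm_mul, Complex.norm_real, Real.norm_eq_abs]
    have h2 : 0 ≤ hermiteFun 0 x := by rw [hermiteFun_zero]; positivity
    rw [abs_of_nonneg h2, hermiteFun_zero]
    ring
  have hgm : AEStronglyMeasurable g volume := by
    have : (fun x => (hermiteFun 0 x : ℂ)) = hermiteS 0 := funext fun x => (hermiteS_apply 0 x).symm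
    have h0 : Continuous (fun x => (hermiteFun 0 x : ℂ)) := this ▸ (hermiteS 0).continuous
    exact h0.aestronglyMeasurable.mul hfm.1
  have hgi : Integrable g := by
    have := hdom 0
    simp only [zero_mul, Real.exp_zero, one_mul] at this
    exact (integrable_norm_iff hgm).mp this
  have hmom : ∀ k : ℕ, ∫ x : ℝ, (x : ℂ) ^ k * g x = 0 := by
    intro k
    have := inner_posS_pow_hermiteS_eq_zero f hf k 0
    rw [← pairing_eq_inner, pairing] at this
    rw [← this]
    congr 1
    ext x
    rw [posS_pow_apply, hermiteS_apply, map_mul, map_pow, Complex.conj_ofReal, Complex.conj_ofReal]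
    ring
  have hF : ∀ ξ : ℝ, FourierTransform.fourier g ξ = 0 := by
    intro ξ
    rw [Real.fourier_real_eq_integral_exp_smul]
    have hs := hasSum_integral_of_dominated_convergence (μ := volume)
      (F := fun (k : ℕ) (x : ℝ) => ((-2 * Real.pi * x * ξ : ℝ) * Complex.I) ^ k / k.factorial * g x)
      (f := fun x : ℝ => Complex.exp ((-2 * Real.pi * x * ξ : ℝ) * Complex.I) * g x)
      (bound := fun k x => (|2 * Real.pi * ξ| * |x|) ^ k / k.factorial * ‖g x‖)
      (fun k => by
        refine AEStronglyMeasurable.mul ?_ hgm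
        exact Continuous.aestronglyMeasurable (by fun_prop))
      (fun k => ae_of_all _ fun x => by
        rw [norm_mul, norm_div, norm_pow, norm_mul, Complex.norm_I, Complex.norm_real,
          Complex.norm_natCast, Real.norm_eq_abs, mul_one, ← abs_mul]
        apply le_of_eq
        congr 3
        rw [← abs_neg]; congr 1; ring)
      (ae_of_all _ fun x => (Real.summable_pow_div_factorial _).mul_right _)
      (by
        refine (hdom |2 * Real.pi * ξ|).congr (ae_of_all _ fun x => ?_)
        simp only
        rw [tsum_mul_right, Real.exp_eq_exp_ℝ, NormedSpace.exp_eq_tsum_div])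
      (ae_of_all _ fun x => by
        refine HasSum.mul_right _ ?_
        rw [Complex.exp_eq_exp_ℂ]
        exact NormedSpace.expSeries_div_hasSum_exp _)
    have hz : ∀ k : ℕ, ∫ x : ℝ, ((-2 * Real.pi * x * ξ : ℝ) * Complex.I) ^ k / k.factorial * g x = 0 := by
      intro k
      have : ∀ x : ℝ, ((-2 * Real.pi * x * ξ : ℝ) * Complex.I) ^ k / k.factorial * g x =
          (((-2 * Real.pi * ξ : ℝ) * Complex.I) ^ k / k.factorial) * ((x : ℂ) ^ k * g x) := by
        intro x; push_cast; ring
      simp_rw [this]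
      rw [integral_const_mul, hmom, mul_zero]
    simp only [hz] at hs
    simp only [smul_eq_mul]
    exact (hs.unique hasSum_zero)
  have h0 := ae_eq_zero_of_fourier_eq_zero g hgi hF
  rw [Lp.eq_zero_iff_ae_eq_zero]
  filter_upwards [h0] with x hx
  have : (hermiteFun 0 x : ℂ) ≠ 0 := by
    rw [Complex.ofReal_ne_zero, hermiteFun_zero]; positivity
  exact (mul_eq_zero.mp hx).resolve_left this

theorem orthonormal_hermite : Orthonormal ℂ fun n => toL2 (hermiteS n) := by
  rw [orthonormal_iff_ite]
  exact fun m n => by rw [inner_hermite]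

/-- The Hermite functions as a Hilbert basis of `L²(ℝ)`. -/
noncomputable def hermiteBasis : HilbertBasis ℕ ℂ L2R :=
  HilbertBasis.mkOfOrthogonalEqBot orthonormal_hermite (by
    rw [Submodule.eq_bot_iff]
    intro f hf
    apply eq_zero_of_inner_hermiteS_eq_zero
    intro n
    exact Submodule.inner_right_of_mem_orthogonal (Submodule.subset_span (mem_range_self n)) hf)

theorem hermiteBasis_apply (n : ℕ) : hermiteBasis n = toL2 (hermiteS n) := by
  simp [hermiteBasis]

theorem hermiteCoeff_eq_inner (ψ : L2R) (n : ℕ) :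
    hermiteCoeff ψ n = inner ℂ (hermiteBasis n) ψ := by
  rw [hermiteBasis_apply, ← pairing_eq_inner, hermiteCoeff]
  congr 1
  exact funext fun x => (hermiteS_apply n x).symm

theorem hasSum_hermiteCoeff_sq (ψ : L2R) :
    HasSum (fun n => ‖hermiteCoeff ψ n‖ ^ 2) (‖ψ‖ ^ 2) := by
  have h := hermiteBasis.hasSum_inner_mul_inner ψ ψ
  rw [inner_self_eq_norm_sq_to_K] at h
  rw [← Complex.hasSum_ofReal]
  push_cast
  convert! h using 2 with n
  rw [hermiteCoeff_eq_inner, ← inner_conj_symm ψ, RCLike.conj_mul]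
  rfl

/-! ### Chirps and dilations -/

/-- The multiplier `e^(-ℓ/2) e^(iγx²/2)`. -/
noncomputable def chirp (γ ℓ : ℝ) (x : ℝ) : ℂ :=
  (Real.exp (-ℓ / 2) : ℂ) * Complex.exp (Complex.I * γ * (x : ℂ) ^ 2 / 2)

theorem norm_chirp (γ ℓ x : ℝ) : ‖chirp γ ℓ x‖ = Real.exp (-ℓ / 2) := by
  have : Complex.I * γ * (x : ℂ) ^ 2 / 2 = ((γ * x ^ 2 / 2 : ℝ) : ℂ) * Complex.I := by
    push_cast; ring
  rw [chirp, norm_mul, this, Complex.norm_exp_ofReal_mul_I, mul_one, Complex.norm_real,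
    Real.norm_eq_abs, Real.abs_exp]

theorem continuous_chirp (γ ℓ : ℝ) : Continuous (chirp γ ℓ) := by
  unfold chirp; fun_prop

theorem quasiMeasurePreserving_mul_left_real {a : ℝ} (ha : a ≠ 0) :
    Measure.QuasiMeasurePreserving (fun x : ℝ => a * x) volume volume := by
  refine ⟨measurable_const_mul a, ?_⟩
  rw [Real.map_volume_mul_left ha]
  exact Measure.smul_absolutelyContinuous

theorem memLp_comp_mul_left {f : ℝ → ℂ} (hf : MemLp f 2 volume) {a : ℝ} (ha : a ≠ 0) :
    MemLp (fun x => f (a * x)) 2 volume := by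
  refine MemLp.comp_of_map (f := fun x : ℝ => a * x) (g := f) ?_ (measurable_const_mul a).aemeasurable
  rw [Real.map_volume_mul_left ha]
  exact hf.smul_measure ENNReal.ofReal_ne_top

theorem memLp_chirp_mul (γ ℓ : ℝ) (f : L2R) :
    MemLp (fun x => chirp γ ℓ x * f (Real.exp (-ℓ) * x)) 2 volume := by
  have h := memLp_comp_mul_left (Lp.memLp f) (Real.exp_pos (-ℓ)).ne'
  refine (h.const_mul (Real.exp (-ℓ / 2) : ℂ)).of_le
    ((continuous_chirp γ ℓ).aestronglyMeasurable.mul h.1) (ae_of_all _ fun x => ?_)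
  rw [norm_mul, norm_mul, norm_chirp, Complex.norm_real, Real.norm_eq_abs, Real.abs_exp]

theorem toLp_chirp_mul_congr (γ ℓ : ℝ) {f : L2R} {g : ℝ → ℂ} (h : f =ᵐ[volume] g) :
    (memLp_chirp_mul γ ℓ f).toLp _ =ᵐ[volume] fun x => chirp γ ℓ x * g (Real.exp (-ℓ) * x) := by
  refine (MemLp.coeFn_toLp _).trans ?_
  filter_upwards [(quasiMeasurePreserving_mul_left_real (Real.exp_pos (-ℓ)).ne').ae h] with x hx
  rw [hx]

/-- The unitary operator `f ↦ e^(-ℓ/2) e^(iγx²/2) f(e^(-ℓ) x)`, as a linear map. -/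
noncomputable def dilLin (γ ℓ : ℝ) : L2R →ₗ[ℂ] L2R where
  toFun f := (memLp_chirp_mul γ ℓ f).toLp _
  map_add' f g := by
    apply Lp.ext
    refine (toLp_chirp_mul_congr γ ℓ (Lp.coeFn_add f g)).trans ?_
    filter_upwards [Lp.coeFn_add ((memLp_chirp_mul γ ℓ f).toLp _) ((memLp_chirp_mul γ ℓ g).toLp _),
      (memLp_chirp_mul γ ℓ f).coeFn_toLp, (memLp_chirp_mul γ ℓ g).coeFn_toLp] with x h1 h2 h3
    rw [h1, Pi.add_apply, Pi.add_apply, h2, h3, mul_add]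
  map_smul' c f := by
    apply Lp.ext
    refine (toLp_chirp_mul_congr γ ℓ (Lp.coeFn_smul c f)).trans ?_
    filter_upwards [Lp.coeFn_smul c ((memLp_chirp_mul γ ℓ f).toLp _),
      (memLp_chirp_mul γ ℓ f).coeFn_toLp] with x h1 h2
    rw [RingHom.id_apply, h1, Pi.smul_apply, Pi.smul_apply, h2, smul_eq_mul, smul_eq_mul]
    ring

theorem coeFn_dilLin (γ ℓ : ℝ) (f : L2R) :
    dilLin γ ℓ f =ᵐ[volume] fun x => chirp γ ℓ x * f (Real.exp (-ℓ) * x) :=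
  (memLp_chirp_mul γ ℓ f).coeFn_toLp

theorem norm_dilLin (γ ℓ : ℝ) (f : L2R) : ‖dilLin γ ℓ f‖ = ‖f‖ := by
  have key : (inner ℂ (dilLin γ ℓ f) (dilLin γ ℓ f) : ℂ) = inner ℂ f f := by
    rw [L2.inner_def, L2.inner_def]
    have h1 : ∫ x, (inner ℂ (dilLin γ ℓ f x) (dilLin γ ℓ f x) : ℂ) =
        ∫ x, (fun y : ℝ => (Real.exp (-ℓ) : ℂ) * inner ℂ (f y) (f y)) (Real.exp (-ℓ) * x) := by
      apply integral_congr_ae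
      filter_upwards [coeFn_dilLin γ ℓ f] with x hx
      simp only [inner_self_eq_norm_sq_to_K]
      rw [hx, norm_mul, norm_chirp]
      have : (Real.exp (-ℓ) : ℂ) = (Real.exp (-ℓ / 2) : ℂ) ^ 2 := by
        rw [← Complex.ofReal_pow, ← Real.exp_nat_mul]; congr 2; ring
      rw [this, RCLike.ofReal_mul, mul_pow]
      rfl
    rw [h1, Measure.integral_comp_mul_left
      (fun y : ℝ => (Real.exp (-ℓ) : ℂ) * inner ℂ (f y) (f y)), integral_const_mul, abs_inv,
      Real.abs_exp, Complex.real_smul, ← mul_assoc, ← Complex.ofReal_mul,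
      inv_mul_cancel₀ (Real.exp_pos _).ne', Complex.ofReal_one, one_mul]
  rw [inner_self_eq_norm_sq_to_K, inner_self_eq_norm_sq_to_K] at key
  have : ‖dilLin γ ℓ f‖ ^ 2 = ‖f‖ ^ 2 := by exact_mod_cast key
  exact (sq_eq_sq₀ (norm_nonneg _) (norm_nonneg _)).mp this

theorem dilLin_dilLin (γ ℓ γ' ℓ' : ℝ) (f : L2R) :
    dilLin γ ℓ (dilLin γ' ℓ' f) = dilLin (γ + Real.exp (-2 * ℓ) * γ') (ℓ + ℓ') f := by
  apply Lp.ext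
  refine (toLp_chirp_mul_congr γ ℓ (coeFn_dilLin γ' ℓ' f)).trans ?_
  filter_upwards [coeFn_dilLin (γ + Real.exp (-2 * ℓ) * γ') (ℓ + ℓ') f] with x hx
  have h3 : Real.exp (-2 * ℓ) = Real.exp (-ℓ) ^ 2 := by rw [← Real.exp_nat_mul]; congr 1; ring
  have h4 : Real.exp (-ℓ') * (Real.exp (-ℓ) * x) = Real.exp (-(ℓ + ℓ')) * x := by
    rw [← mul_assoc, ← Real.exp_add]; congr 2; ring
  rw [hx, h4, ← mul_assoc]
  congr 1
  simp only [chirp, h3]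
  have h5 : Real.exp (-(ℓ + ℓ') / 2) = Real.exp (-ℓ / 2) * Real.exp (-ℓ' / 2) := by
    rw [← Real.exp_add]; congr 1; ring
  rw [h5, mul_mul_mul_comm, ← Complex.exp_add, Complex.ofReal_mul]
  congr 2
  · rw [Complex.ofReal_mul]
  · simp only [Complex.ofReal_add, Complex.ofReal_mul, Complex.ofReal_pow]
    ring

theorem dilLin_zero_zero (f : L2R) : dilLin 0 0 f = f := by
  apply Lp.ext
  filter_upwards [coeFn_dilLin 0 0 f] with x hx
  rw [hx]
  simp [chirp]

/-- The unitary operator `f ↦ e^(-ℓ/2) e^(iγx²/2) f(e^(-ℓ) x)` on `L²(ℝ)`. It quantises the lower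
triangular matrix `(e^ℓ, 0; γ e^ℓ, e^(-ℓ))`. -/
noncomputable def dil (γ ℓ : ℝ) : L2R ≃ₗᵢ[ℂ] L2R where
  toLinearEquiv := LinearEquiv.ofLinearMap (dilLin γ ℓ) (dilLin (-(Real.exp (2 * ℓ) * γ)) (-ℓ))
    (by
      ext1 f
      rw [LinearMap.comp_apply, dilLin_dilLin, mul_neg, ← mul_assoc, ← Real.exp_add]
      simp [dilLin_zero_zero])
    (by
      ext1 f
      rw [LinearMap.comp_apply, dilLin_dilLin]
      simp [dilLin_zero_zero])
  norm_map' := norm_dilLin γ ℓ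

theorem coeFn_dil (γ ℓ : ℝ) (f : L2R) :
    dil γ ℓ f =ᵐ[volume] fun x => chirp γ ℓ x * f (Real.exp (-ℓ) * x) :=
  coeFn_dilLin γ ℓ f

theorem dil_zero_zero (f : L2R) : dil 0 0 f = f := dilLin_zero_zero f

/-! ### Rotations -/

/-- The phase `e^(-i(n+1/2)θ)` by which the rotation of angle `θ` acts on `hₙ`. -/
noncomputable def phase (θ : ℝ) (n : ℕ) : ℂ :=
  Complex.exp (((-((n : ℝ) + 1 / 2) * θ : ℝ) : ℂ) * Complex.I)

theorem norm_phase (θ : ℝ) (n : ℕ) : ‖phase θ n‖ = 1 := Complex.norm_exp_ofReal_mul_I _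

theorem phase_ne_zero (θ : ℝ) (n : ℕ) : phase θ n ≠ 0 := Complex.exp_ne_zero _

theorem conj_phase_mul (θ : ℝ) (n : ℕ) : (starRingEnd ℂ) (phase θ n) * phase θ n = 1 := by
  rw [RCLike.conj_mul, norm_phase]; simp

theorem orthonormal_phase_hermite (θ : ℝ) :
    Orthonormal ℂ fun n => phase θ n • hermiteBasis n := by
  rw [orthonormal_iff_ite]
  intro m n
  rw [inner_smul_left, inner_smul_right, orthonormal_iff_ite.mp hermiteBasis.orthonormal]
  split_ifs with h
  · rw [h, mul_one, conj_phase_mul]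
  · simp

/-- The Hilbert basis `e^(-i(n+1/2)θ) hₙ`. -/
noncomputable def rotBasis (θ : ℝ) : HilbertBasis ℕ ℂ L2R :=
  HilbertBasis.mkOfOrthogonalEqBot (orthonormal_phase_hermite θ) (by
    rw [Submodule.eq_bot_iff]
    intro f hf
    apply eq_zero_of_inner_hermiteS_eq_zero
    intro n
    have h := Submodule.inner_right_of_mem_orthogonal (Submodule.subset_span (mem_range_self n)) hf
    rw [inner_smul_left, hermiteBasis_apply] at h
    exact (mul_eq_zero.mp h).resolve_left (by simpa using phase_ne_zero θ n))

theorem rotBasis_apply (θ : ℝ) (n : ℕ) : rotBasis θ n = phase θ n • hermiteBasis n := by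
  simp [rotBasis]

/-- The rotation `e^(-iθH₀/2)`, i.e. `∑ cₙ hₙ ↦ ∑ e^(-i(n+1/2)θ) cₙ hₙ`. -/
noncomputable def rot (θ : ℝ) : L2R ≃ₗᵢ[ℂ] L2R :=
  hermiteBasis.repr.trans (rotBasis θ).repr.symm

theorem rot_hermiteBasis (θ : ℝ) (n : ℕ) : rot θ (hermiteBasis n) = phase θ n • hermiteBasis n := by
  classical
  rw [rot, LinearIsometryEquiv.trans_apply, HilbertBasis.repr_self, HilbertBasis.repr_symm_single,
    rotBasis_apply]

theorem hermiteCoeff_rot (θ : ℝ) (f : L2R) (n : ℕ) :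
    hermiteCoeff (rot θ f) n = phase θ n * hermiteCoeff f n := by
  have h : inner ℂ (rot θ (hermiteBasis n)) (rot θ f) = inner ℂ (hermiteBasis n) f :=
    (rot θ).inner_map_map _ _
  rw [rot_hermiteBasis, inner_smul_left] at h
  rw [hermiteCoeff_eq_inner, hermiteCoeff_eq_inner, ← h, ← mul_assoc, mul_comm (phase θ n),
    conj_phase_mul, one_mul]

theorem norm_hermiteCoeff_rot (θ : ℝ) (f : L2R) (n : ℕ) :
    ‖hermiteCoeff (rot θ f) n‖ = ‖hermiteCoeff f n‖ := by
  rw [hermiteCoeff_rot, norm_mul, norm_phase, one_mul]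

theorem sobolevNorm_rot (s θ : ℝ) (f : L2R) : sobolevNorm s (rot θ f) = sobolevNorm s f := by
  simp only [sobolevNorm, norm_hermiteCoeff_rot]

theorem rot_mem_sobolevSpace (s θ : ℝ) (f : L2R) :
    rot θ f ∈ sobolevSpace s ↔ f ∈ sobolevSpace s := by
  simp only [sobolevSpace, mem_ofPred_eq, norm_hermiteCoeff_rot]

/-! ### Transformed Hermite functions -/

theorem wave_re_pos (γ ℓ : ℝ) : 0 < ((Real.exp (-2 * ℓ) : ℂ) - Complex.I * γ).re := by
  simp
  rw [← Complex.ofReal_ofNat, ← Complex.ofReal_mul, ← Complex.ofReal_neg, Complex.exp_ofReal_re]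
  positivity

/-- The image `e^(-ℓ/2) e^(iγx²/2) hₙ(e^(-ℓ) x)` of the `n`-th Hermite function under `dil γ ℓ`,
as a Schwartz function. -/
noncomputable def waveS (n : ℕ) (γ ℓ : ℝ) : 𝓢(ℝ, ℂ) :=
  polyGaussS (Polynomial.C (Real.exp (-ℓ / 2) : ℂ) *
    (hermitePoly n).comp (Polynomial.C (Real.exp (-ℓ) : ℂ) * Polynomial.X))
    ((Real.exp (-2 * ℓ) : ℂ) - Complex.I * γ) (wave_re_pos γ ℓ)

theorem waveS_apply (n : ℕ) (γ ℓ x : ℝ) :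
    waveS n γ ℓ x = chirp γ ℓ x * (hermiteFun n (Real.exp (-ℓ) * x) : ℂ) := by
  have h3 : Real.exp (-2 * ℓ) = Real.exp (-ℓ) ^ 2 := by rw [← Real.exp_nat_mul]; congr 1; ring
  rw [← hermiteS_apply, hermiteS, polyGaussS_apply, waveS, polyGaussS_apply, polyGauss, polyGauss,
    chirp, Polynomial.eval_mul, Polynomial.eval_C, Polynomial.eval_comp, Polynomial.eval_mul,
    Polynomial.eval_C, Polynomial.eval_X, h3, mul_assoc, mul_assoc, Complex.ofReal_mul,
    ← mul_assoc (Complex.exp _), mul_comm (Complex.exp (Complex.I * _ * _ / 2)), mul_assoc,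
    ← Complex.exp_add]
  congr 3
  push_cast
  ring_nf

theorem dil_hermiteBasis (n : ℕ) (γ ℓ : ℝ) : dil γ ℓ (hermiteBasis n) = toL2 (waveS n γ ℓ) := by
  apply Lp.ext
  rw [hermiteBasis_apply]
  refine (toLp_chirp_mul_congr γ ℓ (coeFn_toL2 (hermiteS n))).trans ?_
  filter_upwards [coeFn_toL2 (waveS n γ ℓ)] with x hx
  rw [hx, waveS_apply, hermiteS_apply]

open Filter Topology

/-! ### Strong differentiability in `L²` -/

theorem norm_toL2_sq (f : 𝓢(ℝ, ℂ)) : ‖toL2 f‖ ^ 2 = ∫ x, ‖f x‖ ^ 2 := by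
  have h := inner_toL2 f f
  rw [inner_self_eq_norm_sq_to_K] at h
  simp_rw [RCLike.conj_mul] at h
  have h2 : ((‖toL2 f‖ ^ 2 : ℝ) : ℂ) = ((∫ x, ‖f x‖ ^ 2 : ℝ) : ℂ) := by
    rw [← integral_complex_ofReal]
    push_cast
    exact h
  exact_mod_cast h2

/-- Differentiation under the `L²` norm: pointwise differentiability with a square integrable
bound for the derivative gives differentiability in `L²`. -/
theorem hasDerivAt_toL2 (F G : ℝ → 𝓢(ℝ, ℂ)) (g : ℝ → ℝ) (hg : MemLp g 2 volume) (t : ℝ) {ε : ℝ}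
    (hε : 0 < ε) (hF : ∀ τ x, HasDerivAt (fun σ => F σ x) (G τ x) τ)
    (hG : ∀ τ ∈ Metric.ball t ε, ∀ x, ‖G τ x‖ ≤ g x) :
    HasDerivAt (fun τ => toL2 (F τ)) (toL2 (G t)) t := by
  rw [hasDerivAt_iff_tendsto_slope]
  set S : ℝ → 𝓢(ℝ, ℂ) := fun τ => (((τ - t)⁻¹ : ℝ) : ℂ) • (F τ - F t) with hS
  have hslope : slope (fun τ => toL2 (F τ)) t = fun τ => toL2 (S τ) := by
    ext1 τ
    rw [slope_def_module, hS, toL2_smul, toL2_sub]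
    rfl
  rw [hslope, tendsto_iff_norm_sub_tendsto_zero]
  have hSx : ∀ τ x, S τ x = slope (fun σ => F σ x) t τ := by
    intro τ x
    rw [slope_def_module]
    simp [hS]
  have hsq : Tendsto (fun τ => ‖toL2 (S τ) - toL2 (G t)‖ ^ 2) (𝓝[≠] t) (𝓝 0) := by
    have h0 : ∀ τ, ‖toL2 (S τ) - toL2 (G t)‖ ^ 2 = ∫ x, ‖S τ x - G t x‖ ^ 2 := by
      intro τ
      rw [← toL2_sub, norm_toL2_sq]
      rfl
    simp_rw [h0]
    have hz : (0 : ℝ) = ∫ _ : ℝ, (0 : ℝ) := by simp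
    rw [hz]
    refine tendsto_integral_filter_of_dominated_convergence (fun x => (2 * g x) ^ 2) ?_ ?_ ?_ ?_
    · refine Eventually.of_forall fun τ => Continuous.aestronglyMeasurable ?_
      have h1 := (S τ).continuous
      have h2 := (G t).continuous
      fun_prop
    · have hb : ∀ᶠ τ in 𝓝[≠] t, τ ∈ Metric.ball t ε :=
        nhdsWithin_le_nhds (Metric.ball_mem_nhds t hε)
      filter_upwards [hb, self_mem_nhdsWithin] with τ hτ hne
      refine ae_of_all _ fun x => ?_
      have h1 : ‖S τ x‖ ≤ g x := by
        have h2 := (convex_ball t ε).norm_image_sub_le_of_norm_hasDerivWithin_le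
          (f := fun σ => F σ x) (f' := fun σ => G σ x) (C := g x)
          (fun σ _ => (hF σ x).hasDerivWithinAt) (fun σ hσ => hG σ hσ x)
          (Metric.mem_ball_self hε) hτ
        have h3 : 0 < ‖τ - t‖ := norm_pos_iff.mpr (sub_ne_zero.mpr hne)
        have h4 : S τ x = (((τ - t)⁻¹ : ℝ) : ℂ) * (F τ x - F t x) := by simp [hS]
        rw [h4, norm_mul, Complex.norm_real, norm_inv, inv_mul_le_iff₀ h3]
        linarith
      have h2 : ‖G t x‖ ≤ g x := hG t (Metric.mem_ball_self hε) x
      rw [norm_pow, norm_norm]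
      have h5 := norm_sub_le (S τ x) (G t x)
      gcongr
      linarith
    · exact (hg.const_mul 2).integrable_sq
    · refine ae_of_all _ fun x => ?_
      have h1 := (hasDerivAt_iff_tendsto_slope.mp (hF t x))
      have h2 := ((h1.sub_const (G t x)).norm.pow 2)
      simp only [sub_self, norm_zero, ne_eq, OfNat.ofNat_ne_zero, not_false_eq_true, zero_pow] at h2
      refine h2.congr fun τ => ?_
      rw [hSx]
  have h2 := hsq.sqrt
  simpa [Real.sqrt_sq (norm_nonneg _)] using h2

/-! ### The Weyl operator on Schwartz functions -/

/-- The Weyl operator `½ (a x² + b x·(-i∂ₓ) + b (-i∂ₓ)·x + c (-i∂ₓ)²)` on Schwartz functions. -/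
noncomputable def weylS (a b c : ℝ) (f : 𝓢(ℝ, ℂ)) : 𝓢(ℝ, ℂ) :=
  (1 / 2 : ℂ) • ((a : ℂ) • posS (posS f) - (b * Complex.I : ℂ) • (posS (derS f) + derS (posS f)) -
    (c : ℂ) • derS (derS f))

theorem coe_weylS (a b c : ℝ) (f : 𝓢(ℝ, ℂ)) : weylOp a b c f = weylS a b c f := by
  have h1 : momentum f = fun x => -Complex.I * derS f x := rfl
  have h2 : position f = posS f := by ext x; simp [position]
  ext x
  have h3 : momentum (fun x => -Complex.I * derS f x) x = -derS (derS f) x := by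
    have := ((derS f).hasDerivAt x).const_mul (-Complex.I)
    rw [momentum, this.deriv, ← mul_assoc]
    simp
  rw [weylOp, h1, h3, h2]
  simp [weylS, momentum, position]
  ring_nf

theorem inner_weylS (a b c : ℝ) (f g : 𝓢(ℝ, ℂ)) :
    inner ℂ (toL2 (weylS a b c f)) (toL2 g) = inner ℂ (toL2 f) (toL2 (weylS a b c g)) := by
  simp only [weylS, toL2_smul, toL2_sub, toL2_add, inner_smul_left, inner_smul_right,
    inner_sub_left, inner_sub_right, inner_add_left, inner_add_right, inner_posS, inner_derS,
    map_mul, Complex.conj_ofReal, Complex.conj_I, map_div₀, map_one, map_ofNat]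
  ring

theorem pairing_weylOp (a b c : ℝ) (f : 𝓢(ℝ, ℂ)) (ψ : L2R) :
    pairing (weylOp a b c f) ψ = inner ℂ (toL2 (weylS a b c f)) ψ := by
  rw [coe_weylS, pairing_eq_inner]

theorem norm_toL2_weylS_le (a b c : ℝ) (f : 𝓢(ℝ, ℂ)) :
    ‖toL2 (weylS a b c f)‖ ≤ (|a| + |b| + |c|) * (‖toL2 (posS (posS f))‖ +
      ‖toL2 (posS (derS f) + derS (posS f))‖ + ‖toL2 (derS (derS f))‖) := by
  rw [weylS, toL2_smul, toL2_sub, toL2_sub, toL2_smul, toL2_smul, toL2_smul, norm_smul]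
  set X := toL2 (posS (posS f))
  set Y := toL2 (posS (derS f) + derS (posS f))
  set Z := toL2 (derS (derS f))
  have h1 := norm_sub_le ((a : ℂ) • X - (b * Complex.I : ℂ) • Y) ((c : ℂ) • Z)
  have h2 := norm_sub_le ((a : ℂ) • X) ((b * Complex.I : ℂ) • Y)
  rw [norm_smul, norm_smul] at h2
  rw [norm_smul (c : ℂ)] at h1
  simp only [norm_mul, Complex.norm_real, Complex.norm_I, mul_one, Real.norm_eq_abs] at h1 h2
  have h3 : ‖(1 / 2 : ℂ)‖ = 1 / 2 := by norm_num
  rw [h3]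
  have := mul_nonneg (abs_nonneg a) (norm_nonneg Y)
  have := mul_nonneg (abs_nonneg a) (norm_nonneg Z)
  have := mul_nonneg (abs_nonneg a) (norm_nonneg X)
  have := mul_nonneg (abs_nonneg b) (norm_nonneg X)
  have := mul_nonneg (abs_nonneg b) (norm_nonneg Y)
  have := mul_nonneg (abs_nonneg b) (norm_nonneg Z)
  have := mul_nonneg (abs_nonneg c) (norm_nonneg X)
  have := mul_nonneg (abs_nonneg c) (norm_nonneg Y)
  have := mul_nonneg (abs_nonneg c) (norm_nonneg Z)
  nlinarith

/-! ### The evolution of the Hermite functions -/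

/-- Parameters `(γ, ℓ, θ)` of the metaplectic operators `dil γ ℓ ∘ rot θ` following the flow of the
quadratic Hamiltonian with coefficients `a, b, c`: the equations say that the lower triangular
matrix `(e^ℓ, 0; γ e^ℓ, e^(-ℓ))` times the rotation by `θ` solves `Φ' = (b, c; -a, -b) Φ`. -/
structure IsIwasawaFlow (a b c γ ℓ θ : ℝ → ℝ) : Prop where
  cont_a : Continuous a
  cont_b : Continuous b
  cont_c : Continuous c
  hγ : ∀ t, HasDerivAt γ
    (-a t - 2 * b t * γ t - c t * γ t ^ 2 + c t * Real.exp (-4 * ℓ t)) t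
  hℓ : ∀ t, HasDerivAt ℓ (b t + c t * γ t) t
  hθ : ∀ t, HasDerivAt θ (c t * Real.exp (-2 * ℓ t)) t

/-- The derivative of the Hermite function `hₙ`. -/
noncomputable def hermiteDer (n : ℕ) (x : ℝ) : ℝ :=
  x * hermiteFun n x - Real.sqrt (2 * (n + 1)) * hermiteFun (n + 1) x

theorem hasDerivAt_hermiteDer (n : ℕ) (x : ℝ) :
    HasDerivAt (hermiteDer n) ((x ^ 2 - (2 * n + 1)) * hermiteFun n x) x := by
  have h1 := ((hasDerivAt_id x).mul (hasDerivAt_hermiteFun n x)).sub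
    ((hasDerivAt_hermiteFun (n + 1) x).const_mul (Real.sqrt (2 * (n + 1))))
  convert! h1 using 1
  have h2 := hermiteFun_recurrence n x
  have h3 : Real.sqrt (2 * (n + 1)) ^ 2 = 2 * (n + 1) := Real.sq_sqrt (by positivity)
  have h4 : ((n + 1 : ℕ) : ℝ) + 1 = n + 2 := by push_cast; ring
  simp only [h4, id]
  linear_combination Real.sqrt (2 * (n + 1)) * h2 + hermiteFun n x * h3

theorem hasDerivAt_chirp_space (γ ℓ x : ℝ) :
    HasDerivAt (chirp γ ℓ) (chirp γ ℓ x * (Complex.I * γ * x)) x := by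
  have h2 : HasDerivAt (fun z : ℂ => Complex.exp (Complex.I * γ * z ^ 2 / 2))
      (Complex.exp (Complex.I * γ * (x : ℂ) ^ 2 / 2) * (Complex.I * γ * (2 * (x : ℂ)) / 2))
      (x : ℂ) := by
    have := (((hasDerivAt_pow 2 (x : ℂ)).const_mul (Complex.I * γ)).div_const 2).cexp
    simpa using this
  have h3 := (h2.comp_ofReal).const_mul (Real.exp (-ℓ / 2) : ℂ)
  convert! h3 using 1
  rw [chirp]
  ring

theorem hasDerivAt_hermiteFun_scaled (n : ℕ) (p x : ℝ) :
    HasDerivAt (fun y : ℝ => (hermiteFun n (p * y) : ℂ)) ((p * hermiteDer n (p * x) : ℝ) : ℂ) x := by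
  have h1 : HasDerivAt (fun y : ℝ => p * y) p x := by simpa using (hasDerivAt_id x).const_mul p
  have h2 := ((hasDerivAt_hermiteFun n (p * x)).comp x h1).ofReal_comp
  convert! h2 using 2
  rw [hermiteDer, mul_comm]

theorem hasDerivAt_hermiteDer_scaled (n : ℕ) (p x : ℝ) :
    HasDerivAt (fun y : ℝ => (hermiteDer n (p * y) : ℂ))
      ((p * (((p * x) ^ 2 - (2 * n + 1)) * hermiteFun n (p * x)) : ℝ) : ℂ) x := by
  have h1 : HasDerivAt (fun y : ℝ => p * y) p x := by simpa using (hasDerivAt_id x).const_mul p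
  have h2 := ((hasDerivAt_hermiteDer n (p * x)).comp x h1).ofReal_comp
  convert! h2 using 2
  rw [mul_comm]

/-- The derivative of a transformed Hermite function, in terms of `hₙ` and `hₙ′` at the rescaled
point. -/
theorem derS_waveS (n : ℕ) (γ ℓ x : ℝ) :
    derS (waveS n γ ℓ) x = chirp γ ℓ x * (Complex.I * γ * x * hermiteFun n (Real.exp (-ℓ) * x) +
      Real.exp (-ℓ) * hermiteDer n (Real.exp (-ℓ) * x)) := by
  have h0 : (waveS n γ ℓ : ℝ → ℂ) = fun x =>
    chirp γ ℓ x * (hermiteFun n (Real.exp (-ℓ) * x) : ℂ) := funext (waveS_apply n γ ℓ)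
  have h1 := (hasDerivAt_chirp_space γ ℓ x).mul (hasDerivAt_hermiteFun_scaled n (Real.exp (-ℓ)) x)
  rw [derS_apply, h0]
  refine h1.deriv.trans ?_
  rw [Complex.ofReal_mul]
  ring

theorem derS_derS_waveS (n : ℕ) (γ ℓ x : ℝ) :
    derS (derS (waveS n γ ℓ)) x = chirp γ ℓ x *
      ((Complex.I * γ - γ ^ 2 * x ^ 2 + Real.exp (-ℓ) ^ 2 * ((Real.exp (-ℓ) * x) ^ 2 - (2 * n + 1))) *
        hermiteFun n (Real.exp (-ℓ) * x) +
      2 * (Complex.I * γ * x) * Real.exp (-ℓ) * hermiteDer n (Real.exp (-ℓ) * x)) := by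
  have h0 : (derS (waveS n γ ℓ) : ℝ → ℂ) = fun x =>
    chirp γ ℓ x * (Complex.I * γ * x * hermiteFun n (Real.exp (-ℓ) * x) +
      Real.exp (-ℓ) * hermiteDer n (Real.exp (-ℓ) * x)) := funext (derS_waveS n γ ℓ)
  have h1 : HasDerivAt (fun y : ℝ => Complex.I * γ * (y : ℂ)) (Complex.I * γ) x := by
    simpa using (Complex.ofRealCLM.hasDerivAt (x := x)).const_mul (Complex.I * γ)
  have h2 := (hasDerivAt_chirp_space γ ℓ x).mul
    ((h1.mul (hasDerivAt_hermiteFun_scaled n (Real.exp (-ℓ)) x)).add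
      ((hasDerivAt_hermiteDer_scaled n (Real.exp (-ℓ)) x).const_mul (Real.exp (-ℓ) : ℂ)))
  rw [derS_apply, h0]
  refine h2.deriv.trans ?_
  simp only [Complex.ofReal_mul, Complex.ofReal_sub, Complex.ofReal_pow, Complex.ofReal_add,
    Complex.ofReal_natCast, Complex.ofReal_one, Complex.ofReal_ofNat, Pi.add_apply, Pi.mul_apply]
  linear_combination (chirp γ ℓ x * γ ^ 2 * x ^ 2 * hermiteFun n (Real.exp (-ℓ) * x)) *
    Complex.I_sq

theorem derS_posS (f : 𝓢(ℝ, ℂ)) (x : ℝ) : derS (posS f) x = f x + x * derS f x := by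
  have h0 : (posS f : ℝ → ℂ) = fun x : ℝ => (x : ℂ) * f x := funext (posS_apply f)
  have h1 : HasDerivAt (fun y : ℝ => (y : ℂ)) 1 x := Complex.ofRealCLM.hasDerivAt
  rw [derS_apply, h0]
  refine (h1.mul (f.hasDerivAt x)).deriv.trans ?_
  rw [one_mul]
  rfl

/-- The Hermite function `hₙ` transported by the operator `dil γ ℓ ∘ rot θ`. -/
noncomputable def stateS (n : ℕ) (γ ℓ θ : ℝ) : 𝓢(ℝ, ℂ) := phase θ n • waveS n γ ℓ

theorem toL2_stateS (n : ℕ) (γ ℓ θ : ℝ) :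
    toL2 (stateS n γ ℓ θ) = dil γ ℓ (rot θ (hermiteBasis n)) := by
  rw [rot_hermiteBasis, map_smul, dil_hermiteBasis, stateS, toL2_smul]

/-- Explicit form of `-i L ψ` for a transformed Hermite function `ψ`. -/
theorem weylS_stateS (a b c : ℝ) (n : ℕ) (γ ℓ θ x : ℝ) :
    -Complex.I * weylS a b c (stateS n γ ℓ θ) x = phase θ n * chirp γ ℓ x *
      ((-Complex.I * (n + 1 / 2) * (c * Real.exp (-2 * ℓ) : ℝ) - (b + c * γ : ℝ) / 2 +
        Complex.I * (-a - 2 * b * γ - c * γ ^ 2 + c * Real.exp (-4 * ℓ) : ℝ) * x ^ 2 / 2) *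
        hermiteFun n (Real.exp (-ℓ) * x) -
        (b + c * γ : ℝ) * (Real.exp (-ℓ) * x) * hermiteDer n (Real.exp (-ℓ) * x)) := by
  have h3 : Real.exp (-2 * ℓ) = Real.exp (-ℓ) ^ 2 := by rw [← Real.exp_nat_mul]; congr 1; ring
  have h4 : Real.exp (-4 * ℓ) = Real.exp (-ℓ) ^ 4 := by rw [← Real.exp_nat_mul]; congr 1; ring
  have h5 : weylS a b c (stateS n γ ℓ θ) x = (1 / 2 : ℂ) * phase θ n * (a * x ^ 2 * waveS n γ ℓ x -
      b * Complex.I * (2 * x * derS (waveS n γ ℓ) x + waveS n γ ℓ x) -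
      c * derS (derS (waveS n γ ℓ)) x) := by
    have : ∀ f g : 𝓢(ℝ, ℂ), (f - g) x = f x - g x := fun f g => rfl
    have h' : ∀ f g : 𝓢(ℝ, ℂ), (f + g) x = f x + g x := fun f g => rfl
    have h'' : ∀ (z : ℂ) (f : 𝓢(ℝ, ℂ)), (z • f) x = z * f x := fun f g => rfl
    simp only [weylS, stateS, map_smul, this, h', h'', derS_posS, posS_apply]
    ring
  rw [h5, derS_derS_waveS, derS_waveS, waveS_apply, h3, h4]
  generalize Real.exp (-ℓ) = p
  simp only [Complex.ofReal_mul, Complex.ofReal_sub, Complex.ofReal_pow, Complex.ofReal_add,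
    Complex.ofReal_neg, Complex.ofReal_ofNat]
  generalize (hermiteFun n (p * x) : ℂ) = H
  generalize (hermiteDer n (p * x) : ℂ) = D
  generalize chirp γ ℓ x = E
  generalize phase θ n = Q
  linear_combination (E * Q * (c * γ * H / 2 + b * H / 2 + x * b * p * D + x * c * γ * p * D + b * Complex.I * γ * x ^ 2 * H)) *
    Complex.I_sq

/-- Pointwise in `x`, the transported Hermite functions solve the Schrödinger equation. -/
theorem hasDerivAt_stateS {a b c γ ℓ θ : ℝ → ℝ} (h : IsIwasawaFlow a b c γ ℓ θ) (n : ℕ) (x t : ℝ) :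
    HasDerivAt (fun τ => stateS n (γ τ) (ℓ τ) (θ τ) x)
      (-Complex.I * weylS (a t) (b t) (c t) (stateS n (γ t) (ℓ t) (θ t)) x) t := by
  have h0 : (fun τ => stateS n (γ τ) (ℓ τ) (θ τ) x) = fun τ => phase (θ τ) n *
      (chirp (γ τ) (ℓ τ) x * (hermiteFun n (Real.exp (-ℓ τ) * x) : ℂ)) := by
    ext τ
    rw [← waveS_apply]
    rfl
  rw [h0, weylS_stateS]
  have h1 : HasDerivAt (fun τ => phase (θ τ) n) (phase (θ t) n *
      (((-((n : ℝ) + 1 / 2) * (c t * Real.exp (-2 * ℓ t)) : ℝ) : ℂ) * Complex.I)) t :=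
    ((((h.hθ t).const_mul _).ofReal_comp).mul_const Complex.I).cexp
  have h2 : HasDerivAt (fun τ => chirp (γ τ) (ℓ τ) x) (chirp (γ t) (ℓ t) x *
      (-(b t + c t * γ t : ℝ) / 2 + Complex.I *
        (-a t - 2 * b t * γ t - c t * γ t ^ 2 + c t * Real.exp (-4 * ℓ t) : ℝ) * x ^ 2 / 2)) t := by
    have e1 := (((h.hℓ t).neg.div_const 2).exp).ofReal_comp
    have e2 := (((((h.hγ t).ofReal_comp).const_mul Complex.I).mul_const ((x : ℂ) ^ 2)).div_const
      2).cexp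
    convert! e1.mul e2 using 1
    simp only [chirp, Complex.ofReal_mul, Complex.ofReal_neg, Complex.ofReal_div,
      Complex.ofReal_ofNat, Pi.neg_apply]
    ring
  have h3 : HasDerivAt (fun τ => (hermiteFun n (Real.exp (-ℓ τ) * x) : ℂ))
      (hermiteDer n (Real.exp (-ℓ t) * x) * (-(b t + c t * γ t : ℝ) * (Real.exp (-ℓ t) * x))) t := by
    have e1 := ((h.hℓ t).neg.exp).mul_const x
    have e2 := ((hasDerivAt_hermiteFun n (Real.exp (-ℓ t) * x)).comp t e1).ofReal_comp
    convert! e2 using 1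
    rw [← hermiteDer]
    simp only [Complex.ofReal_mul, Complex.ofReal_neg, Pi.neg_apply]
    ring
  convert! h1.mul (h2.mul h3) using 1
  simp only [Complex.ofReal_mul, Complex.ofReal_neg, Complex.ofReal_add, Complex.ofReal_natCast,
    Complex.ofReal_one, Complex.ofReal_ofNat, Complex.ofReal_div, Pi.mul_apply]
  ring

/-! ### Strong differentiability of the transported Hermite functions -/

theorem exists_pow_mul_hermiteFun_le (k n : ℕ) :
    ∃ C : ℝ, 0 < C ∧ ∀ y : ℝ, |y ^ k * hermiteFun n y| ≤ C * Real.exp (-1 / 4 * y ^ 2) := by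
  obtain ⟨C, hC, h⟩ := exists_polyGauss_le (Polynomial.X ^ k * hermitePoly n) (β := 1) (by simp)
  refine ⟨C, hC, fun y => ?_⟩
  have h1 : polyGauss (Polynomial.X ^ k * hermitePoly n) 1 y = ((y ^ k * hermiteFun n y : ℝ) : ℂ) := by
    rw [Complex.ofReal_mul, ← hermiteS_apply, hermiteS, polyGaussS_apply, polyGauss, polyGauss]
    simp [mul_assoc]
  have h2 := h y
  rw [h1, Complex.norm_real, Real.norm_eq_abs] at h2
  simpa using h2

theorem exists_hermite_bounds (n : ℕ) :
    ∃ C : ℝ, 0 < C ∧ ∀ y : ℝ, |hermiteFun n y| ≤ C * Real.exp (-1 / 4 * y ^ 2) ∧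
      |y * hermiteDer n y| ≤ C * Real.exp (-1 / 4 * y ^ 2) := by
  obtain ⟨C0, hC0, h0⟩ := exists_pow_mul_hermiteFun_le 0 n
  obtain ⟨C1, hC1, h1⟩ := exists_pow_mul_hermiteFun_le 1 (n + 1)
  obtain ⟨C2, hC2, h2⟩ := exists_pow_mul_hermiteFun_le 2 n
  refine ⟨C0 + C2 + Real.sqrt (2 * (n + 1)) * C1, by positivity, fun y => ?_⟩
  have e0 := h0 y
  have e1 := h1 y
  have e2 := h2 y
  have hs : 0 ≤ Real.sqrt (2 * (n + 1)) := Real.sqrt_nonneg _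
  have hE := Real.exp_pos (-1 / 4 * y ^ 2)
  rw [pow_zero, one_mul] at e0
  rw [pow_one] at e1
  have hC2E := mul_pos hC2 hE
  have hC1E := mul_nonneg hs (mul_pos hC1 hE).le
  have hC0E := mul_pos hC0 hE
  constructor
  · nlinarith
  · have h3 : y * hermiteDer n y = y ^ 2 * hermiteFun n y -
        Real.sqrt (2 * (n + 1)) * (y * hermiteFun (n + 1) y) := by rw [hermiteDer]; ring
    have h4 := abs_sub (y ^ 2 * hermiteFun n y) (Real.sqrt (2 * (n + 1)) * (y * hermiteFun (n + 1) y))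
    rw [abs_mul (Real.sqrt _), abs_of_nonneg hs] at h4
    rw [h3]
    have h5 := mul_le_mul_of_nonneg_left e1 hs
    nlinarith

theorem memLp_one_add_sq_mul_gauss (C : ℝ) {δ : ℝ} (hδ : 0 < δ) :
    MemLp (fun x : ℝ => C * ((1 + x ^ 2) * Real.exp (-δ * x ^ 2))) 2 volume := by
  have h := (polyGaussS (1 + Polynomial.X ^ 2) ((2 * δ : ℝ) : ℂ)
    (by rw [Complex.ofReal_re]; positivity)).memLp 2 (volume : Measure ℝ)
  refine MemLp.const_mul (h.norm.congr_norm (by fun_prop) (ae_of_all _ fun x => ?_)) C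
  rw [norm_norm, polyGaussS_apply, polyGauss, norm_mul, norm_exp_gauss, norm_mul, Complex.ofReal_re]
  congr 1
  · have : (1 + Polynomial.X ^ 2 : Polynomial ℂ).eval (x : ℂ) = ((1 + x ^ 2 : ℝ) : ℂ) := by
      push_cast; simp
    rw [this, Complex.norm_real]
  · rw [Real.norm_eq_abs, Real.abs_exp]
    congr 1; ring

/-- Locally uniformly in time, the time derivative of a transported Hermite function is dominated
by one square integrable function. -/
theorem exists_bound_weylS_stateS {a b c γ ℓ θ : ℝ → ℝ} (h : IsIwasawaFlow a b c γ ℓ θ) (n : ℕ)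
    (t : ℝ) : ∃ ε : ℝ, 0 < ε ∧ ∃ g : ℝ → ℝ, MemLp g 2 volume ∧ ∀ τ ∈ Metric.ball t ε, ∀ x,
      ‖(-Complex.I • weylS (a τ) (b τ) (c τ) (stateS n (γ τ) (ℓ τ) (θ τ))) x‖ ≤ g x := by
  have cγ : Continuous γ := continuous_iff_continuousAt.mpr fun τ => (h.hγ τ).continuousAt
  have cℓ : Continuous ℓ := continuous_iff_continuousAt.mpr fun τ => (h.hℓ τ).continuousAt
  have ca := h.cont_a
  have cb := h.cont_b
  have cc := h.cont_c
  set A : ℝ → ℝ := fun τ => c τ * Real.exp (-2 * ℓ τ) with hA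
  set B : ℝ → ℝ := fun τ => b τ + c τ * γ τ with hB
  set D : ℝ → ℝ := fun τ => -a τ - 2 * b τ * γ τ - c τ * γ τ ^ 2 + c τ * Real.exp (-4 * ℓ τ) with hD
  set S : ℝ → ℝ := fun τ => |A τ| + |B τ| + |D τ| + |ℓ τ| with hS
  have cS : Continuous S := by fun_prop
  obtain ⟨C, hC, hb⟩ := exists_hermite_bounds n
  set M : ℝ := S t + 1 with hM
  have hM0 : 0 < M := by
    have : 0 ≤ S t := by positivity
    linarith
  obtain ⟨ε, hε, hball⟩ := Metric.mem_nhds_iff.mp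
    (cS.continuousAt.eventually_lt_const (show S t < M by linarith))
  set δ : ℝ := Real.exp (-M) ^ 2 / 4 with hδ
  refine ⟨ε, hε, fun x => (Real.exp M * C * M * (n + 2)) * ((1 + x ^ 2) * Real.exp (-δ * x ^ 2)),
    memLp_one_add_sq_mul_gauss _ (by positivity), fun τ hτ x => ?_⟩
  have hSτ : S τ < M := hball hτ
  have hAM : |A τ| ≤ M := by
    have := abs_nonneg (B τ); have := abs_nonneg (D τ); have := abs_nonneg (ℓ τ)
    simp only [hS] at hSτ; linarith
  have hBM : |B τ| ≤ M := by
    have := abs_nonneg (A τ); have := abs_nonneg (D τ); have := abs_nonneg (ℓ τ)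
    simp only [hS] at hSτ; linarith
  have hDM : |D τ| ≤ M := by
    have := abs_nonneg (B τ); have := abs_nonneg (A τ); have := abs_nonneg (ℓ τ)
    simp only [hS] at hSτ; linarith
  have hℓM : |ℓ τ| ≤ M := by
    have := abs_nonneg (B τ); have := abs_nonneg (D τ); have := abs_nonneg (A τ)
    simp only [hS] at hSτ; linarith
  have hℓ1 := (abs_le.mp hℓM).1
  have hℓ2 := (abs_le.mp hℓM).2
  have e1 : (-Complex.I • weylS (a τ) (b τ) (c τ) (stateS n (γ τ) (ℓ τ) (θ τ))) x =
    -Complex.I * weylS (a τ) (b τ) (c τ) (stateS n (γ τ) (ℓ τ) (θ τ)) x := rfl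
  rw [e1, weylS_stateS, norm_mul, norm_mul, norm_phase, one_mul, norm_chirp]
  change Real.exp (-ℓ τ / 2) * ‖(-Complex.I * (n + 1 / 2) * (A τ : ℝ) - (B τ : ℝ) / 2 +
        Complex.I * (D τ : ℝ) * x ^ 2 / 2) * hermiteFun n (Real.exp (-ℓ τ) * x) -
        (B τ : ℝ) * (Real.exp (-ℓ τ) * x) * hermiteDer n (Real.exp (-ℓ τ) * x)‖ ≤ _
  set y := Real.exp (-ℓ τ) * x with hy
  have hE : Real.exp (-1 / 4 * y ^ 2) ≤ Real.exp (-δ * x ^ 2) := by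
    rw [Real.exp_le_exp, hy, mul_pow, hδ]
    have : Real.exp (-M) ^ 2 ≤ Real.exp (-ℓ τ) ^ 2 := by
      gcongr
    nlinarith [sq_nonneg x]
  have hE0 : 0 < Real.exp (-δ * x ^ 2) := Real.exp_pos _
  obtain ⟨hb1, hb2⟩ := hb y
  have hb1' : |hermiteFun n y| ≤ C * Real.exp (-δ * x ^ 2) :=
    hb1.trans (by gcongr)
  have hb2' : |y * hermiteDer n y| ≤ C * Real.exp (-δ * x ^ 2) :=
    hb2.trans (by gcongr)
  have hexp : Real.exp (-ℓ τ / 2) ≤ Real.exp M := Real.exp_le_exp.mpr (by linarith)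
  have hcoef : ‖(-Complex.I * (n + 1 / 2) * (A τ : ℝ) - (B τ : ℝ) / 2 +
      Complex.I * (D τ : ℝ) * x ^ 2 / 2 : ℂ)‖ ≤ (n + 1 / 2) * M + M / 2 + M * x ^ 2 / 2 := by
    refine (norm_add_le _ _).trans (add_le_add ((norm_sub_le _ _).trans (add_le_add ?_ ?_)) ?_)
    · have : ‖((n : ℂ) + 1 / 2)‖ = (n : ℝ) + 1 / 2 := by
        have : ((n : ℂ) + 1 / 2) = (((n : ℝ) + 1 / 2 : ℝ) : ℂ) := by push_cast; ring
        rw [this, Complex.norm_real, Real.norm_eq_abs, abs_of_nonneg (by positivity)]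
      rw [norm_mul, norm_mul, norm_neg, Complex.norm_I, one_mul, this, Complex.norm_real,
        Real.norm_eq_abs]
      gcongr
    · rw [norm_div, Complex.norm_real, Real.norm_eq_abs, Complex.norm_ofNat]
      gcongr
    · rw [norm_div, norm_mul, norm_mul, Complex.norm_I, one_mul, Complex.norm_real, norm_pow,
        Complex.norm_real, Real.norm_eq_abs, Real.norm_eq_abs, sq_abs, Complex.norm_ofNat]
      gcongr
  have hyc : (B τ : ℂ) * (Real.exp (-ℓ τ) * x) * hermiteDer n y =
      (B τ : ℂ) * ((y * hermiteDer n y : ℝ) : ℂ) := by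
    rw [hy]; simp only [Complex.ofReal_mul]; ring
  rw [hyc]
  calc _ ≤ Real.exp M * (((n + 1 / 2) * M + M / 2 + M * x ^ 2 / 2) * (C * Real.exp (-δ * x ^ 2)) +
        M * (C * Real.exp (-δ * x ^ 2))) := by
        gcongr
        refine (norm_sub_le _ _).trans (add_le_add ?_ ?_)
        · rw [norm_mul, Complex.norm_real, Real.norm_eq_abs]
          gcongr
        · rw [norm_mul, Complex.norm_real, Complex.norm_real, Real.norm_eq_abs, Real.norm_eq_abs]
          gcongr
    _ ≤ _ := by
        have h1 : ((n + 1 / 2) * M + M / 2 + M * x ^ 2 / 2) + M ≤ M * (n + 2) * (1 + x ^ 2) := by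
          have : 0 ≤ M * n * x ^ 2 := by positivity
          have : 0 ≤ M * x ^ 2 := by positivity
          nlinarith
        calc _ = Real.exp M * C * Real.exp (-δ * x ^ 2) *
              (((n + 1 / 2) * M + M / 2 + M * x ^ 2 / 2) + M) := by ring
          _ ≤ Real.exp M * C * Real.exp (-δ * x ^ 2) * (M * (n + 2) * (1 + x ^ 2)) := by gcongr
          _ = _ := by ring

/-- The transported Hermite functions solve the Schrödinger equation strongly in `L²`. -/
theorem hasDerivAt_toL2_stateS {a b c γ ℓ θ : ℝ → ℝ} (h : IsIwasawaFlow a b c γ ℓ θ) (n : ℕ)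
    (t : ℝ) : HasDerivAt (fun τ => toL2 (stateS n (γ τ) (ℓ τ) (θ τ)))
      (-Complex.I • toL2 (weylS (a t) (b t) (c t) (stateS n (γ t) (ℓ t) (θ t)))) t := by
  obtain ⟨ε, hε, g, hg, hb⟩ := exists_bound_weylS_stateS h n t
  exact hasDerivAt_toL2 (fun τ => stateS n (γ τ) (ℓ τ) (θ τ))
    (fun τ => -Complex.I • weylS (a τ) (b τ) (c τ) (stateS n (γ τ) (ℓ τ) (θ τ))) g hg t hε
    (fun τ x => hasDerivAt_stateS h n x τ) hb

/-! ### Weak solutions -/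

/-- Weak solutions of `i ∂ₜ u = Lᵂ(t) u` on `[0, ∞)` for coefficients depending on time. -/
def IsWeakSol (a b c : ℝ → ℝ) (u : ℝ → L2R) : Prop :=
  ContinuousOn u (Ici 0) ∧ ∀ φ : 𝓢(ℝ, ℂ), ∀ t : ℝ, 0 ≤ t →
    HasDerivWithinAt (fun τ => inner ℂ (toL2 φ) (u τ))
      (-Complex.I * inner ℂ (toL2 (weylS (a t) (b t) (c t) φ)) (u t)) (Ici 0) t

theorem isSolution_iff {d : ℕ} (ω : Fin d → ℝ) (a b c : (Fin d → ℝ) → ℝ) (u : ℝ → L2R) :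
    IsSolution ω a b c u ↔
      IsWeakSol (fun t => a (t • ω)) (fun t => b (t • ω)) (fun t => c (t • ω)) u := by
  simp only [IsSolution, IsWeakSol, pairing_weylOp, pairing_eq_inner]

/-- The metaplectic operator `dil γ ℓ ∘ rot θ`. -/
noncomputable def metaplectic (γ ℓ θ : ℝ) : L2R ≃ₗᵢ[ℂ] L2R := (rot θ).trans (dil γ ℓ)

theorem metaplectic_apply (γ ℓ θ : ℝ) (f : L2R) : metaplectic γ ℓ θ f = dil γ ℓ (rot θ f) := rfl

theorem metaplectic_hermiteBasis (γ ℓ θ : ℝ) (n : ℕ) :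
    metaplectic γ ℓ θ (hermiteBasis n) = toL2 (stateS n γ ℓ θ) := (toL2_stateS n γ ℓ θ).symm

/-- A family of isometries is strongly continuous if it is so on a Hilbert basis. -/
theorem continuous_isometry_apply {X : Type*} [TopologicalSpace X] (V : X → L2R ≃ₗᵢ[ℂ] L2R)
    (hV : ∀ n, Continuous fun τ => V τ (hermiteBasis n)) (f : L2R) :
    Continuous fun τ => V τ f := by
  have hs := hermiteBasis.hasSum_repr f
  have hu : TendstoUniformly (fun (s : Finset ℕ) τ =>
      V τ (∑ i ∈ s, hermiteBasis.repr f i • hermiteBasis i)) (fun τ => V τ f) atTop := by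
    rw [Metric.tendstoUniformly_iff]
    intro ε hε
    have := (Metric.tendsto_nhds.mp hs) ε hε
    simp only [SummationFilter.unconditional_filter] at this
    filter_upwards [this] with s hs τ
    rw [LinearIsometryEquiv.dist_map, dist_comm]
    exact hs
  refine hu.continuous (Eventually.of_forall fun s => ?_).frequently
  simp only [map_sum, map_smul]
  refine continuous_finsetSum _ fun i _ => ?_
  have := hV i
  fun_prop

theorem continuous_rot (f : L2R) : Continuous fun θ => rot θ f := by
  refine continuous_isometry_apply rot (fun n => ?_) f
  simp only [rot_hermiteBasis, phase]
  fun_prop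

theorem continuous_metaplectic {a b c γ ℓ θ : ℝ → ℝ} (h : IsIwasawaFlow a b c γ ℓ θ) (f : L2R) :
    Continuous fun t => metaplectic (γ t) (ℓ t) (θ t) f := by
  refine continuous_isometry_apply (fun t => metaplectic (γ t) (ℓ t) (θ t)) (fun n => ?_) f
  simp only [metaplectic_hermiteBasis]
  exact continuous_iff_continuousAt.mpr fun t => (hasDerivAt_toL2_stateS h n t).continuousAt

/-- Existence: the metaplectic operators following the flow map any initial datum to a weak
solution. By linearity and symmetry of `L` this holds for finite combinations of Hermite functions;
in general both sides are locally uniform limits, as the operators are isometries. -/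
theorem isWeakSol_metaplectic {a b c γ ℓ θ : ℝ → ℝ} (h : IsIwasawaFlow a b c γ ℓ θ) (f : L2R) :
    IsWeakSol a b c fun t => metaplectic (γ t) (ℓ t) (θ t) f := by
  refine ⟨(continuous_metaplectic h f).continuousOn, fun φ t _ => HasDerivAt.hasDerivWithinAt ?_⟩
  set V : ℝ → L2R ≃ₗᵢ[ℂ] L2R := fun t => metaplectic (γ t) (ℓ t) (θ t) with hV
  set P : Finset ℕ → L2R := fun s => ∑ i ∈ s, hermiteBasis.repr f i • hermiteBasis i with hP
  have hs : Tendsto P atTop (𝓝 f) := by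
    simpa only [SummationFilter.unconditional_filter] using! hermiteBasis.hasSum_repr f
  have ca := h.cont_a
  have cb := h.cont_b
  have cc := h.cont_c
  set K : ℝ := ‖toL2 (posS (posS φ))‖ +
      ‖toL2 (posS (derS φ) + derS (posS φ))‖ + ‖toL2 (derS (derS φ))‖ with hK
  have hK0 : 0 ≤ K := by positivity
  set S : ℝ → ℝ := fun τ => (|a τ| + |b τ| + |c τ|) * K with hS
  have cS : Continuous S := by fun_prop
  have hU : {τ | S τ < S t + 1} ∈ 𝓝 t := cS.continuousAt.eventually_lt_const (by linarith)
  have hUo : IsOpen {τ | S τ < S t + 1} := isOpen_lt cS continuous_const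
  refine hasDerivAt_of_tendstoUniformlyOn (l := atTop) hUo (f := fun s τ => inner ℂ (toL2 φ) (V τ (P s)))
    (f' := fun s τ => -Complex.I * inner ℂ (toL2 (weylS (a τ) (b τ) (c τ) φ)) (V τ (P s)))
    (g' := fun τ => -Complex.I * inner ℂ (toL2 (weylS (a τ) (b τ) (c τ) φ)) (V τ f))
    ?_ ?_ ?_ (mem_of_mem_nhds hU)
  · rw [Metric.tendstoUniformlyOn_iff]
    intro ε hε
    have hS0 : 0 < S t + 1 := by
      have : 0 ≤ S t := by positivity
      linarith
    have := Metric.tendsto_nhds.mp hs (ε / (S t + 1)) (by positivity)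
    filter_upwards [this] with s hs τ hτ
    rw [dist_eq_norm, ← mul_sub, ← inner_sub_right, ← map_sub, norm_mul, norm_neg, Complex.norm_I,
      one_mul]
    refine (norm_inner_le_norm _ _).trans_lt ?_
    rw [LinearIsometryEquiv.norm_map, ← dist_eq_norm, dist_comm]
    have h1 : ‖toL2 (weylS (a τ) (b τ) (c τ) φ)‖ ≤ S t + 1 :=
      (norm_toL2_weylS_le (a τ) (b τ) (c τ) φ).trans (le_of_lt hτ)
    calc _ ≤ (S t + 1) * dist (P s) f := by gcongr
      _ < (S t + 1) * (ε / (S t + 1)) := by gcongr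
      _ = ε := by field_simp
  · refine Eventually.of_forall fun s τ _ => ?_
    have h1 : ∀ i, HasDerivAt (fun τ => inner ℂ (toL2 φ) (V τ (hermiteBasis i)))
        (-Complex.I * inner ℂ (toL2 (weylS (a τ) (b τ) (c τ) φ)) (V τ (hermiteBasis i))) τ := by
      intro i
      simp only [hV, metaplectic_hermiteBasis]
      have h2 := (hasDerivAt_toL2_stateS h i τ)
      have h3 := (hasDerivAt_const τ (toL2 φ)).inner ℂ h2
      rw [inner_zero_left, add_zero, inner_smul_right] at h3
      rw [inner_weylS]
      exact h3
    have h4 : (fun τ => inner ℂ (toL2 φ) (V τ (P s))) = fun τ =>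
        ∑ i ∈ s, hermiteBasis.repr f i * inner ℂ (toL2 φ) (V τ (hermiteBasis i)) := by
      ext τ
      simp only [hP, map_sum, map_smul, inner_sum, inner_smul_right]
    have h5 : -Complex.I * inner ℂ (toL2 (weylS (a τ) (b τ) (c τ) φ)) (V τ (P s)) =
        ∑ i ∈ s, hermiteBasis.repr f i *
          (-Complex.I * inner ℂ (toL2 (weylS (a τ) (b τ) (c τ) φ)) (V τ (hermiteBasis i))) := by
      simp only [hP, map_sum, map_smul, inner_sum, inner_smul_right, Finset.mul_sum]
      exact Finset.sum_congr rfl fun i _ => by ring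
    rw [h4]
    simp only [h5]
    exact HasDerivAt.fun_sum fun i _ => (h1 i).const_mul _
  · intro τ _
    exact Filter.Tendsto.inner tendsto_const_nhds (((V τ).continuous.tendsto f).comp hs)

/-- Uniqueness: the pairing of a weak solution with a strong solution through Schwartz functions is
conserved, and the transported Hermite functions form a basis at every time. -/
theorem eq_metaplectic_of_isWeakSol {a b c γ ℓ θ : ℝ → ℝ} (h : IsIwasawaFlow a b c γ ℓ θ)
    {w : ℝ → L2R} (hw : IsWeakSol a b c w) (f : L2R) (h0 : w 0 = metaplectic (γ 0) (ℓ 0) (θ 0) f)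
    {t : ℝ} (ht : 0 ≤ t) : w t = metaplectic (γ t) (ℓ t) (θ t) f := by
  have key : ∀ n, inner ℂ (metaplectic (γ t) (ℓ t) (θ t) (hermiteBasis n)) (w t) =
      inner ℂ (hermiteBasis n) f := by
    intro n
    set ψ : ℝ → L2R := fun τ => toL2 (stateS n (γ τ) (ℓ τ) (θ τ)) with hψ
    -- The difference quotient of `⟨ψ, w⟩` splits so that the strong derivative falls on `ψ` and only
    -- the pairing of `w` with the fixed function `ψ τ` is differentiated.
    have hd : ∀ τ, 0 ≤ τ → HasDerivWithinAt (fun σ => inner ℂ (ψ σ) (w σ)) 0 (Ici 0) τ := by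
      intro τ hτ
      have h1 := (hasDerivAt_toL2_stateS h n τ).hasDerivWithinAt (s := Ici 0)
      have h2 := hw.2 (stateS n (γ τ) (ℓ τ) (θ τ)) τ hτ
      rw [hasDerivWithinAt_iff_tendsto_slope] at h1 h2 ⊢
      have hwc : Tendsto w (𝓝[Ici 0 \ {τ}] τ) (𝓝 (w τ)) :=
        (hw.1 τ hτ).mono_left (nhdsWithin_mono _ sdiff_subset)
      have h3 := (h1.inner hwc (𝕜 := ℂ)).add h2
      rw [inner_smul_left, map_neg, Complex.conj_I, neg_neg, ← add_mul, add_neg_cancel,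
        zero_mul] at h3
      refine h3.congr fun σ => ?_
      rw [slope_def_module, slope_def_module, slope_def_module,
        RCLike.real_smul_eq_coe_smul (K := ℂ) _ (ψ σ - ψ τ), inner_smul_left, RCLike.conj_ofReal,
        RCLike.real_smul_eq_coe_mul (K := ℂ), RCLike.real_smul_eq_coe_mul (K := ℂ),
        inner_sub_left]
      ring
    have hc := constant_of_has_deriv_right_zero (f := fun σ => inner ℂ (ψ σ) (w σ)) (a := 0) (b := t)
      (fun σ hσ => ((hd σ hσ.1).continuousWithinAt).mono Icc_subset_Ici_self)
      (fun σ hσ => (hd σ hσ.1).mono (Ici_subset_Ici.mpr hσ.1)) t ⟨ht, le_rfl⟩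
    rw [metaplectic_hermiteBasis]
    refine hc.trans ?_
    rw [h0, hψ]
    simp only
    rw [← metaplectic_hermiteBasis, LinearIsometryEquiv.inner_map_map]
  have h1 : (metaplectic (γ t) (ℓ t) (θ t)).symm (w t) = f := by
    rw [← sub_eq_zero]
    apply eq_zero_of_inner_hermiteS_eq_zero
    intro n
    rw [inner_sub_right, ← hermiteBasis_apply, ← key n, sub_eq_zero,
      ← LinearIsometryEquiv.inner_map_map (metaplectic (γ t) (ℓ t) (θ t)),
      LinearIsometryEquiv.apply_symm_apply]
  rw [← h1, LinearIsometryEquiv.apply_symm_apply]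

/-! ### Iwasawa coordinates of a path in `SL(2, ℝ)` -/

/-- The Iwasawa coordinates of the matrix `(α, β; δ, ε)` of determinant one are
`ℓ = ½ log (α² + β²)` and `γ = (αδ + βε) / (α² + β²)`, and the angle `θ` of its first row. Along a
solution of `Φ' = (b, c; -a, -b) Φ` they form an Iwasawa flow. The angle enters only through its
derivative `c / (α² + β²)`. -/
theorem isIwasawaFlow_of_matrix {a b c α β δ ε θ : ℝ → ℝ}
    (ca : Continuous a) (cb : Continuous b) (cc : Continuous c)
    (hα : ∀ t, HasDerivAt α (b t * α t + c t * δ t) t)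
    (hβ : ∀ t, HasDerivAt β (b t * β t + c t * ε t) t)
    (hδ : ∀ t, HasDerivAt δ (-a t * α t - b t * δ t) t)
    (hε : ∀ t, HasDerivAt ε (-a t * β t - b t * ε t) t)
    (hdet : ∀ t, α t * ε t - β t * δ t = 1)
    (hθ : ∀ t, HasDerivAt θ (c t / (α t ^ 2 + β t ^ 2)) t) :
    IsIwasawaFlow a b c (fun t => (α t * δ t + β t * ε t) / (α t ^ 2 + β t ^ 2))
      (fun t => Real.log (α t ^ 2 + β t ^ 2) / 2) θ := by
  have hpos : ∀ t, 0 < α t ^ 2 + β t ^ 2 := by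
    intro t
    have h := hdet t
    by_contra hc
    have h1 : α t = 0 := by nlinarith [sq_nonneg (α t), sq_nonneg (β t)]
    have h2 : β t = 0 := by nlinarith [sq_nonneg (α t), sq_nonneg (β t)]
    rw [h1, h2] at h
    norm_num at h
  have hR : ∀ t, HasDerivAt (fun t => α t ^ 2 + β t ^ 2)
      (2 * (b t * (α t ^ 2 + β t ^ 2) + c t * (α t * δ t + β t * ε t))) t := by
    intro t
    convert! ((hα t).pow 2).add ((hβ t).pow 2) using 1
    push_cast
    ring
  have e2 : ∀ t, Real.exp (-2 * (Real.log (α t ^ 2 + β t ^ 2) / 2)) = (α t ^ 2 + β t ^ 2)⁻¹ := by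
    intro t
    rw [show -2 * (Real.log (α t ^ 2 + β t ^ 2) / 2) = -Real.log (α t ^ 2 + β t ^ 2) by ring,
      Real.exp_neg, Real.exp_log (hpos t)]
  refine ⟨ca, cb, cc, fun t => ?_, fun t => ?_, fun t => ?_⟩
  · have hN : HasDerivAt (fun t => α t * δ t + β t * ε t)
        (c t * (δ t ^ 2 + ε t ^ 2) - a t * (α t ^ 2 + β t ^ 2)) t := by
      convert! ((hα t).mul (hδ t)).add ((hβ t).mul (hε t)) using 1
      ring
    convert! hN.div (hR t) (hpos t).ne' using 1
    have e4 : Real.exp (-4 * (Real.log (α t ^ 2 + β t ^ 2) / 2)) = (α t ^ 2 + β t ^ 2)⁻¹ ^ 2 := by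
      rw [← e2, ← Real.exp_nat_mul]; congr 1; push_cast; ring
    rw [e4]
    have h1 := (hpos t).ne'
    -- the Lagrange identity `|row₁|² |row₂|² = (row₁ · row₂)² + det²`
    have h2 : (α t ^ 2 + β t ^ 2) * (δ t ^ 2 + ε t ^ 2) = (α t * δ t + β t * ε t) ^ 2 + 1 := by
      have := hdet t
      linear_combination (α t * ε t - β t * δ t + 1) * this
    field_simp
    linear_combination (-c t) * h2
  · have := ((hR t).log (hpos t).ne').div_const 2
    convert! this using 1
    have h1 := (hpos t).ne'
    field_simp
  · have := hθ t
    rw [div_eq_mul_inv, ← e2] at this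
    exact this

theorem exists_angle {f : ℝ → ℝ} (hf : Continuous f) (θ₀ : ℝ) :
    ∃ θ : ℝ → ℝ, θ 0 = θ₀ ∧ ∀ t, HasDerivAt θ (f t) t := by
  refine ⟨fun t => θ₀ + ∫ τ in (0 : ℝ)..t, f τ, by simp, fun t => ?_⟩
  exact (hf.integral_hasStrictDerivAt 0 t).hasDerivAt.const_add θ₀

/-- The harmonic oscillator: the parameters of the rotations form an Iwasawa flow for
`a = c = 1`, `b = 0`. -/
theorem rot_flow : IsIwasawaFlow (fun _ => 1) (fun _ => 0) (fun _ => 1) (fun _ => 0) (fun _ => 0)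
    (fun t => t) := by
  refine ⟨continuous_const, continuous_const, continuous_const, fun t => ?_, fun t => ?_,
    fun t => ?_⟩
  · simpa using hasDerivAt_const t (0 : ℝ)
  · simpa using hasDerivAt_const t (0 : ℝ)
  · simpa using hasDerivAt_id' t

theorem rot_zero (u : L2R) : rot 0 u = u := by
  apply hermiteBasis.repr.injective
  ext n
  rw [HilbertBasis.repr_apply_apply, HilbertBasis.repr_apply_apply, ← hermiteCoeff_eq_inner,
    ← hermiteCoeff_eq_inner, hermiteCoeff_rot]
  simp [phase]

/-- Composition of a metaplectic operator with a rotation. No computation with operators is needed: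
both sides solve the harmonic oscillator equation in `τ`. -/
theorem rot_metaplectic (α β δ ε : ℝ) (hdet : α * ε - β * δ = 1) (θ₀ : ℝ) {τ : ℝ} (hτ : 0 ≤ τ)
    (f : L2R) : ∃ θ₁ : ℝ,
      rot τ (metaplectic ((α * δ + β * ε) / (α ^ 2 + β ^ 2)) (Real.log (α ^ 2 + β ^ 2) / 2) θ₀ f) =
      metaplectic
        (((α * Real.cos τ + δ * Real.sin τ) * (δ * Real.cos τ - α * Real.sin τ) +
          (β * Real.cos τ + ε * Real.sin τ) * (ε * Real.cos τ - β * Real.sin τ)) /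
          ((α * Real.cos τ + δ * Real.sin τ) ^ 2 + (β * Real.cos τ + ε * Real.sin τ) ^ 2))
        (Real.log ((α * Real.cos τ + δ * Real.sin τ) ^ 2 +
          (β * Real.cos τ + ε * Real.sin τ) ^ 2) / 2) θ₁ f := by
  set A : ℝ → ℝ := fun t => α * Real.cos t + δ * Real.sin t with hA
  set B : ℝ → ℝ := fun t => β * Real.cos t + ε * Real.sin t with hB
  set C : ℝ → ℝ := fun t => δ * Real.cos t - α * Real.sin t with hC
  set D : ℝ → ℝ := fun t => ε * Real.cos t - β * Real.sin t with hD
  have hd : ∀ t, A t * D t - B t * C t = 1 := by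
    intro t
    simp only [hA, hB, hC, hD]
    linear_combination (α * ε - β * δ) * Real.sin_sq_add_cos_sq t + hdet
  have hpos : ∀ t, A t ^ 2 + B t ^ 2 ≠ 0 := by
    intro t ht
    have h := hd t
    have h1 : A t = 0 := by nlinarith [sq_nonneg (A t), sq_nonneg (B t)]
    have h2 : B t = 0 := by nlinarith [sq_nonneg (A t), sq_nonneg (B t)]
    rw [h1, h2] at h
    norm_num at h
  have cA : Continuous A := by fun_prop
  have cB : Continuous B := by fun_prop
  obtain ⟨θ, hθ0, hθ⟩ := exists_angle (f := fun t => 1 / (A t ^ 2 + B t ^ 2))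
    (continuous_const.div (by fun_prop) hpos) θ₀
  have hflow := isIwasawaFlow_of_matrix (a := fun _ => 1) (b := fun _ => 0) (c := fun _ => 1)
    (α := A) (β := B) (δ := C) (ε := D) (θ := θ) continuous_const continuous_const continuous_const
    (fun t => by
      convert! ((Real.hasDerivAt_cos t).const_mul α).add ((Real.hasDerivAt_sin t).const_mul δ) using 1
      simp only [hC]; ring)
    (fun t => by
      convert! ((Real.hasDerivAt_cos t).const_mul β).add ((Real.hasDerivAt_sin t).const_mul ε) using 1
      simp only [hD]; ring)
    (fun t => by
      convert! ((Real.hasDerivAt_cos t).const_mul δ).sub ((Real.hasDerivAt_sin t).const_mul α) using 1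
      simp only [hA]; ring)
    (fun t => by
      convert! ((Real.hasDerivAt_cos t).const_mul ε).sub ((Real.hasDerivAt_sin t).const_mul β) using 1
      simp only [hB]; ring) hd hθ
  refine ⟨θ τ, ?_⟩
  set u := metaplectic ((α * δ + β * ε) / (α ^ 2 + β ^ 2)) (Real.log (α ^ 2 + β ^ 2) / 2) θ₀ f with hu
  have hw := isWeakSol_metaplectic rot_flow u
  have := eq_metaplectic_of_isWeakSol hflow hw f (by
    simp only [metaplectic_apply, dil_zero_zero, hθ0]
    rw [rot_zero, hu, metaplectic_apply]
    simp [hA, hB, hC, hD]) hτ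
  simp only [metaplectic_apply, dil_zero_zero] at this
  rw [this]
  rfl

/-- The Cartan decomposition: up to a rotation on the left and on the right, a metaplectic operator
is a dilation by a factor comparable with the norm of the matrix. -/
theorem exists_rot_metaplectic_eq_dil (α β δ ε : ℝ) (hdet : α * ε - β * δ = 1) (θ₀ : ℝ) (f : L2R) :
    ∃ τ ℓ₁ θ₁ : ℝ, 0 ≤ ℓ₁ ∧ (α ^ 2 + β ^ 2 + δ ^ 2 + ε ^ 2) / 2 ≤ Real.exp ℓ₁ ^ 2 ∧
      Real.exp ℓ₁ ^ 2 ≤ α ^ 2 + β ^ 2 + δ ^ 2 + ε ^ 2 ∧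
      rot τ (metaplectic ((α * δ + β * ε) / (α ^ 2 + β ^ 2)) (Real.log (α ^ 2 + β ^ 2) / 2) θ₀ f) =
        dil 0 ℓ₁ (rot θ₁ f) := by
  set P : ℝ → ℝ := fun t => α * Real.cos t + δ * Real.sin t with hP
  set Q : ℝ → ℝ := fun t => β * Real.cos t + ε * Real.sin t with hQ
  set R : ℝ → ℝ := fun t => δ * Real.cos t - α * Real.sin t with hR
  set S : ℝ → ℝ := fun t => ε * Real.cos t - β * Real.sin t with hS
  have hd : ∀ t, P t * S t - Q t * R t = 1 := by
    intro t
    simp only [hP, hQ, hR, hS]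
    linear_combination (α * ε - β * δ) * Real.sin_sq_add_cos_sq t + hdet
  have hN : ∀ t, P t ^ 2 + Q t ^ 2 + (R t ^ 2 + S t ^ 2) = α ^ 2 + β ^ 2 + δ ^ 2 + ε ^ 2 := by
    intro t
    simp only [hP, hQ, hR, hS]
    linear_combination (α ^ 2 + β ^ 2 + δ ^ 2 + ε ^ 2) * Real.sin_sq_add_cos_sq t
  -- the scalar product of the rows changes sign between `0` and `π/2`
  have hzero : ∃ t, 0 ≤ t ∧ P t * R t + Q t * S t = 0 := by
    have hc : Continuous fun t => P t * R t + Q t * S t := by fun_prop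
    have h0 : P 0 * R 0 + Q 0 * S 0 = α * δ + β * ε := by simp [hP, hQ, hR, hS]
    have h1 : P (Real.pi / 2) * R (Real.pi / 2) + Q (Real.pi / 2) * S (Real.pi / 2) =
        -(α * δ + β * ε) := by simp [hP, hQ, hR, hS]; ring
    have hpi : (0 : ℝ) ≤ Real.pi / 2 := by positivity
    have hI := intermediate_value_uIcc (a := 0) (b := Real.pi / 2) hc.continuousOn
    have hmem : (0 : ℝ) ∈ uIcc (P 0 * R 0 + Q 0 * S 0)
        (P (Real.pi / 2) * R (Real.pi / 2) + Q (Real.pi / 2) * S (Real.pi / 2)) := by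
      rw [h0, h1, mem_uIcc]
      rcases le_total 0 (α * δ + β * ε) with h | h
      · right; constructor <;> linarith
      · left; constructor <;> linarith
    obtain ⟨t, ht, ht0⟩ := hI hmem
    rw [uIcc_of_le hpi] at ht
    exact ⟨t, ht.1, ht0⟩
  have hmain : ∃ t, 0 ≤ t ∧ P t * R t + Q t * S t = 0 ∧ 1 ≤ P t ^ 2 + Q t ^ 2 ∧
      R t ^ 2 + S t ^ 2 ≤ P t ^ 2 + Q t ^ 2 := by
    obtain ⟨t, ht, h0⟩ := hzero
    have hL : (P t ^ 2 + Q t ^ 2) * (R t ^ 2 + S t ^ 2) = 1 := by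
      have := hd t
      linear_combination (P t * S t - Q t * R t + 1) * this + (P t * R t + Q t * S t) * h0
    have hnn1 : 0 ≤ P t ^ 2 + Q t ^ 2 := by positivity
    have hnn2 : 0 ≤ R t ^ 2 + S t ^ 2 := by positivity
    -- a further quarter turn exchanges the rows, so that the first one becomes the longer
    rcases le_total (R t ^ 2 + S t ^ 2) (P t ^ 2 + Q t ^ 2) with h | h
    · exact ⟨t, ht, h0, by nlinarith, h⟩
    · have e1 : P (t + Real.pi / 2) = R t := by
        simp only [hP, hR, Real.cos_add_pi_div_two, Real.sin_add_pi_div_two]; ring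
      have e2 : Q (t + Real.pi / 2) = S t := by
        simp only [hQ, hS, Real.cos_add_pi_div_two, Real.sin_add_pi_div_two]; ring
      have e3 : R (t + Real.pi / 2) = -P t := by
        simp only [hP, hR, Real.cos_add_pi_div_two, Real.sin_add_pi_div_two]; ring
      have e4 : S (t + Real.pi / 2) = -Q t := by
        simp only [hQ, hS, Real.cos_add_pi_div_two, Real.sin_add_pi_div_two]; ring
      refine ⟨t + Real.pi / 2, by positivity, ?_, ?_, ?_⟩
      · rw [e1, e2, e3, e4]; linarith
      · rw [e1, e2]; nlinarith
      · rw [e1, e2, e3, e4, neg_sq, neg_sq]; exact h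
  obtain ⟨t, ht, h0, h1, h2⟩ := hmain
  obtain ⟨θ₁, hθ₁⟩ := rot_metaplectic α β δ ε hdet θ₀ ht f
  have hexp : Real.exp (Real.log (P t ^ 2 + Q t ^ 2) / 2) ^ 2 = P t ^ 2 + Q t ^ 2 := by
    rw [← Real.exp_nat_mul]
    push_cast
    rw [mul_div_cancel₀ _ two_ne_zero, Real.exp_log (by linarith)]
  refine ⟨t, Real.log (P t ^ 2 + Q t ^ 2) / 2, θ₁, ?_, ?_, ?_, ?_⟩
  · have := Real.log_nonneg h1
    linarith
  · rw [hexp]; have := hN t; linarith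
  · rw [hexp]; have := hN t; nlinarith [sq_nonneg (R t), sq_nonneg (S t)]
  · rw [hθ₁, metaplectic_apply]
    change dil ((P t * R t + Q t * S t) / (P t ^ 2 + Q t ^ 2))
      (Real.log (P t ^ 2 + Q t ^ 2) / 2) (rot θ₁ f) = _
    rw [h0, zero_div]

/-! ### Dilations of finite Hermite expansions: integer Sobolev exponents -/

/-- The three-term recurrence, valid at `n = 0` as well: there `n - 1 = 0` in `ℕ`, but its
coefficient `√(2n)` vanishes. -/
theorem two_mul_hermiteFun (n : ℕ) (x : ℝ) :
    2 * x * hermiteFun n x = Real.sqrt (2 * (n + 1)) * hermiteFun (n + 1) x +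
      Real.sqrt (2 * n) * hermiteFun (n - 1) x := by
  cases n with
  | zero => simpa using hermiteFun_recurrence_zero x
  | succ n =>
    have := hermiteFun_recurrence n x
    have h4 : ((n + 1 : ℕ) : ℝ) + 1 = n + 2 := by push_cast; ring
    rw [h4]
    simpa using this

/-- The creation operator on dilated Hermite functions: the dilation turns it into a combination
(Bogoliubov transformation) of creation and annihilation. -/
theorem creation_waveS (m : ℕ) (ℓ : ℝ) :
    posS (waveS m 0 ℓ) - derS (waveS m 0 ℓ) =
      ((Real.cosh ℓ * Real.sqrt (2 * (m + 1)) : ℝ) : ℂ) • waveS (m + 1) 0 ℓ +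
      ((Real.sinh ℓ * Real.sqrt (2 * m) : ℝ) : ℂ) • waveS (m - 1) 0 ℓ := by
  ext x
  have h' : ∀ f g : 𝓢(ℝ, ℂ), (f + g) x = f x + g x := fun f g => rfl
  have h'' : ∀ f g : 𝓢(ℝ, ℂ), (f - g) x = f x - g x := fun f g => rfl
  have h3 : ∀ (z : ℂ) (f : 𝓢(ℝ, ℂ)), (z • f) x = z * f x := fun f g => rfl
  rw [h', h'', h3, h3, posS_apply, derS_waveS, waveS_apply, waveS_apply, waveS_apply, hermiteDer]
  have h1 := two_mul_hermiteFun m (Real.exp (-ℓ) * x)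
  have h2 : x = Real.exp ℓ * (Real.exp (-ℓ) * x) := by
    rw [← mul_assoc, ← Real.exp_add]; simp
  have key : x * hermiteFun m (Real.exp (-ℓ) * x) - Real.exp (-ℓ) *
      (Real.exp (-ℓ) * x * hermiteFun m (Real.exp (-ℓ) * x) -
        Real.sqrt (2 * (m + 1)) * hermiteFun (m + 1) (Real.exp (-ℓ) * x)) =
      Real.cosh ℓ * Real.sqrt (2 * (m + 1)) * hermiteFun (m + 1) (Real.exp (-ℓ) * x) +
      Real.sinh ℓ * Real.sqrt (2 * m) * hermiteFun (m - 1) (Real.exp (-ℓ) * x) := by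
    rw [Real.cosh_eq, Real.sinh_eq]
    linear_combination hermiteFun m (Real.exp (-ℓ) * x) * h2 +
      ((Real.exp ℓ - Real.exp (-ℓ)) / 2) * h1
  have key2 := congrArg (fun y : ℝ => chirp 0 ℓ x * (y : ℂ)) key
  simp only [Complex.ofReal_mul, Complex.ofReal_add, Complex.ofReal_sub] at key2 ⊢
  simp only [Complex.ofReal_zero]
  linear_combination key2

/-- A recurrence for the matrix elements of a dilation. A factor `√(n+1)`, half a power of the
energy on the left, is traded for a ladder operator of size `e^ℓ` on the right. -/
theorem inner_hermite_dil_rec (n m : ℕ) (ℓ : ℝ) :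
    (Real.sqrt (n + 1) : ℂ) * inner ℂ (hermiteBasis n) (dil 0 ℓ (hermiteBasis m)) =
      (Real.cosh ℓ * Real.sqrt (m + 1) : ℝ) *
        inner ℂ (hermiteBasis (n + 1)) (dil 0 ℓ (hermiteBasis (m + 1))) +
      (Real.sinh ℓ * Real.sqrt m : ℝ) *
        inner ℂ (hermiteBasis (n + 1)) (dil 0 ℓ (hermiteBasis (m - 1))) := by
  have h := inner_annihilation (hermiteS (n + 1)) (waveS m 0 ℓ)
  rw [annihilation_hermiteS, creation_waveS, toL2_add, toL2_smul, toL2_smul, toL2_smul,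
    inner_smul_left, inner_add_right, inner_smul_right, inner_smul_right, Complex.conj_ofReal,
    ← dil_hermiteBasis, ← dil_hermiteBasis, ← dil_hermiteBasis, ← hermiteBasis_apply,
    ← hermiteBasis_apply] at h
  have e : ∀ y : ℝ, Real.sqrt (2 * y) = Real.sqrt 2 * Real.sqrt y := fun y =>
    Real.sqrt_mul (by norm_num) y
  rw [e, e, e] at h
  have h2 : (Real.sqrt 2 : ℂ) ≠ 0 := by
    rw [Complex.ofReal_ne_zero]; positivity
  apply mul_left_cancel₀ h2
  simp only [Complex.ofReal_mul] at h ⊢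
  linear_combination h

/-- The sequence of coefficients of `μ a† + ν a` applied to `∑ vₘ hₘ`, where `a†` and `a` are the
normalised creation and annihilation operators. -/
noncomputable def ladder (μ ν : ℝ) (v : ℕ → ℂ) (m : ℕ) : ℂ :=
  (μ * Real.sqrt m : ℝ) * v (m - 1) + (ν * Real.sqrt (m + 1) : ℝ) * v (m + 1)

/-- The finite Hermite expansion `∑_{m < M} vₘ hₘ`. -/
noncomputable def hermiteSum (M : ℕ) (v : ℕ → ℂ) : L2R :=
  ∑ m ∈ Finset.range M, v m • hermiteBasis m

theorem sum_ladder_smul {F : Type*} [AddCommGroup F] [Module ℂ F] (K : ℕ → F) (μ ν : ℝ) (M : ℕ)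
    (v : ℕ → ℂ) (hv : ∀ m, M ≤ m → v m = 0) :
    ∑ m ∈ Finset.range (M + 1), ladder μ ν v m • K m =
      ∑ m ∈ Finset.range M, v m • (((μ * Real.sqrt (m + 1) : ℝ) : ℂ) • K (m + 1) +
        ((ν * Real.sqrt m : ℝ) : ℂ) • K (m - 1)) := by
  simp only [ladder, add_smul, smul_add, Finset.sum_add_distrib, smul_smul]
  congr 1
  · rw [Finset.sum_range_succ']
    simp [mul_comm]
  · have h2 := Finset.sum_range_succ' (fun m : ℕ => (((ν * Real.sqrt m : ℝ) : ℂ) * v m) •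
      K (m - 1)) (M + 1)
    rw [Finset.sum_range_succ, Finset.sum_range_succ, hv M le_rfl, hv (M + 1) (by omega)] at h2
    simp only [mul_zero, zero_smul, add_zero, Nat.cast_zero, Real.sqrt_zero, Complex.ofReal_zero,
      zero_mul, Nat.add_sub_cancel, Nat.cast_add, Nat.cast_one] at h2
    rw [← h2]
    exact Finset.sum_congr rfl fun m _ => by rw [mul_comm]

theorem inner_dil_hermiteSum (n M : ℕ) (ℓ : ℝ) (v : ℕ → ℂ) (hv : ∀ m, M ≤ m → v m = 0) :
    (Real.sqrt (n + 1) : ℂ) * inner ℂ (hermiteBasis n) (dil 0 ℓ (hermiteSum M v)) =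
      inner ℂ (hermiteBasis (n + 1))
        (dil 0 ℓ (hermiteSum (M + 1) (ladder (Real.cosh ℓ) (Real.sinh ℓ) v))) := by
  rw [hermiteSum, hermiteSum, sum_ladder_smul _ _ _ _ _ hv]
  simp only [map_sum, map_smul, map_add, inner_sum, inner_smul_right, inner_add_right,
    Finset.mul_sum]
  refine Finset.sum_congr rfl fun m _ => ?_
  rw [mul_left_comm, inner_hermite_dil_rec n m ℓ]

theorem norm_ladder_sq_le {μ ν ρ : ℝ} (hc : 0 ≤ μ) (hs : 0 ≤ ν) (hc' : μ ≤ ρ) (hs' : ν ≤ ρ) (v : ℕ → ℂ) (m : ℕ) :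
    ‖ladder μ ν v m‖ ^ 2 ≤
      2 * ρ ^ 2 * (m * ‖v (m - 1)‖ ^ 2 + (m + 1) * ‖v (m + 1)‖ ^ 2) := by
  have hρ : 0 ≤ ρ := hc.trans hc'
  have h1 : ‖ladder μ ν v m‖ ≤
      ρ * Real.sqrt m * ‖v (m - 1)‖ + ρ * Real.sqrt (m + 1) * ‖v (m + 1)‖ := by
    refine (norm_add_le _ _).trans ?_
    rw [norm_mul, norm_mul, Complex.norm_real, Complex.norm_real, Real.norm_eq_abs,
      Real.norm_eq_abs, abs_of_nonneg (by positivity), abs_of_nonneg (by positivity)]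
    gcongr
  have h2 : Real.sqrt m ^ 2 = m := Real.sq_sqrt (by positivity)
  have h3 : Real.sqrt (m + 1) ^ 2 = m + 1 := Real.sq_sqrt (by positivity)
  calc _ ≤ (ρ * Real.sqrt m * ‖v (m - 1)‖ +
        ρ * Real.sqrt (m + 1) * ‖v (m + 1)‖) ^ 2 := by gcongr
    _ ≤ 2 * ((ρ * Real.sqrt m * ‖v (m - 1)‖) ^ 2 +
        (ρ * Real.sqrt (m + 1) * ‖v (m + 1)‖) ^ 2) := add_sq_le
    _ = _ := by
        rw [mul_pow, mul_pow, mul_pow, mul_pow, h2, h3]; ring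

/-- A ladder operator with coefficients at most `ρ` costs `ρ` and half a power of the energy. -/
theorem sum_ladder_sq_le (S : ℕ) {μ ν ρ : ℝ} (hc : 0 ≤ μ) (hs : 0 ≤ ν) (hc' : μ ≤ ρ) (hs' : ν ≤ ρ)
    (M : ℕ) (v : ℕ → ℂ)
    (hv : ∀ m, M ≤ m → v m = 0) :
    ∑ m ∈ Finset.range (M + 1), ((m : ℝ) + 1) ^ S * ‖ladder μ ν v m‖ ^ 2 ≤
      2 * (2 ^ S + 1) * ρ ^ 2 *
        ∑ m ∈ Finset.range M, ((m : ℝ) + 1) ^ (S + 1) * ‖v m‖ ^ 2 := by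
  have h1 : ∑ m ∈ Finset.range (M + 1), ((m : ℝ) + 1) ^ S * (m * ‖v (m - 1)‖ ^ 2) ≤
      2 ^ S * ∑ m ∈ Finset.range M, ((m : ℝ) + 1) ^ (S + 1) * ‖v m‖ ^ 2 := by
    rw [Finset.sum_range_succ', Finset.mul_sum]
    simp only [Nat.cast_zero, zero_mul, mul_zero, add_zero, Nat.add_sub_cancel, Nat.cast_add,
      Nat.cast_one]
    refine Finset.sum_le_sum fun m _ => ?_
    have : ((m : ℝ) + 1 + 1) ^ S ≤ 2 ^ S * ((m : ℝ) + 1) ^ S := by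
      rw [← mul_pow]
      gcongr
      have : (0 : ℝ) ≤ m := by positivity
      linarith
    calc _ ≤ (2 ^ S * ((m : ℝ) + 1) ^ S) * (((m : ℝ) + 1) * ‖v m‖ ^ 2) := by gcongr
      _ = _ := by ring
  have h2 : ∑ m ∈ Finset.range (M + 1), ((m : ℝ) + 1) ^ S * ((m + 1) * ‖v (m + 1)‖ ^ 2) ≤
      ∑ m ∈ Finset.range M, ((m : ℝ) + 1) ^ (S + 1) * ‖v m‖ ^ 2 := by
    have h3 := Finset.sum_range_succ' (fun m : ℕ => (m : ℝ) ^ (S + 1) * ‖v m‖ ^ 2) (M + 1)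
    rw [Finset.sum_range_succ, Finset.sum_range_succ, hv M le_rfl, hv (M + 1) (by omega)] at h3
    simp only [norm_zero, ne_eq, OfNat.ofNat_ne_zero, not_false_eq_true, zero_pow, mul_zero,
      add_zero, Nat.cast_zero, Nat.add_eq_zero_iff, one_ne_zero, and_false, zero_mul, Nat.cast_add,
      Nat.cast_one] at h3
    calc _ = ∑ m ∈ Finset.range (M + 1), ((m : ℝ) + 1) ^ (S + 1) * ‖v (m + 1)‖ ^ 2 :=
          Finset.sum_congr rfl fun m _ => by ring
      _ = ∑ m ∈ Finset.range M, (m : ℝ) ^ (S + 1) * ‖v m‖ ^ 2 := h3.symm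
      _ ≤ _ := Finset.sum_le_sum fun m _ => by gcongr; linarith
  calc _ ≤ ∑ m ∈ Finset.range (M + 1), ((m : ℝ) + 1) ^ S *
        (2 * ρ ^ 2 * (m * ‖v (m - 1)‖ ^ 2 + (m + 1) * ‖v (m + 1)‖ ^ 2)) :=
        Finset.sum_le_sum fun m _ => mul_le_mul_of_nonneg_left (norm_ladder_sq_le hc hs hc' hs' v m)
          (by positivity)
    _ = 2 * ρ ^ 2 * (∑ m ∈ Finset.range (M + 1), ((m : ℝ) + 1) ^ S * (m * ‖v (m - 1)‖ ^ 2) +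
        ∑ m ∈ Finset.range (M + 1), ((m : ℝ) + 1) ^ S * ((m + 1) * ‖v (m + 1)‖ ^ 2)) := by
        rw [← Finset.sum_add_distrib, Finset.mul_sum]
        exact Finset.sum_congr rfl fun m _ => by ring
    _ ≤ 2 * ρ ^ 2 * (2 ^ S * ∑ m ∈ Finset.range M, ((m : ℝ) + 1) ^ (S + 1) * ‖v m‖ ^ 2 +
        ∑ m ∈ Finset.range M, ((m : ℝ) + 1) ^ (S + 1) * ‖v m‖ ^ 2) := by gcongr
    _ = _ := by ring

theorem norm_hermiteSum_sq (M : ℕ) (v : ℕ → ℂ) :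
    ‖hermiteSum M v‖ ^ 2 = ∑ m ∈ Finset.range M, ‖v m‖ ^ 2 := by
  have h := hermiteBasis.orthonormal.inner_sum v v (Finset.range M)
  rw [inner_self_eq_norm_sq_to_K] at h
  simp_rw [RCLike.conj_mul] at h
  exact_mod_cast h

/-- Dilations by `e^ℓ ≥ 1` on finite Hermite expansions, for integer Sobolev exponents. -/
theorem exists_sum_dil_hermiteSum_le (S : ℕ) : ∃ C : ℝ, 0 < C ∧ ∀ ℓ : ℝ, 0 ≤ ℓ → ∀ (M : ℕ)
    (v : ℕ → ℂ), (∀ m, M ≤ m → v m = 0) → ∀ N : ℕ,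
    ∑ n ∈ Finset.range N, ((n : ℝ) + 1) ^ S * ‖hermiteCoeff (dil 0 ℓ (hermiteSum M v)) n‖ ^ 2 ≤
      C * (Real.exp ℓ ^ 2) ^ S * ∑ m ∈ Finset.range M, ((m : ℝ) + 1) ^ S * ‖v m‖ ^ 2 := by
  induction S with
  | zero =>
    refine ⟨1, one_pos, fun ℓ _ M v _ N => ?_⟩
    simp only [pow_zero, one_mul]
    rw [← norm_hermiteSum_sq M v, ← (dil 0 ℓ).norm_map]
    exact sum_le_hasSum _ (fun _ _ => by positivity)
      (hasSum_hermiteCoeff_sq (dil 0 ℓ (hermiteSum M v)))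
  | succ S ih =>
    obtain ⟨C, hC, h⟩ := ih
    refine ⟨C * (2 * (2 ^ S + 1)), by positivity, fun ℓ hℓ M v hv N => ?_⟩
    set v' := ladder (Real.cosh ℓ) (Real.sinh ℓ) v with hv'
    have hv'0 : ∀ m, M + 1 ≤ m → v' m = 0 := by
      intro m hm
      simp [hv', ladder, hv (m - 1) (by omega), hv (m + 1) (by omega)]
    have hrec : ∀ n : ℕ, ((n : ℝ) + 1) * ‖hermiteCoeff (dil 0 ℓ (hermiteSum M v)) n‖ ^ 2 =
        ‖hermiteCoeff (dil 0 ℓ (hermiteSum (M + 1) v')) (n + 1)‖ ^ 2 := by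
      intro n
      rw [hermiteCoeff_eq_inner, hermiteCoeff_eq_inner, ← inner_dil_hermiteSum n M ℓ v hv, norm_mul,
        Complex.norm_real, mul_pow, Real.norm_eq_abs, sq_abs, Real.sq_sqrt (by positivity)]
    calc _ = ∑ n ∈ Finset.range N, ((n : ℝ) + 1) ^ S *
          ‖hermiteCoeff (dil 0 ℓ (hermiteSum (M + 1) v')) (n + 1)‖ ^ 2 :=
          Finset.sum_congr rfl fun n _ => by rw [← hrec]; ring
      _ ≤ ∑ n ∈ Finset.range N, (((n + 1 : ℕ) : ℝ) + 1) ^ S *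
          ‖hermiteCoeff (dil 0 ℓ (hermiteSum (M + 1) v')) (n + 1)‖ ^ 2 :=
          Finset.sum_le_sum fun n _ => by push_cast; gcongr; linarith
      _ ≤ ∑ n ∈ Finset.range (N + 1), ((n : ℝ) + 1) ^ S *
          ‖hermiteCoeff (dil 0 ℓ (hermiteSum (M + 1) v')) n‖ ^ 2 := by
          rw [Finset.sum_range_succ' _ N]
          have : 0 ≤ (((0 : ℕ) : ℝ) + 1) ^ S *
            ‖hermiteCoeff (dil 0 ℓ (hermiteSum (M + 1) v')) 0‖ ^ 2 := by positivity
          linarith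
      _ ≤ _ := h ℓ hℓ (M + 1) v' hv'0 (N + 1)
      _ ≤ C * (Real.exp ℓ ^ 2) ^ S * (2 * (2 ^ S + 1) * Real.exp ℓ ^ 2 *
          ∑ m ∈ Finset.range M, ((m : ℝ) + 1) ^ (S + 1) * ‖v m‖ ^ 2) := by
          have hsum := Real.cosh_add_sinh ℓ
          have hs : 0 ≤ Real.sinh ℓ := Real.sinh_nonneg_iff.mpr hℓ
          have hc : 0 ≤ Real.cosh ℓ := (Real.cosh_pos ℓ).le
          have := sum_ladder_sq_le S hc hs (by linarith) (by linarith) (ρ := Real.exp ℓ) M v hv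
          gcongr
      _ = _ := by ring

/-! ### Interpolation to real exponents -/

theorem lintegral_Ioc_rpow {s A : ℝ} (hs : 0 < s) (hA : 0 < A) :
    ∫⁻ E in Ioc (0 : ℝ) A, ENNReal.ofReal (s * E ^ (s - 1)) = ENNReal.ofReal (A ^ s) := by
  have hi : IntervalIntegrable (fun E : ℝ => s * E ^ (s - 1)) volume 0 A :=
    (intervalIntegral.intervalIntegrable_rpow' (by linarith)).const_mul s
  rw [← ofReal_integral_eq_lintegral_ofReal ((intervalIntegrable_iff_integrableOn_Ioc_of_le
    hA.le).mp hi), ← intervalIntegral.integral_of_le hA.le, intervalIntegral.integral_const_mul,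
    integral_rpow (Or.inl (by linarith))]
  · rw [sub_add_cancel, Real.zero_rpow hs.ne', sub_zero, mul_div_cancel₀ _ hs.ne']
  · filter_upwards [ae_restrict_mem measurableSet_Ioc] with E hE
    have := hE.1
    simp only [Pi.zero_apply]
    positivity

theorem lintegral_rpow_indicator {s A : ℝ} (hs : 0 < s) (hA : 0 < A) :
    ∫⁻ E in Ioi (0 : ℝ), ENNReal.ofReal (s * E ^ (s - 1)) * ENNReal.ofReal (if E < A then 1 else 0) =
      ENNReal.ofReal (A ^ s) := by
  have h1 : ∀ E : ℝ, ENNReal.ofReal (s * E ^ (s - 1)) * ENNReal.ofReal (if E < A then 1 else 0) =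
      (Iio A).indicator (fun E => ENNReal.ofReal (s * E ^ (s - 1))) E := by
    intro E
    by_cases h : E < A
    · simp [h]
    · simp [h]
  simp_rw [h1]
  rw [lintegral_indicator measurableSet_Iio, Measure.restrict_restrict measurableSet_Iio,
    Iio_inter_Ioi, Measure.restrict_congr_set Ioo_ae_eq_Ioc, lintegral_Ioc_rpow hs hA]

theorem lintegral_rpow_min_le {s B : ℝ} {S : ℕ} (hs : 0 < s) (hS : s < S) (hB : 0 < B) :
    ∫⁻ E in Ioi (0 : ℝ), ENNReal.ofReal (s * E ^ (s - 1)) * ENNReal.ofReal (min 1 ((B / E) ^ S)) ≤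
      ENNReal.ofReal ((1 + s / (S - s)) * B ^ s) := by
  have hSs : 0 < (S : ℝ) - s := by linarith
  rw [← Ioc_union_Ioi_eq_Ioi hB.le]
  refine (lintegral_union_le _ _ _).trans ?_
  rw [add_mul, one_mul, ENNReal.ofReal_add (by positivity) (by positivity)]
  refine add_le_add ?_ ?_
  · rw [← lintegral_Ioc_rpow hs hB]
    refine lintegral_mono fun E => mul_le_of_le_one_right' ?_
    rw [ENNReal.ofReal_le_one]
    exact min_le_left _ _
  · have hi : IntegrableOn (fun E : ℝ => s * B ^ S * E ^ (s - 1 - S)) (Ioi B) :=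
      (integrableOn_Ioi_rpow_of_lt (by linarith) hB).const_mul _
    calc _ ≤ ∫⁻ E in Ioi B, ENNReal.ofReal (s * B ^ S * E ^ (s - 1 - S)) := by
          refine setLIntegral_mono_ae' measurableSet_Ioi (ae_of_all _ fun E hE => ?_)
          have hE0 : 0 < E := hB.trans hE
          rw [← ENNReal.ofReal_mul (by positivity)]
          refine ENNReal.ofReal_le_ofReal ?_
          calc _ ≤ s * E ^ (s - 1) * (B / E) ^ S := by
                gcongr
                exact min_le_right _ _
            _ = _ := by
                rw [Real.rpow_sub hE0 (s - 1), Real.rpow_natCast, div_pow]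
                ring
      _ = ENNReal.ofReal (s / (S - s) * B ^ s) := by
          rw [← ofReal_integral_eq_lintegral_ofReal hi]
          · rw [integral_const_mul, integral_Ioi_rpow_of_lt (by linarith) hB]
            congr 1
            have e1 : s - 1 - (S : ℝ) + 1 = s - S := by ring
            rw [e1, Real.rpow_sub hB, Real.rpow_natCast]
            have e2 : s - (S : ℝ) ≠ 0 := by linarith
            have e3 : (S : ℝ) - s ≠ 0 := by linarith
            have e4 : B ^ S ≠ 0 := by positivity
            field_simp
            ring
          · filter_upwards [ae_restrict_mem measurableSet_Ioi] with E hE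
            have hE0 : 0 < E := hB.trans hE
            simp only [Pi.zero_apply]
            positivity

/-- An estimate of the tails of `p` by smoothed tails of `q` yields weighted estimates with any
smaller exponent. This is real interpolation for weighted `ℓ²` spaces, through the layer-cake
formula. -/
theorem sum_rpow_le_of_tail_le {p q : ℕ → ℝ} (hp : ∀ n, 0 ≤ p n) (hq : ∀ n, 0 ≤ q n) {R C s : ℝ}
    (hR : 0 < R) (hC : 0 ≤ C) (hs : 0 < s) {S : ℕ} (hS : s < S)
    (hsum : Summable fun m : ℕ => ((m : ℝ) + 1) ^ s * q m)
    (h : ∀ E : ℝ, 0 < E → ∀ N : ℕ, ∑ n ∈ Finset.range N, (if E < (n : ℝ) + 1 then 1 else 0) * p n ≤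
      C * ∑' m : ℕ, min 1 ((((m : ℝ) + 1) * R / E) ^ S) * q m) (N : ℕ) :
    ∑ n ∈ Finset.range N, ((n : ℝ) + 1) ^ s * p n ≤
      C * (1 + s / (S - s)) * R ^ s * ∑' m : ℕ, ((m : ℝ) + 1) ^ s * q m := by
  have hSs : 0 < (S : ℝ) - s := by linarith
  have hqs : Summable q := hsum.of_nonneg_of_le hq fun m =>
    le_mul_of_one_le_left (hq m) (Real.one_le_rpow (by linarith [m.cast_nonneg (α := ℝ)]) hs.le)
  have hpos : 0 ≤ C * (1 + s / (S - s)) * R ^ s * ∑' m : ℕ, ((m : ℝ) + 1) ^ s * q m := by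
    have : 0 ≤ ∑' m : ℕ, ((m : ℝ) + 1) ^ s * q m :=
      tsum_nonneg fun m => mul_nonneg (by positivity) (hq m)
    positivity
  rw [← ENNReal.ofReal_le_ofReal_iff hpos]
  have hmeas : ∀ A : ℝ, Measurable fun E : ℝ => ENNReal.ofReal (s * E ^ (s - 1)) *
      ENNReal.ofReal (if E < A then 1 else 0) := by
    intro A
    refine Measurable.mul (by fun_prop) (ENNReal.measurable_ofReal.comp ?_)
    exact Measurable.ite measurableSet_Iio measurable_const measurable_const
  calc ENNReal.ofReal (∑ n ∈ Finset.range N, ((n : ℝ) + 1) ^ s * p n)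
      = ∑ n ∈ Finset.range N, ENNReal.ofReal (((n : ℝ) + 1) ^ s) * ENNReal.ofReal (p n) := by
        rw [ENNReal.ofReal_sum_of_nonneg fun n _ => mul_nonneg (by positivity) (hp n)]
        exact Finset.sum_congr rfl fun n _ => ENNReal.ofReal_mul (by positivity)
    _ = ∑ n ∈ Finset.range N, ∫⁻ E in Ioi (0 : ℝ), ENNReal.ofReal (s * E ^ (s - 1)) *
          ENNReal.ofReal (if E < (n : ℝ) + 1 then 1 else 0) * ENNReal.ofReal (p n) := by
        refine Finset.sum_congr rfl fun n _ => ?_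
        rw [lintegral_mul_const _ (hmeas _), lintegral_rpow_indicator hs (by positivity)]
    _ = ∫⁻ E in Ioi (0 : ℝ), ∑ n ∈ Finset.range N, ENNReal.ofReal (s * E ^ (s - 1)) *
          ENNReal.ofReal (if E < (n : ℝ) + 1 then 1 else 0) * ENNReal.ofReal (p n) := by
        rw [lintegral_finsetSum _ fun n _ => (hmeas _).mul_const _]
    _ ≤ ∫⁻ E in Ioi (0 : ℝ), ENNReal.ofReal C * ∑' m : ℕ, ENNReal.ofReal (s * E ^ (s - 1)) *
          ENNReal.ofReal (min 1 ((((m : ℝ) + 1) * R / E) ^ S)) * ENNReal.ofReal (q m) := by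
        refine setLIntegral_mono_ae' measurableSet_Ioi (ae_of_all _ fun E hE => ?_)
        have hE0 : (0 : ℝ) < E := hE
        have h1 : ∀ m : ℕ, 0 ≤ min 1 ((((m : ℝ) + 1) * R / E) ^ S) * q m := fun m =>
          mul_nonneg (le_min zero_le_one (by positivity)) (hq m)
        have h2 : Summable fun m : ℕ => min 1 ((((m : ℝ) + 1) * R / E) ^ S) * q m :=
          hqs.of_nonneg_of_le h1 fun m => mul_le_of_le_one_left (hq m) (min_le_left _ _)
        have h3 := ENNReal.ofReal_le_ofReal (h E hE0 N)
        rw [ENNReal.ofReal_sum_of_nonneg fun n _ => mul_nonneg (by positivity) (hp n),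
          ENNReal.ofReal_mul hC, ENNReal.ofReal_tsum_of_nonneg h1 h2] at h3
        have h4 := mul_le_mul_right h3 (ENNReal.ofReal (s * E ^ (s - 1)))
        rw [Finset.mul_sum, mul_left_comm, ← ENNReal.tsum_mul_left] at h4
        refine (le_of_eq ?_).trans (h4.trans (le_of_eq ?_))
        · refine Finset.sum_congr rfl fun n _ => ?_
          have hi : (0 : ℝ) ≤ if E < (n : ℝ) + 1 then 1 else 0 := by positivity
          rw [ENNReal.ofReal_mul hi, mul_assoc]
        · congr 2
          ext m
          rw [ENNReal.ofReal_mul (le_min zero_le_one (by positivity)), mul_assoc]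
    _ = ENNReal.ofReal C * ∑' m : ℕ, (∫⁻ E in Ioi (0 : ℝ), ENNReal.ofReal (s * E ^ (s - 1)) *
          ENNReal.ofReal (min 1 ((((m : ℝ) + 1) * R / E) ^ S))) * ENNReal.ofReal (q m) := by
        have hm : ∀ m : ℕ, Measurable fun E : ℝ => ENNReal.ofReal (s * E ^ (s - 1)) *
          ENNReal.ofReal (min 1 ((((m : ℝ) + 1) * R / E) ^ S)) := fun m => by fun_prop
        rw [lintegral_const_mul _ (Measurable.tsum fun m => (hm m).mul_const _),
          lintegral_tsum fun m => ((hm m).mul_const _).aemeasurable]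
        congr 2
        ext m
        rw [lintegral_mul_const _ (hm m)]
    _ ≤ ENNReal.ofReal C * ∑' m : ℕ, ENNReal.ofReal ((1 + s / (S - s)) * R ^ s *
          (((m : ℝ) + 1) ^ s * q m)) := by
        gcongr with m
        refine (mul_le_mul_left (lintegral_rpow_min_le hs hS (by positivity)) _).trans (le_of_eq ?_)
        rw [← ENNReal.ofReal_mul (by positivity), Real.mul_rpow (by positivity) hR.le]
        congr 1
        ring
    _ = _ := by
        rw [← ENNReal.ofReal_tsum_of_nonneg _ (hsum.mul_left _), ← ENNReal.ofReal_mul hC,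
          tsum_mul_left]
        · congr 1
          ring
        · exact fun m => mul_nonneg (by positivity) (mul_nonneg (by positivity) (hq m))

/-! ### Dilations on the Sobolev spaces: upper bounds -/

theorem hermiteCoeff_sub (f g : L2R) (n : ℕ) :
    hermiteCoeff (f - g) n = hermiteCoeff f n - hermiteCoeff g n := by
  simp only [hermiteCoeff_eq_inner, inner_sub_right]

theorem hermiteCoeff_hermiteSum (M : ℕ) (v : ℕ → ℂ) (n : ℕ) :
    hermiteCoeff (hermiteSum M v) n = if n < M then v n else 0 := by
  rw [hermiteCoeff_eq_inner, hermiteSum, inner_sum]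
  simp only [inner_smul_right, orthonormal_iff_ite.mp hermiteBasis.orthonormal, mul_ite, mul_one,
    mul_zero, Finset.sum_ite_eq, Finset.mem_range]

/-- The coefficients of `f` below `M`. -/
noncomputable def lowCoeff (M : ℕ) (f : L2R) (n : ℕ) : ℂ := if n < M then hermiteCoeff f n else 0

theorem lowCoeff_eq_zero (M : ℕ) (f : L2R) (n : ℕ) (h : M ≤ n) : lowCoeff M f n = 0 :=
  if_neg (not_lt.mpr h)

theorem sum_lowCoeff_sq (w : ℕ → ℝ) (M : ℕ) (f : L2R) :
    ∑ n ∈ Finset.range M, w n * ‖lowCoeff M f n‖ ^ 2 =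
      ∑ n ∈ Finset.range M, w n * ‖hermiteCoeff f n‖ ^ 2 :=
  Finset.sum_congr rfl fun n hn => by rw [lowCoeff, if_pos (Finset.mem_range.mp hn)]

theorem hermiteCoeff_sub_low (M : ℕ) (f : L2R) (n : ℕ) :
    hermiteCoeff (f - hermiteSum M (lowCoeff M f)) n = if n < M then 0 else hermiteCoeff f n := by
  rw [hermiteCoeff_sub, hermiteCoeff_hermiteSum, lowCoeff]
  split_ifs <;> simp

theorem hasSum_tail_sq (M : ℕ) (f : L2R) :
    HasSum (fun n => if n < M then 0 else ‖hermiteCoeff f n‖ ^ 2)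
      (‖f - hermiteSum M (lowCoeff M f)‖ ^ 2) := by
  convert! hasSum_hermiteCoeff_sq (f - hermiteSum M (lowCoeff M f)) using 2 with n
  rw [hermiteCoeff_sub_low]
  split_ifs <;> simp

/-- Tails of the coefficients of a dilated function. The part of `f` with energy below `E / ρ²` is
estimated by means of the exponent `S`, the remainder in `L²`. -/
theorem exists_dil_tail_le (S : ℕ) : ∃ C : ℝ, 0 < C ∧ ∀ ℓ : ℝ, 0 ≤ ℓ → ∀ (f : L2R) (E : ℝ),
    0 < E → ∀ N : ℕ,
    ∑ n ∈ Finset.range N, (if E < (n : ℝ) + 1 then 1 else 0) *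
        ‖hermiteCoeff (dil 0 ℓ f) n‖ ^ 2 ≤
      C * ∑' m : ℕ, min 1 ((((m : ℝ) + 1) * Real.exp ℓ ^ 2 / E) ^ S) * ‖hermiteCoeff f m‖ ^ 2 := by
  obtain ⟨C, hC, h⟩ := exists_sum_dil_hermiteSum_le S
  refine ⟨2 * C + 2, by positivity, fun ℓ hℓ f E hE N => ?_⟩
  set R := Real.exp ℓ ^ 2 with hR
  have hR0 : 0 < R := by positivity
  set M := ⌊E / R⌋₊ with hM
  set k : ℕ → ℝ := fun m => min 1 ((((m : ℝ) + 1) * R / E) ^ S) with hk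
  have hk0 : ∀ m, 0 ≤ k m := fun m => le_min zero_le_one (by positivity)
  have hlow : ∀ m, m < M → k m = (((m : ℝ) + 1) * R / E) ^ S := by
    intro m hm
    refine min_eq_right (pow_le_one₀ (by positivity) ?_)
    have h1 : ((m + 1 : ℕ) : ℝ) ≤ E / R := by
      refine (Nat.cast_le.mpr hm).trans (Nat.floor_le (by positivity))
    rw [div_le_one hE, ← le_div_iff₀ hR0]
    exact_mod_cast h1
  have hhigh : ∀ m, M ≤ m → k m = 1 := by
    intro m hm
    refine min_eq_left (one_le_pow₀ ?_)
    have h1 : E / R < (m : ℝ) + 1 := (Nat.lt_floor_add_one _).trans_le (by gcongr)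
    rw [one_le_div hE, ← div_le_iff₀ hR0]
    exact h1.le
  have hks : Summable fun m => k m * ‖hermiteCoeff f m‖ ^ 2 :=
    (hasSum_hermiteCoeff_sq f).summable.of_nonneg_of_le
      (fun m => mul_nonneg (hk0 m) (by positivity))
      (fun m => mul_le_of_le_one_left (by positivity) (min_le_left _ _))
  set T := ∑' m : ℕ, k m * ‖hermiteCoeff f m‖ ^ 2 with hT
  set f₁ := hermiteSum M (lowCoeff M f) with hf₁
  have hlowT : ∑ n ∈ Finset.range N, (if E < (n : ℝ) + 1 then 1 else 0) *
      ‖hermiteCoeff (dil 0 ℓ f₁) n‖ ^ 2 ≤ C * T := by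
    calc _ ≤ ∑ n ∈ Finset.range N, (E ^ S)⁻¹ * (((n : ℝ) + 1) ^ S *
          ‖hermiteCoeff (dil 0 ℓ f₁) n‖ ^ 2) := by
          refine Finset.sum_le_sum fun n _ => ?_
          rw [← mul_assoc]
          refine mul_le_mul_of_nonneg_right ?_ (by positivity)
          split_ifs with hn
          · rw [inv_mul_eq_div, ← div_pow]
            exact one_le_pow₀ ((one_le_div hE).mpr hn.le)
          · positivity
      _ ≤ (E ^ S)⁻¹ * (C * R ^ S * ∑ m ∈ Finset.range M, ((m : ℝ) + 1) ^ S *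
          ‖lowCoeff M f m‖ ^ 2) := by
          rw [← Finset.mul_sum]
          have := h ℓ hℓ M (lowCoeff M f) (lowCoeff_eq_zero M f) N
          gcongr
      _ = C * ∑ m ∈ Finset.range M, k m * ‖hermiteCoeff f m‖ ^ 2 := by
          rw [sum_lowCoeff_sq (fun m => ((m : ℝ) + 1) ^ S), Finset.mul_sum, Finset.mul_sum,
            Finset.mul_sum]
          refine Finset.sum_congr rfl fun m hm => ?_
          rw [hlow m (Finset.mem_range.mp hm), div_pow, mul_pow]
          ring
      _ ≤ C * T := by
          have := hks.sum_le_tsum (Finset.range M) fun m _ => mul_nonneg (hk0 m) (by positivity)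
          gcongr
  have hhighT : ∑ n ∈ Finset.range N, (if E < (n : ℝ) + 1 then 1 else 0) *
      ‖hermiteCoeff (dil 0 ℓ (f - f₁)) n‖ ^ 2 ≤ T := by
    calc _ ≤ ∑ n ∈ Finset.range N, ‖hermiteCoeff (dil 0 ℓ (f - f₁)) n‖ ^ 2 := by
          refine Finset.sum_le_sum fun n _ => mul_le_of_le_one_left (by positivity) ?_
          split_ifs <;> norm_num
      _ ≤ ‖dil 0 ℓ (f - f₁)‖ ^ 2 :=
          sum_le_hasSum _ (fun _ _ => by positivity) (hasSum_hermiteCoeff_sq _)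
      _ = ∑' n, (if n < M then 0 else ‖hermiteCoeff f n‖ ^ 2) := by
          rw [LinearIsometryEquiv.norm_map, (hasSum_tail_sq M f).tsum_eq]
      _ ≤ T := by
          refine (hasSum_tail_sq M f).summable.tsum_le_tsum (fun m => ?_) hks
          split_ifs with hm
          · exact mul_nonneg (hk0 m) (by positivity)
          · rw [hhigh m (not_lt.mp hm), one_mul]
  have hsplit : ∀ n, ‖hermiteCoeff (dil 0 ℓ f) n‖ ^ 2 ≤
      2 * ‖hermiteCoeff (dil 0 ℓ f₁) n‖ ^ 2 + 2 * ‖hermiteCoeff (dil 0 ℓ (f - f₁)) n‖ ^ 2 := by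
    intro n
    have e1 : hermiteCoeff (dil 0 ℓ f) n =
        hermiteCoeff (dil 0 ℓ f₁) n + hermiteCoeff (dil 0 ℓ (f - f₁)) n := by
      rw [map_sub, hermiteCoeff_sub]; ring
    rw [e1, ← mul_add]
    calc _ ≤ (‖hermiteCoeff (dil 0 ℓ f₁) n‖ + ‖hermiteCoeff (dil 0 ℓ (f - f₁)) n‖) ^ 2 := by
          gcongr; exact norm_add_le _ _
      _ ≤ _ := add_sq_le
  calc _ ≤ ∑ n ∈ Finset.range N, (if E < (n : ℝ) + 1 then 1 else 0) *
        (2 * ‖hermiteCoeff (dil 0 ℓ f₁) n‖ ^ 2 + 2 * ‖hermiteCoeff (dil 0 ℓ (f - f₁)) n‖ ^ 2) := by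
        refine Finset.sum_le_sum fun n _ => mul_le_mul_of_nonneg_left (hsplit n) ?_
        split_ifs <;> norm_num
    _ = 2 * ∑ n ∈ Finset.range N, (if E < (n : ℝ) + 1 then 1 else 0) *
          ‖hermiteCoeff (dil 0 ℓ f₁) n‖ ^ 2 + 2 * ∑ n ∈ Finset.range N,
          (if E < (n : ℝ) + 1 then 1 else 0) * ‖hermiteCoeff (dil 0 ℓ (f - f₁)) n‖ ^ 2 := by
        rw [Finset.mul_sum, Finset.mul_sum, ← Finset.sum_add_distrib]
        exact Finset.sum_congr rfl fun n _ => by ring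
    _ ≤ 2 * (C * T) + 2 * T := by gcongr
    _ = _ := by ring

/-- Dilations by `ρ = e^ℓ ≥ 1` are bounded on `ℋˢ` by a multiple of `ρˢ`. -/
theorem exists_sobolevNorm_dil_le {s : ℝ} (hs : 0 ≤ s) : ∃ C : ℝ, 0 < C ∧ ∀ ℓ : ℝ, 0 ≤ ℓ →
    ∀ f ∈ sobolevSpace s, dil 0 ℓ f ∈ sobolevSpace s ∧
      sobolevNorm s (dil 0 ℓ f) ≤ C * Real.exp ℓ ^ s * sobolevNorm s f := by
  rcases hs.eq_or_lt with rfl | hs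
  · refine ⟨1, one_pos, fun ℓ _ f _ => ?_⟩
    have hn : ∀ g : L2R, HasSum (fun n : ℕ => (2 * (n : ℝ) + 1) ^ (0 : ℝ) *
        ‖hermiteCoeff g n‖ ^ 2) (‖g‖ ^ 2) := by
      intro g
      simpa using hasSum_hermiteCoeff_sq g
    refine ⟨(hn _).summable, le_of_eq ?_⟩
    rw [sobolevNorm, sobolevNorm, (hn _).tsum_eq, (hn _).tsum_eq, LinearIsometryEquiv.norm_map,
      Real.rpow_zero, one_mul, one_mul]
  · obtain ⟨S, hS⟩ := exists_nat_gt s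
    obtain ⟨C, hC, h⟩ := exists_dil_tail_le S
    have hSs : 0 < (S : ℝ) - s := by linarith
    set K := 2 ^ s * (C * (1 + s / (S - s))) with hK
    have hK0 : 0 < K := by positivity
    refine ⟨Real.sqrt K, by positivity, fun ℓ hℓ f hf => ?_⟩
    have hw : ∀ n : ℕ, ((n : ℝ) + 1) ^ s ≤ (2 * (n : ℝ) + 1) ^ s := fun n => by
      gcongr
      linarith [n.cast_nonneg (α := ℝ)]
    have hw2 : ∀ n : ℕ, (2 * (n : ℝ) + 1) ^ s ≤ 2 ^ s * ((n : ℝ) + 1) ^ s := fun n => by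
      rw [← Real.mul_rpow (by norm_num) (by positivity)]
      gcongr
      linarith [n.cast_nonneg (α := ℝ)]
    have hf' : Summable fun n : ℕ => (2 * (n : ℝ) + 1) ^ s * ‖hermiteCoeff f n‖ ^ 2 := hf
    have hf1 : Summable fun n : ℕ => ((n : ℝ) + 1) ^ s * ‖hermiteCoeff f n‖ ^ 2 :=
      hf'.of_nonneg_of_le (fun n => by positivity) fun n =>
        mul_le_mul_of_nonneg_right (hw n) (by positivity)
    have hbound : ∀ N : ℕ, ∑ n ∈ Finset.range N, (2 * (n : ℝ) + 1) ^ s *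
        ‖hermiteCoeff (dil 0 ℓ f) n‖ ^ 2 ≤
        K * (Real.exp ℓ ^ 2) ^ s * ∑' n : ℕ, (2 * (n : ℝ) + 1) ^ s * ‖hermiteCoeff f n‖ ^ 2 := by
      intro N
      have h1 := sum_rpow_le_of_tail_le (p := fun n => ‖hermiteCoeff (dil 0 ℓ f) n‖ ^ 2)
        (q := fun n => ‖hermiteCoeff f n‖ ^ 2) (fun n => by positivity) (fun n => by positivity)
        (R := Real.exp ℓ ^ 2) (by positivity) hC.le hs hS hf1 (h ℓ hℓ f) N
      have h2 : ∑' n : ℕ, ((n : ℝ) + 1) ^ s * ‖hermiteCoeff f n‖ ^ 2 ≤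
          ∑' n : ℕ, (2 * (n : ℝ) + 1) ^ s * ‖hermiteCoeff f n‖ ^ 2 :=
        hf1.tsum_le_tsum (fun n => mul_le_mul_of_nonneg_right (hw n) (by positivity)) hf'
      calc _ ≤ ∑ n ∈ Finset.range N, 2 ^ s * (((n : ℝ) + 1) ^ s *
            ‖hermiteCoeff (dil 0 ℓ f) n‖ ^ 2) := by
            refine Finset.sum_le_sum fun n _ => ?_
            rw [← mul_assoc]
            exact mul_le_mul_of_nonneg_right (hw2 n) (by positivity)
        _ ≤ 2 ^ s * (C * (1 + s / (S - s)) * (Real.exp ℓ ^ 2) ^ s *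
            ∑' n : ℕ, (2 * (n : ℝ) + 1) ^ s * ‖hermiteCoeff f n‖ ^ 2) := by
            rw [← Finset.mul_sum]
            gcongr
            refine h1.trans ?_
            gcongr
        _ = _ := by rw [hK]; ring
    refine ⟨summable_of_sum_range_le (fun n => by positivity) hbound, ?_⟩
    have h3 := Real.tsum_le_of_sum_range_le (fun n => by positivity) hbound
    have h4 : (Real.exp ℓ ^ 2) ^ s = (Real.exp ℓ ^ s) ^ 2 := by
      rw [← Real.rpow_natCast, ← Real.rpow_natCast, ← Real.rpow_mul (by positivity),
        ← Real.rpow_mul (by positivity), mul_comm]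
    rw [sobolevNorm, sobolevNorm]
    refine (Real.sqrt_le_sqrt h3).trans (le_of_eq ?_)
    rw [h4, Real.sqrt_mul (by positivity), Real.sqrt_mul (by positivity),
      Real.sqrt_sq (by positivity)]

/-! ### Dilations on the Sobolev spaces: lower bounds -/

/-- The mass `∫ x²/(1+x²) |f|²` of `f` away from the origin. -/
noncomputable def outerMass (f : L2R) : ℝ := ∫ x : ℝ, x ^ 2 / (1 + x ^ 2) * ‖f x‖ ^ 2

theorem outer_weight_nonneg (x : ℝ) : 0 ≤ x ^ 2 / (1 + x ^ 2) := by positivity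

theorem outer_weight_le_one (x : ℝ) : x ^ 2 / (1 + x ^ 2) ≤ 1 := by
  rw [div_le_one (by positivity)]; linarith

theorem integrable_norm_sq (f : L2R) : Integrable fun x => ‖f x‖ ^ 2 :=
  (Lp.memLp f).norm.integrable_sq

theorem integral_norm_sq (f : L2R) : ∫ x, ‖f x‖ ^ 2 = ‖f‖ ^ 2 := by
  have h := L2.inner_def (𝕜 := ℂ) f f
  rw [inner_self_eq_norm_sq_to_K] at h
  simp_rw [inner_self_eq_norm_sq_to_K] at h
  have h2 : ((‖f‖ ^ 2 : ℝ) : ℂ) = ((∫ x, ‖f x‖ ^ 2 : ℝ) : ℂ) := by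
    rw [← integral_complex_ofReal]
    push_cast
    exact h
  exact_mod_cast h2.symm

theorem integrable_outer (r : ℝ) (f : L2R) :
    Integrable fun x : ℝ => (r * x) ^ 2 / (1 + (r * x) ^ 2) * ‖f x‖ ^ 2 := by
  refine (integrable_norm_sq f).mono' ?_ (ae_of_all _ fun x => ?_)
  · refine AEStronglyMeasurable.mul (Continuous.aestronglyMeasurable ?_)
      (integrable_norm_sq f).aestronglyMeasurable
    exact Continuous.div (by fun_prop) (by fun_prop) fun x => by positivity
  · rw [Real.norm_eq_abs, abs_of_nonneg (mul_nonneg (outer_weight_nonneg _) (by positivity))]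
    exact mul_le_of_le_one_left (by positivity) (outer_weight_le_one _)

theorem outerMass_pos {f : L2R} (hf : f ≠ 0) : 0 < outerMass f := by
  have hi : Integrable fun x : ℝ => x ^ 2 / (1 + x ^ 2) * ‖f x‖ ^ 2 := by
    simpa using integrable_outer 1 f
  have hnn : 0 ≤ fun x : ℝ => x ^ 2 / (1 + x ^ 2) * ‖f x‖ ^ 2 := fun x =>
    mul_nonneg (outer_weight_nonneg _) (by positivity)
  refine lt_of_le_of_ne (integral_nonneg hnn) fun h0 => hf ?_
  have h1 := (integral_eq_zero_iff_of_nonneg hnn hi).mp h0.symm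
  rw [Lp.eq_zero_iff_ae_eq_zero]
  have h2 : ∀ᵐ x : ℝ, x ≠ 0 := by
    simp [ae_iff]
  filter_upwards [h1, h2] with x hx hx0
  rcases mul_eq_zero.mp hx with h | h
  · exact absurd h (by positivity)
  · simpa using h

theorem outerMass_le_add (f g : L2R) : outerMass f ≤ 2 * outerMass g + 2 * ‖f - g‖ ^ 2 := by
  rw [← integral_norm_sq, outerMass, outerMass, ← integral_const_mul, ← integral_const_mul]
  have hi : ∀ f : L2R, Integrable fun x : ℝ => x ^ 2 / (1 + x ^ 2) * ‖f x‖ ^ 2 := fun f => by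
    simpa using integrable_outer 1 f
  rw [← integral_add ((hi g).const_mul 2) ((integrable_norm_sq (f - g)).const_mul 2)]
  refine integral_mono_ae (hi f) (((hi g).const_mul 2).add
    ((integrable_norm_sq (f - g)).const_mul 2)) ?_
  filter_upwards [Lp.coeFn_sub f g] with x hx
  rw [hx, Pi.sub_apply]
  have h1 : ‖f x‖ ^ 2 ≤ 2 * (‖g x‖ ^ 2 + ‖f x - g x‖ ^ 2) := by
    calc _ = ‖g x + (f x - g x)‖ ^ 2 := by rw [add_sub_cancel]
      _ ≤ (‖g x‖ + ‖f x - g x‖) ^ 2 := by gcongr; exact norm_add_le _ _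
      _ ≤ _ := add_sq_le
  have h2 := outer_weight_nonneg x
  have h3 := outer_weight_le_one x
  calc _ ≤ x ^ 2 / (1 + x ^ 2) * (2 * (‖g x‖ ^ 2 + ‖f x - g x‖ ^ 2)) := by gcongr
    _ = 2 * (x ^ 2 / (1 + x ^ 2) * ‖g x‖ ^ 2) + 2 * (x ^ 2 / (1 + x ^ 2) * ‖f x - g x‖ ^ 2) := by
      ring
    _ ≤ _ := by
      have := mul_le_of_le_one_left (show 0 ≤ ‖f x - g x‖ ^ 2 by positivity) h3
      linarith

theorem rot_periodic (f : L2R) : Function.Periodic (fun θ => rot θ f) (4 * Real.pi) := by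
  intro θ
  apply hermiteBasis.repr.injective
  ext n
  simp only [HilbertBasis.repr_apply_apply, ← hermiteCoeff_eq_inner, hermiteCoeff_rot]
  congr 1
  rw [phase, phase, Complex.exp_eq_exp_iff_exists_int]
  refine ⟨-(2 * n + 1), ?_⟩
  push_cast
  ring

/-- By compactness of the circle, all rotations of `f ≠ 0` carry a fixed mass away from the
origin. -/
theorem exists_outerMass_rot_ge {f : L2R} (hf : f ≠ 0) :
    ∃ m : ℝ, 0 < m ∧ ∀ θ : ℝ, m ≤ outerMass (rot θ f) := by
  have hc : ∃ m : ℝ, 0 < m ∧ ∀ θ ∈ Icc 0 (4 * Real.pi), m ≤ outerMass (rot θ f) := by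
    refine isCompact_Icc.induction_on (p := fun s => ∃ m : ℝ, 0 < m ∧ ∀ θ ∈ s,
      m ≤ outerMass (rot θ f)) ⟨1, one_pos, by simp⟩ ?_ ?_ ?_
    · rintro s t hst ⟨m, hm, h⟩
      exact ⟨m, hm, fun θ hθ => h θ (hst hθ)⟩
    · rintro s t ⟨m, hm, h⟩ ⟨m', hm', h'⟩
      refine ⟨min m m', lt_min hm hm', fun θ hθ => ?_⟩
      rcases hθ with hθ | hθ
      · exact (min_le_left _ _).trans (h θ hθ)
      · exact (min_le_right _ _).trans (h' θ hθ)
    · intro θ₀ _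
      have h0 : 0 < outerMass (rot θ₀ f) :=
        outerMass_pos fun h => hf ((rot θ₀).injective (h.trans (map_zero _).symm))
      have hcont : Continuous fun θ => 2 * ‖rot θ₀ f - rot θ f‖ ^ 2 := by
        have := continuous_rot f
        fun_prop
      have hev : ∀ᶠ θ in 𝓝 θ₀, 2 * ‖rot θ₀ f - rot θ f‖ ^ 2 < outerMass (rot θ₀ f) / 2 := by
        refine hcont.continuousAt.eventually_lt_const ?_
        simp only [sub_self, norm_zero]
        linarith
      refine ⟨_, mem_nhdsWithin_of_mem_nhds hev, outerMass (rot θ₀ f) / 4, by positivity,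
        fun θ hθ => ?_⟩
      have h1 := outerMass_le_add (rot θ₀ f) (rot θ f)
      have h2 : 2 * ‖rot θ₀ f - rot θ f‖ ^ 2 < outerMass (rot θ₀ f) / 2 := hθ
      linarith
  obtain ⟨m, hm, h⟩ := hc
  refine ⟨m, hm, fun θ => ?_⟩
  obtain ⟨y, hy, hθ⟩ := (rot_periodic f).exists_mem_Ico₀ (by positivity) θ
  have hθ' : rot θ f = rot y f := hθ
  rw [hθ']
  exact h y (Ico_subset_Icc_self hy)

/-- The mass of `f` away from the origin, measured after a dilation by `e^ℓ`. -/
theorem outerMass_eq_dil (ℓ : ℝ) (f : L2R) :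
    outerMass f = ∫ x : ℝ, (Real.exp (-ℓ) * x) ^ 2 / (1 + (Real.exp (-ℓ) * x) ^ 2) *
      ‖dil 0 ℓ f x‖ ^ 2 := by
  have h1 : ∫ x : ℝ, (Real.exp (-ℓ) * x) ^ 2 / (1 + (Real.exp (-ℓ) * x) ^ 2) * ‖dil 0 ℓ f x‖ ^ 2 =
      ∫ x : ℝ, (fun y : ℝ => Real.exp (-ℓ) * (y ^ 2 / (1 + y ^ 2) * ‖f y‖ ^ 2))
        (Real.exp (-ℓ) * x) := by
    apply integral_congr_ae
    filter_upwards [coeFn_dil 0 ℓ f] with x hx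
    rw [hx, norm_mul, norm_chirp]
    have : Real.exp (-ℓ) = Real.exp (-ℓ / 2) ^ 2 := by rw [← Real.exp_nat_mul]; congr 1; ring
    rw [mul_pow (Real.exp (-ℓ / 2)), ← this]
    ring
  rw [h1, Measure.integral_comp_mul_left
    (fun y : ℝ => Real.exp (-ℓ) * (y ^ 2 / (1 + y ^ 2) * ‖f y‖ ^ 2)), integral_const_mul, abs_inv,
    Real.abs_exp, smul_eq_mul, ← mul_assoc, inv_mul_cancel₀ (Real.exp_pos _).ne', one_mul]
  rfl

theorem posS_hermiteS_eq (n : ℕ) :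
    posS (hermiteS n) = (((1 / Real.sqrt 2) * Real.sqrt (n + 1) : ℝ) : ℂ) • hermiteS (n + 1) +
      (((1 / Real.sqrt 2) * Real.sqrt n : ℝ) : ℂ) • hermiteS (n - 1) := by
  ext x
  have h' : ∀ f g : 𝓢(ℝ, ℂ), (f + g) x = f x + g x := fun f g => rfl
  have h3 : ∀ (z : ℂ) (f : 𝓢(ℝ, ℂ)), (z • f) x = z * f x := fun f g => rfl
  rw [h', h3, h3, posS_apply, hermiteS_apply, hermiteS_apply, hermiteS_apply]
  norm_cast
  have h := two_mul_hermiteFun n x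
  have e : ∀ y : ℝ, Real.sqrt (2 * y) = Real.sqrt 2 * Real.sqrt y := fun y =>
    Real.sqrt_mul (by norm_num) y
  rw [e, e] at h
  have h2 : Real.sqrt 2 * Real.sqrt 2 = 2 := Real.mul_self_sqrt (by norm_num)
  have h4 : Real.sqrt 2 ≠ 0 := by positivity
  push_cast
  field_simp
  apply mul_left_cancel₀ h4
  linear_combination h + (x * hermiteFun n x) * h2

/-- The position operator is bounded by `O(√M)` on the span of the first `M` Hermite functions. -/
theorem exists_toL2_eq_hermiteSum_and_norm_posS_le (M : ℕ) (v : ℕ → ℂ) (hv : ∀ m, M ≤ m → v m = 0) :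
    ∃ g : 𝓢(ℝ, ℂ), toL2 g = hermiteSum M v ∧
      ‖toL2 (posS g)‖ ^ 2 ≤ 2 * M * ‖hermiteSum M v‖ ^ 2 := by
  refine ⟨∑ m ∈ Finset.range M, v m • hermiteS m, ?_, ?_⟩
  · have : ∀ s : Finset ℕ, toL2 (∑ m ∈ s, v m • hermiteS m) = ∑ m ∈ s, v m • hermiteBasis m := by
      intro s
      induction s using Finset.induction_on with
      | empty => simp [toL2_zero]
      | insert a s ha ih =>
        rw [Finset.sum_insert ha, Finset.sum_insert ha, toL2_add, ih, toL2_smul, hermiteBasis_apply]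
    exact this _
  · have h1 : toL2 (posS (∑ m ∈ Finset.range M, v m • hermiteS m)) =
        hermiteSum (M + 1) (ladder (1 / Real.sqrt 2) (1 / Real.sqrt 2) v) := by
      rw [hermiteSum, sum_ladder_smul _ _ _ _ _ hv, map_sum]
      have : ∀ s : Finset ℕ, toL2 (∑ m ∈ s, posS (v m • hermiteS m)) =
          ∑ m ∈ s, v m • (((1 / Real.sqrt 2 * Real.sqrt (m + 1) : ℝ) : ℂ) • hermiteBasis (m + 1) +
            ((1 / Real.sqrt 2 * Real.sqrt m : ℝ) : ℂ) • hermiteBasis (m - 1)) := by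
        intro s
        induction s using Finset.induction_on with
        | empty => simp [toL2_zero]
        | insert a s ha ih =>
          rw [Finset.sum_insert ha, Finset.sum_insert ha, toL2_add, ih, map_smul, toL2_smul,
            posS_hermiteS_eq, toL2_add, toL2_smul, toL2_smul, hermiteBasis_apply,
            hermiteBasis_apply]
      exact this _
    have hp : (0 : ℝ) ≤ 1 / Real.sqrt 2 := by positivity
    have h2 := sum_ladder_sq_le 0 hp hp le_rfl le_rfl M v hv
    rw [h1, norm_hermiteSum_sq, norm_hermiteSum_sq]
    simp only [pow_zero, one_mul, zero_add, pow_one, div_pow, one_pow,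
      Real.sq_sqrt (show (0 : ℝ) ≤ 2 by norm_num)] at h2
    refine h2.trans ?_
    have h3 : ∑ m ∈ Finset.range M, ((m : ℝ) + 1) * ‖v m‖ ^ 2 ≤
        ∑ m ∈ Finset.range M, (M : ℝ) * ‖v m‖ ^ 2 := by
      refine Finset.sum_le_sum fun m hm => ?_
      have : ((m + 1 : ℕ) : ℝ) ≤ M := Nat.cast_le.mpr (Finset.mem_range.mp hm)
      push_cast at this
      gcongr
    rw [← Finset.mul_sum] at h3
    linarith

/-- Dilations by `ρ = e^ℓ` of the rotations of `f ≠ 0` have `ℋˢ` norm at least a multiple of `ρˢ`. -/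
theorem exists_sobolevNorm_dil_rot_ge {s : ℝ} (hs : 0 ≤ s) {f : L2R} (hf : f ≠ 0) :
    ∃ m : ℝ, 0 < m ∧ ∀ ℓ θ : ℝ, dil 0 ℓ (rot θ f) ∈ sobolevSpace s →
      m * Real.exp ℓ ^ s ≤ sobolevNorm s (dil 0 ℓ (rot θ f)) := by
  obtain ⟨m, hm, h⟩ := exists_outerMass_rot_ge hf
  have hf0 : 0 < ‖f‖ := norm_pos_iff.mpr hf
  -- The energy cut-off is `κ ρ²`: below it `x² / ρ²` has expectation at most `2 κ ‖f‖² = m / 4`, too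
  -- little to account for the outer mass `m`.
  set κ : ℝ := m / (8 * ‖f‖ ^ 2) with hκ
  have hκ0 : 0 < κ := by positivity
  refine ⟨Real.sqrt (κ ^ s * (m / 4)), by positivity, fun ℓ θ hw => ?_⟩
  set w := dil 0 ℓ (rot θ f) with hw_def
  have hwn : ‖w‖ = ‖f‖ := by rw [hw_def, LinearIsometryEquiv.norm_map, LinearIsometryEquiv.norm_map]
  set ρ := Real.exp ℓ with hρ
  have hρ0 : 0 < ρ := Real.exp_pos _
  set M := ⌊κ * ρ ^ 2⌋₊ with hM
  have hM1 : (M : ℝ) ≤ κ * ρ ^ 2 := Nat.floor_le (by positivity)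
  have hM2 : κ * ρ ^ 2 < M + 1 := Nat.lt_floor_add_one _
  set w₁ := hermiteSum M (lowCoeff M w) with hw₁
  obtain ⟨g, hg, hgX⟩ := exists_toL2_eq_hermiteSum_and_norm_posS_le M (lowCoeff M w) (lowCoeff_eq_zero M w)
  have hw₁n : ‖w₁‖ ^ 2 ≤ ‖f‖ ^ 2 := by
    rw [hw₁, norm_hermiteSum_sq, ← hwn]
    have := sum_lowCoeff_sq (fun _ => 1) M w
    simp only [one_mul] at this
    rw [this]
    exact sum_le_hasSum _ (fun _ _ => by positivity) (hasSum_hermiteCoeff_sq w)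
  have hXi : Integrable fun x => ‖posS g x‖ ^ 2 := ((posS g).memLp 2 volume).norm.integrable_sq
  have htail : m / 4 ≤ ‖w - w₁‖ ^ 2 := by
    have h1 := h θ
    rw [outerMass_eq_dil ℓ] at h1
    have h2 : ∫ x : ℝ, (Real.exp (-ℓ) * x) ^ 2 / (1 + (Real.exp (-ℓ) * x) ^ 2) * ‖w x‖ ^ 2 ≤
        ∫ x : ℝ, 2 * ((Real.exp (-ℓ)) ^ 2 * ‖posS g x‖ ^ 2) + 2 * ‖(w - w₁) x‖ ^ 2 := by
      refine integral_mono_ae (integrable_outer _ w) (((hXi.const_mul _).const_mul 2).add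
        ((integrable_norm_sq (w - w₁)).const_mul 2)) ?_
      filter_upwards [Lp.coeFn_sub w w₁, coeFn_toL2 g] with x hx hgx
      rw [hg] at hgx
      rw [hx, Pi.sub_apply, posS_apply, ← hgx, ← hw₁]
      have e1 : ‖w x‖ ^ 2 ≤ 2 * (‖w₁ x‖ ^ 2 + ‖w x - w₁ x‖ ^ 2) := by
        calc _ = ‖w₁ x + (w x - w₁ x)‖ ^ 2 := by rw [add_sub_cancel]
          _ ≤ (‖w₁ x‖ + ‖w x - w₁ x‖) ^ 2 := by gcongr; exact norm_add_le _ _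
          _ ≤ _ := add_sq_le
      set q := Real.exp (-ℓ) * x with hq
      have e2 := outer_weight_nonneg q
      have e3 := outer_weight_le_one q
      have e4 : q ^ 2 / (1 + q ^ 2) ≤ q ^ 2 := div_le_self (by positivity) (by nlinarith [sq_nonneg q])
      have e5 : Real.exp (-ℓ) ^ 2 * ‖(x : ℂ) * w₁ x‖ ^ 2 = q ^ 2 * ‖w₁ x‖ ^ 2 := by
        rw [norm_mul, Complex.norm_real, mul_pow, Real.norm_eq_abs, sq_abs, hq]; ring
      rw [e5]
      calc _ ≤ q ^ 2 / (1 + q ^ 2) * (2 * (‖w₁ x‖ ^ 2 + ‖w x - w₁ x‖ ^ 2)) := by gcongr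
        _ = 2 * (q ^ 2 / (1 + q ^ 2) * ‖w₁ x‖ ^ 2) +
            2 * (q ^ 2 / (1 + q ^ 2) * ‖w x - w₁ x‖ ^ 2) := by ring
        _ ≤ 2 * (q ^ 2 * ‖w₁ x‖ ^ 2) + 2 * (1 * ‖w x - w₁ x‖ ^ 2) := by gcongr
        _ = _ := by ring
    rw [integral_add ((hXi.const_mul _).const_mul 2) ((integrable_norm_sq (w - w₁)).const_mul 2),
      integral_const_mul, integral_const_mul, integral_const_mul, integral_norm_sq,
      ← norm_toL2_sq] at h2
    have h3 : Real.exp (-ℓ) ^ 2 * ‖toL2 (posS g)‖ ^ 2 ≤ m / 4 := by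
      have e1 : Real.exp (-ℓ) ^ 2 = (ρ ^ 2)⁻¹ := by rw [Real.exp_neg, inv_pow]
      calc _ ≤ (ρ ^ 2)⁻¹ * (2 * (κ * ρ ^ 2) * ‖f‖ ^ 2) := by
            rw [e1]
            gcongr
            exact hgX.trans (by gcongr)
        _ = m / 4 := by
            rw [hκ]; field_simp; ring
    linarith
  have hlow : (κ * ρ ^ 2) ^ s * (m / 4) ≤ ∑' n : ℕ, (2 * (n : ℝ) + 1) ^ s * ‖hermiteCoeff w n‖ ^ 2 := by
    calc _ ≤ (κ * ρ ^ 2) ^ s * ‖w - w₁‖ ^ 2 := by gcongr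
      _ = ∑' n : ℕ, (κ * ρ ^ 2) ^ s * (if n < M then 0 else ‖hermiteCoeff w n‖ ^ 2) := by
          rw [tsum_mul_left, (hasSum_tail_sq M w).tsum_eq]
      _ ≤ _ := by
          refine ((hasSum_tail_sq M w).summable.mul_left _).tsum_le_tsum (fun n => ?_) hw
          split_ifs with hn
          · rw [mul_zero]; positivity
          · have : (M : ℝ) ≤ n := Nat.cast_le.mpr (not_lt.mp hn)
            have : κ * ρ ^ 2 ≤ 2 * (n : ℝ) + 1 := by linarith [n.cast_nonneg (α := ℝ)]
            gcongr
  have h4 : (κ * ρ ^ 2) ^ s * (m / 4) = (κ ^ s * (m / 4)) * (ρ ^ s) ^ 2 := by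
    rw [Real.mul_rpow hκ0.le (by positivity), ← Real.rpow_natCast, ← Real.rpow_natCast,
      ← Real.rpow_mul hρ0.le, ← Real.rpow_mul hρ0.le, mul_comm (2 : ℕ).cast s]
    ring
  rw [sobolevNorm]
  refine le_trans (le_of_eq ?_) (Real.sqrt_le_sqrt hlow)
  rw [h4, Real.sqrt_mul (show 0 ≤ κ ^ s * (m / 4) by positivity) ((ρ ^ s) ^ 2),
    Real.sqrt_sq (by positivity)]

/-! ### Solutions from a fundamental matrix -/

-- `‖M‖` is the Frobenius norm of a matrix from here on
attribute [local instance] Matrix.frobeniusNormedRing Matrix.frobeniusNormedAlgebra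

theorem frobenius_sq (M : Matrix (Fin 2) (Fin 2) ℝ) :
    ‖M‖ ^ 2 = M 0 0 ^ 2 + M 0 1 ^ 2 + M 1 0 ^ 2 + M 1 1 ^ 2 := by
  rw [Matrix.frobenius_norm_def, ← Real.sqrt_eq_rpow, Real.sq_sqrt (by positivity)]
  simp [Fin.sum_univ_two, add_assoc]

theorem one_le_norm_of_det_eq_one {M : Matrix (Fin 2) (Fin 2) ℝ} (h : M.det = 1) : 1 ≤ ‖M‖ := by
  have h1 := frobenius_sq M
  rw [Matrix.det_fin_two] at h
  nlinarith [sq_nonneg (M 0 0 - M 1 1), sq_nonneg (M 0 1 + M 1 0), norm_nonneg M]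

/-- `F` is the fundamental matrix, with `F 0 = 1`, of the Hamiltonian system
`x' = b x + c ξ`, `ξ' = -a x - b ξ`. -/
structure IsFundamental (a b c : ℝ → ℝ) (F : ℝ → Matrix (Fin 2) (Fin 2) ℝ) : Prop where
  map_zero : F 0 = 1
  hasDerivAt : ∀ t i j, HasDerivAt (fun τ => F τ i j) ((!![b t, c t; -a t, -b t] * F t) i j) t

theorem IsFundamental.det_eq_one {a b c : ℝ → ℝ} {F : ℝ → Matrix (Fin 2) (Fin 2) ℝ}
    (h : IsFundamental a b c F) (t : ℝ) : (F t).det = 1 := by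
  have hd : ∀ t, HasDerivAt (fun τ => (F τ).det) 0 t := by
    intro t
    simp only [Matrix.det_fin_two]
    convert! ((h.hasDerivAt t 0 0).mul (h.hasDerivAt t 1 1)).sub
      ((h.hasDerivAt t 0 1).mul (h.hasDerivAt t 1 0)) using 1
    simp only [Matrix.mul_apply, Fin.sum_univ_two, Matrix.of_apply, Matrix.cons_val', Matrix.cons_val_zero,
      Matrix.cons_val_one, Matrix.cons_val_fin_one]
    ring
  have := is_const_of_deriv_eq_zero (fun t => (hd t).differentiableAt) (fun t => (hd t).deriv) t 0
  rw [this, h.map_zero, Matrix.det_one]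

/-- The image of `f ≠ 0` under the metaplectic operator of `G ∈ SL(2, ℝ)` has `ℋˢ` norm comparable
to `‖G‖ˢ`, uniformly in `G` and in the phase `θ`. -/
theorem exists_norm_bounds_metaplectic {s : ℝ} (hs : 0 ≤ s) {f : L2R} (hf : f ∈ sobolevSpace s)
    (hne : f ≠ 0) : ∃ m M : ℝ, 0 < m ∧ 0 < M ∧ ∀ (G : Matrix (Fin 2) (Fin 2) ℝ) (θ : ℝ), G.det = 1 →
      ∀ v, v = metaplectic ((G 0 0 * G 1 0 + G 0 1 * G 1 1) / (G 0 0 ^ 2 + G 0 1 ^ 2))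
        (Real.log (G 0 0 ^ 2 + G 0 1 ^ 2) / 2) θ f →
      v ∈ sobolevSpace s ∧ m * ‖G‖ ^ s ≤ sobolevNorm s v ∧ sobolevNorm s v ≤ M * ‖G‖ ^ s := by
  obtain ⟨C, hC, hup⟩ := exists_sobolevNorm_dil_le hs
  obtain ⟨m, hm, hlo⟩ := exists_sobolevNorm_dil_rot_ge hs hne
  have h2 : (0 : ℝ) < 2 ^ s := by positivity
  refine ⟨m / 2 ^ s, C * (sobolevNorm s f + 1), by positivity,
    mul_pos hC (add_pos_of_nonneg_of_pos (Real.sqrt_nonneg _) one_pos), ?_⟩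
  rintro G θ hG v hv
  obtain ⟨τ, ℓ, θ₁, hℓ, h1, h2, h3⟩ := exists_rot_metaplectic_eq_dil (G 0 0) (G 0 1) (G 1 0) (G 1 1)
    (by rw [← hG, Matrix.det_fin_two]) θ f
  rw [← hv] at h3
  rw [← frobenius_sq] at h1 h2
  have hle : Real.exp ℓ ≤ ‖G‖ := (sq_le_sq₀ (Real.exp_pos _).le (norm_nonneg _)).mp h2
  have hge : ‖G‖ ≤ 2 * Real.exp ℓ := by
    refine (sq_le_sq₀ (norm_nonneg _) (by positivity)).mp ?_
    nlinarith [sq_nonneg (Real.exp ℓ)]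
  obtain ⟨hmem, hup⟩ := hup ℓ hℓ (rot θ₁ f) ((rot_mem_sobolevSpace s θ₁ f).mpr hf)
  have hlo := hlo ℓ θ₁ hmem
  rw [← h3, rot_mem_sobolevSpace] at hmem
  rw [← h3, sobolevNorm_rot] at hup hlo
  rw [sobolevNorm_rot] at hup
  have hf0 : 0 ≤ sobolevNorm s f := Real.sqrt_nonneg _
  refine ⟨hmem, le_trans ?_ hlo, hup.trans ?_⟩
  · calc m / 2 ^ s * ‖G‖ ^ s ≤ m / 2 ^ s * (2 * Real.exp ℓ) ^ s := by gcongr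
      _ = m * Real.exp ℓ ^ s := by
        rw [Real.mul_rpow (by norm_num) (Real.exp_pos _).le]
        field_simp
  · calc C * Real.exp ℓ ^ s * sobolevNorm s f ≤ C * ‖G‖ ^ s * (sobolevNorm s f + 1) := by
          gcongr; linarith
      _ = _ := by ring

/-- The Cauchy problem is solved by the metaplectic operators of the fundamental matrix `F`, and
`‖u(t)‖ₛ` is comparable to `‖F(t)‖ˢ`. -/
theorem IsFundamental.exists_solution {a b c : ℝ → ℝ} {F : ℝ → Matrix (Fin 2) (Fin 2) ℝ}
    (h : IsFundamental a b c F) (ca : Continuous a) (cb : Continuous b) (cc : Continuous c)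
    {s : ℝ} (hs : 0 ≤ s) {f : L2R} (hf : f ∈ sobolevSpace s) (hne : f ≠ 0) :
    ∃ u : ℝ → L2R, IsWeakSol a b c u ∧ u 0 = f ∧
      (∀ w : ℝ → L2R, IsWeakSol a b c w → w 0 = f → ∀ t : ℝ, 0 ≤ t → w t = u t) ∧
      (∀ t, u t ∈ sobolevSpace s) ∧ ∃ m M : ℝ, 0 < m ∧ 0 < M ∧ ∀ t,
        m * ‖F t‖ ^ s ≤ sobolevNorm s (u t) ∧ sobolevNorm s (u t) ≤ M * ‖F t‖ ^ s := by
  have hdet : ∀ t, F t 0 0 * F t 1 1 - F t 0 1 * F t 1 0 = 1 := fun t => by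
    rw [← h.det_eq_one t, Matrix.det_fin_two]
  have hpos : ∀ t, F t 0 0 ^ 2 + F t 0 1 ^ 2 ≠ 0 := by
    intro t ht
    have h0 := hdet t
    have h1 : F t 0 0 = 0 := by nlinarith [sq_nonneg (F t 0 0), sq_nonneg (F t 0 1)]
    have h2 : F t 0 1 = 0 := by nlinarith [sq_nonneg (F t 0 0), sq_nonneg (F t 0 1)]
    rw [h1, h2] at h0
    norm_num at h0
  have hcont : ∀ i j, Continuous fun t => F t i j := fun i j =>
    continuous_iff_continuousAt.mpr fun t => (h.hasDerivAt t i j).continuousAt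
  obtain ⟨θ, hθ0, hθ⟩ := exists_angle (f := fun t => c t / (F t 0 0 ^ 2 + F t 0 1 ^ 2))
    (cc.div (((hcont 0 0).pow 2).add ((hcont 0 1).pow 2)) hpos) 0
  have hd : ∀ t i j, HasDerivAt (fun τ => F τ i j)
      ((!![b t, c t; -a t, -b t] * F t) i j) t := h.hasDerivAt
  simp only [Matrix.mul_apply, Fin.sum_univ_two] at hd
  have hflow := isIwasawaFlow_of_matrix ca cb cc (α := fun t => F t 0 0) (β := fun t => F t 0 1)
    (δ := fun t => F t 1 0) (ε := fun t => F t 1 1) (fun t => by simpa using hd t 0 0)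
    (fun t => by simpa using hd t 0 1)
    (fun t => by simpa [sub_eq_add_neg] using hd t 1 0)
    (fun t => by simpa [sub_eq_add_neg] using hd t 1 1) hdet hθ
  obtain ⟨m, M, hm, hM, hb⟩ := exists_norm_bounds_metaplectic hs hf hne
  have h0 : metaplectic ((F 0 0 0 * F 0 1 0 + F 0 0 1 * F 0 1 1) / (F 0 0 0 ^ 2 + F 0 0 1 ^ 2))
      (Real.log (F 0 0 0 ^ 2 + F 0 0 1 ^ 2) / 2) (θ 0) f = f := by
    rw [h.map_zero, hθ0, metaplectic_apply, rot_zero]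
    simp [dil_zero_zero]
  have hb' := fun t => hb (F t) (θ t) (h.det_eq_one t) _ rfl
  exact ⟨_, isWeakSol_metaplectic hflow f, h0, fun w hw hw0 t ht =>
    eq_metaplectic_of_isWeakSol hflow hw f (hw0.trans h0.symm) ht, fun t => (hb' t).1,
    m, M, hm, hM, fun t => (hb' t).2⟩

/-! ### The reduced system -/

/-- The Cayley-Hamilton theorem for a traceless matrix. -/
theorem sq_eq_of_trace_eq_zero {B : Matrix (Fin 2) (Fin 2) ℝ} (hB : B.trace = 0) :
    B * B = (-B.det) • (1 : Matrix (Fin 2) (Fin 2) ℝ) := by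
  rw [Matrix.trace_fin_two] at hB
  have h : B 1 1 = -B 0 0 := by linarith
  ext i j
  fin_cases i <;> fin_cases j <;>
    simp [Matrix.mul_apply, Fin.sum_univ_two, Matrix.det_fin_two, h] <;> ring

/-- The functions `C = cosh (√D t)` and `S = sinh (√D t) / √D`, interpreted as `cos` and `sin` for
`D < 0` and as `1` and `t` for `D = 0`. -/
theorem exists_cosh_sinh (D : ℝ) : ∃ C S : ℝ → ℝ, C 0 = 1 ∧ S 0 = 0 ∧
    (∀ t, HasDerivAt C (D * S t) t) ∧ (∀ t, HasDerivAt S (C t) t) ∧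
    (D < 0 → ∃ L, ∀ t, |C t| ≤ L ∧ |S t| ≤ L) ∧
    (0 < D → ∃ L, ∀ t, 0 ≤ t → |C t| ≤ L * Real.exp (Real.sqrt D * t) ∧
      |S t| ≤ L * Real.exp (Real.sqrt D * t) ∧ Real.exp (Real.sqrt D * t) ≤ 2 * C t) ∧
    (D = 0 → ∀ t, C t = 1 ∧ S t = t) := by
  rcases lt_trichotomy D 0 with h | h | h
  · set l := Real.sqrt (-D) with hl
    have hl0 : 0 < l := Real.sqrt_pos.mpr (by linarith)
    have hD : D = -l ^ 2 := by rw [hl, Real.sq_sqrt (by linarith)]; ring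
    have hlin : ∀ t, HasDerivAt (fun τ => l * τ) l t := fun t => by
      simpa using (hasDerivAt_id t).const_mul l
    refine ⟨fun t => Real.cos (l * t), fun t => Real.sin (l * t) / l, by simp, by simp,
      fun t => ?_, fun t => ?_, fun _ => ⟨1 + 1 / l, fun t => ⟨?_, ?_⟩⟩, fun h' => absurd h' h.not_gt,
      fun h' => absurd h' h.ne⟩
    · convert! (hlin t).cos using 1
      rw [hD]; field_simp
    · convert! (hlin t).sin.div_const l using 1
      field_simp
    · exact (Real.abs_cos_le_one _).trans (by linarith [one_div_pos.mpr hl0])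
    · rw [abs_div, abs_of_pos hl0]
      have := Real.abs_sin_le_one (l * t)
      calc _ ≤ 1 / l := by gcongr
        _ ≤ _ := by linarith
  · subst h
    refine ⟨fun _ => 1, fun t => t, rfl, rfl, fun t => ?_, fun t => hasDerivAt_id t,
      fun h' => absurd h' (lt_irrefl _), fun h' => absurd h' (lt_irrefl _), fun _ t => ⟨rfl, rfl⟩⟩
    simpa using hasDerivAt_const t (1 : ℝ)
  · set l := Real.sqrt D with hl
    have hl0 : 0 < l := Real.sqrt_pos.mpr h
    have hD : D = l ^ 2 := by rw [hl, Real.sq_sqrt h.le]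
    have hlin : ∀ t, HasDerivAt (fun τ => l * τ) l t := fun t => by
      simpa using (hasDerivAt_id t).const_mul l
    refine ⟨fun t => Real.cosh (l * t), fun t => Real.sinh (l * t) / l, by simp, by simp,
      fun t => ?_, fun t => ?_, fun h' => absurd h' h.not_gt, fun _ => ⟨1 + 1 / l, fun t ht => ?_⟩,
      fun h' => absurd h' h.ne'⟩
    · convert! (hlin t).cosh using 1
      rw [hD]; field_simp
    · convert! (hlin t).sinh.div_const l using 1
      field_simp
    · have h0 : 0 ≤ l * t := by positivity
      have h1 : Real.exp (-(l * t)) ≤ Real.exp (l * t) := Real.exp_le_exp.mpr (by linarith)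
      have h2 := Real.exp_pos (-(l * t))
      have h3 := one_div_pos.mpr hl0
      refine ⟨?_, ?_, ?_⟩
      · rw [abs_of_pos (Real.cosh_pos _), Real.cosh_eq]
        nlinarith [mul_pos h3 (Real.exp_pos (l * t))]
      · have h4 : |Real.sinh (l * t)| ≤ Real.exp (l * t) := by
          rw [abs_le, Real.sinh_eq]
          constructor <;> linarith
        rw [abs_div, abs_of_pos hl0]
        calc _ ≤ Real.exp (l * t) / l := by gcongr
          _ = 1 / l * Real.exp (l * t) := by ring
          _ ≤ _ := by gcongr; linarith
      · simp only [Real.cosh_eq]; linarith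

theorem exists_abs_le_of_periodic {d : ℕ} {p : ℝ} (hp : 0 < p) {g : (Fin d → ℝ) → ℝ}
    (hg : Continuous g) (hper : ∀ (θ : Fin d → ℝ) (n : Fin d → ℤ), g (θ + fun i => p * n i) = g θ) :
    ∃ L, ∀ θ, |g θ| ≤ L := by
  obtain ⟨L, hL⟩ := (isCompact_univ_pi fun _ : Fin d => isCompact_Icc (a := (0 : ℝ)) (b := p))
    |>.exists_bound_of_continuousOn hg.continuousOn
  refine ⟨L, fun θ => ?_⟩
  have h := hper (fun i => Int.fract (θ i / p) * p) fun i => ⌊θ i / p⌋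
  have e : ((fun i => Int.fract (θ i / p) * p) + fun i => p * (⌊θ i / p⌋ : ℝ)) = θ := by
    ext i
    have := Int.fract_add_floor (θ i / p)
    simp only [Pi.add_apply]
    calc _ = (Int.fract (θ i / p) + ⌊θ i / p⌋) * p := by ring
      _ = θ i := by rw [this]; field_simp
  rw [e] at h
  rw [h]
  refine hL _ fun i _ => ⟨mul_nonneg (Int.fract_nonneg _) hp.le, ?_⟩
  exact mul_le_of_le_one_left hp.le (Int.fract_lt_one _).le

theorem continuous_matrix_exp :
    Continuous (NormedSpace.exp : Matrix (Fin 2) (Fin 2) ℝ → Matrix (Fin 2) (Fin 2) ℝ) := by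
  let _ : NormedRing (Matrix (Fin 2) (Fin 2) ℝ) := Matrix.linftyOpNormedRing
  let _ : NormedAlgebra ℝ (Matrix (Fin 2) (Fin 2) ℝ) := Matrix.linftyOpNormedAlgebra
  let _ : NormedAlgebra ℚ (Matrix (Fin 2) (Fin 2) ℝ) := NormedAlgebra.restrictScalars ℚ ℝ _
  exact NormedSpace.exp_continuous

section expProd

variable {d K : ℕ} {Z : Fin (K + 1) → (Fin d → ℝ) → Matrix (Fin 2) (Fin 2) ℝ}

theorem continuous_expProd (hZ : ∀ j, IsAnalyticSl (Z j)) : Continuous (expProd Z) := by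
  have hc : ∀ j, Continuous fun θ => NormedSpace.exp (Z j θ) := fun j =>
    continuous_matrix_exp.comp (continuous_matrix fun i k =>
      continuousOn_univ.mp ((hZ j).1 i k).1.continuousOn)
  unfold expProd
  simp only [List.ofFn_eq_map]
  exact continuous_list_prod _ fun j _ => hc j

theorem expProd_periodic (hZ : ∀ j, IsAnalyticSl (Z j)) (θ : Fin d → ℝ) (n : Fin d → ℤ) :
    expProd Z (θ + fun i => 2 * (n i : ℝ)) = expProd Z θ := by
  have : ∀ j, Z j (θ + fun i => 2 * (n i : ℝ)) = Z j θ := fun j => by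
    ext i k; exact ((hZ j).1 i k).2 θ n
  simp only [expProd, this]

theorem isUnit_det_expProd (θ : Fin d → ℝ) : IsUnit (expProd Z θ).det := by
  rw [← Matrix.isUnit_iff_isUnit_det, expProd]
  refine List.prod_isUnit fun M hM => ?_
  obtain ⟨j, rfl⟩ := (List.mem_ofFn' _ _).mp hM
  exact Matrix.isUnit_exp _

theorem continuous_expProd_inv (hZ : ∀ j, IsAnalyticSl (Z j)) :
    Continuous fun θ => (expProd Z θ)⁻¹ := by
  simp only [Matrix.inv_def, Ring.inverse_eq_inv']
  exact ((continuous_expProd hZ).matrix_det.inv₀ fun θ => (isUnit_det_expProd θ).ne_zero).smul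
    (continuous_expProd hZ).matrix_adjugate

theorem exists_norm_le_of_abs_le {ι : Type*} {M : ι → Matrix (Fin 2) (Fin 2) ℝ}
    (h : ∀ i j, ∃ L, ∀ θ, |M θ i j| ≤ L) : ∃ L, 0 < L ∧ ∀ θ, ‖M θ‖ ≤ L := by
  choose L hL using h
  have hb : ∀ θ i j, M θ i j ^ 2 ≤ L i j ^ 2 := fun θ i j => by
    rw [← sq_abs]; exact pow_le_pow_left₀ (abs_nonneg _) (hL i j θ) 2
  refine ⟨Real.sqrt (L 0 0 ^ 2 + L 0 1 ^ 2 + L 1 0 ^ 2 + L 1 1 ^ 2 + 1), by positivity, fun θ => ?_⟩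
  apply Real.le_sqrt_of_sq_le
  rw [frobenius_sq]
  linarith [hb θ 0 0, hb θ 0 1, hb θ 1 0, hb θ 1 1]

/-- The conjugation `Y = expProd Z` and its inverse are bounded, being continuous and periodic. -/
theorem exists_norm_expProd_le (hZ : ∀ j, IsAnalyticSl (Z j)) :
    ∃ L, 0 < L ∧ ∀ θ, ‖expProd Z θ‖ ≤ L ∧ ‖(expProd Z θ)⁻¹‖ ≤ L := by
  obtain ⟨L₁, h₁, hL₁⟩ := exists_norm_le_of_abs_le (M := expProd Z) fun i j =>
    exists_abs_le_of_periodic two_pos ((continuous_expProd hZ).matrix_elem i j)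
      fun θ n => by rw [expProd_periodic hZ]
  obtain ⟨L₂, h₂, hL₂⟩ := exists_norm_le_of_abs_le (M := fun θ => (expProd Z θ)⁻¹) fun i j =>
    exists_abs_le_of_periodic two_pos ((continuous_expProd_inv hZ).matrix_elem i j)
      fun θ n => by rw [expProd_periodic hZ]
  exact ⟨L₁ + L₂, by positivity, fun θ => ⟨by linarith [hL₁ θ], by linarith [hL₂ θ]⟩⟩

end expProd

/-- If `Y' = A Y - Y B` then `Y(t) e^{tB} Y(0)⁻¹` is the fundamental matrix of `A`; the exponential
`e^{tB}` is written as `C(t) + S(t) B`. -/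
theorem isFundamental_of_conj {a b c : ℝ → ℝ} {Y : ℝ → Matrix (Fin 2) (Fin 2) ℝ}
    {B : Matrix (Fin 2) (Fin 2) ℝ} (hB : B.trace = 0) (hu : IsUnit (Y 0).det)
    (hY : ∀ t i j, HasDerivAt (fun τ => Y τ i j)
      ((!![b t, c t; -a t, -b t] * Y t - Y t * B) i j) t) {C S : ℝ → ℝ} (hC0 : C 0 = 1) (hS0 : S 0 = 0)
    (hC : ∀ t, HasDerivAt C (-B.det * S t) t) (hS : ∀ t, HasDerivAt S (C t) t) :
    IsFundamental a b c fun t => Y t * (C t • 1 + S t • B) * (Y 0)⁻¹ where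
  map_zero := by simp [hC0, hS0, Matrix.mul_nonsing_inv _ hu]
  hasDerivAt := by
    have hmul : ∀ {M N : ℝ → Matrix (Fin 2) (Fin 2) ℝ} {M' N' : Matrix (Fin 2) (Fin 2) ℝ} {t : ℝ},
        (∀ i j, HasDerivAt (fun τ => M τ i j) (M' i j) t) →
        (∀ i j, HasDerivAt (fun τ => N τ i j) (N' i j) t) →
        ∀ i j, HasDerivAt (fun τ => (M τ * N τ) i j) ((M' * N t + M t * N') i j) t := by
      intro M N M' N' t hM hN i j
      simp only [Matrix.mul_apply, Matrix.add_apply, ← Finset.sum_add_distrib]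
      exact HasDerivAt.fun_sum fun k _ => (hM i k).mul (hN k j)
    intro t i j
    have hE : ∀ i j, HasDerivAt (fun τ => (C τ • (1 : Matrix (Fin 2) (Fin 2) ℝ) + S τ • B) i j)
        ((B * (C t • 1 + S t • B)) i j) t := by
      intro i j
      have e : B * (C t • 1 + S t • B) =
          (-B.det * S t) • (1 : Matrix (Fin 2) (Fin 2) ℝ) + C t • B := by
        rw [mul_add, Matrix.mul_smul, Matrix.mul_smul, sq_eq_of_trace_eq_zero hB, mul_one, smul_smul,
          mul_comm (S t), add_comm]
      rw [e]
      exact ((hC t).mul_const _).add ((hS t).mul_const _)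
    have h := hmul (hmul (hY t) hE) (N := fun _ => (Y 0)⁻¹) (N' := 0)
      (fun i j => hasDerivAt_const t _) i j
    rw [mul_zero, add_zero, sub_mul, mul_assoc (Y t) B, sub_add_cancel, mul_assoc !![_, _; _, _],
      mul_assoc !![_, _; _, _]] at h
    exact h

/-! ### Growth of the reduced system -/

/-- If `F = Y E W` with `Y`, `W` and their inverses `P`, `Q` bounded, then `F` and `E` have
comparable norms. -/
theorem norm_le_of_eq_mul_mul {E F Y W P Q : Matrix (Fin 2) (Fin 2) ℝ} {L K : ℝ}
    (h : F = Y * E * W) (hY : P * Y = 1) (hW : W * Q = 1) (hYL : ‖Y‖ ≤ L) (hPL : ‖P‖ ≤ L)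
    (hWK : ‖W‖ ≤ K) (hQK : ‖Q‖ ≤ K) : ‖F‖ ≤ L * K * ‖E‖ ∧ ‖E‖ ≤ L * K * ‖F‖ := by
  have hL : 0 ≤ L := (norm_nonneg _).trans hYL
  have hK : 0 ≤ K := (norm_nonneg _).trans hWK
  have key : ∀ A B C : Matrix (Fin 2) (Fin 2) ℝ, ‖A‖ ≤ L → ‖C‖ ≤ K → ‖A * B * C‖ ≤ L * K * ‖B‖ := by
    intro A B C hA hC
    calc _ ≤ ‖A‖ * ‖B‖ * ‖C‖ := (norm_mul_le _ _).trans (by gcongr; exact norm_mul_le _ _)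
      _ ≤ L * ‖B‖ * K := by gcongr
      _ = _ := by ring
  refine ⟨h ▸ key Y E W hYL hWK, ?_⟩
  have e : E = P * F * Q := by
    calc E = (P * Y) * E * (W * Q) := by rw [hY, hW, one_mul, mul_one]
      _ = _ := by rw [h]; simp only [mul_assoc]
  calc ‖E‖ = ‖P * F * Q‖ := by rw [← e]
    _ ≤ _ := key P F Q hPL hQK

theorem exists_rpow_le {ν N g : ℝ → ℝ} {m k s : ℝ} (hs : 0 ≤ s) (hm : 0 < m) (hk : 0 < k)
    (h : ∀ t, m * N t ^ s ≤ ν t) (hg : ∀ t, 0 ≤ t → 0 ≤ g t)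
    (hN : ∀ t, 0 ≤ t → g t ≤ k * N t) : ∃ m', 0 < m' ∧ ∀ t, 0 ≤ t → m' * g t ^ s ≤ ν t := by
  have hks : 0 < k ^ s := by positivity
  refine ⟨m / k ^ s, by positivity, fun t ht => le_trans ?_ (h t)⟩
  have hN0 : 0 ≤ N t := nonneg_of_mul_nonneg_right ((hg t ht).trans (hN t ht)) hk
  calc m / k ^ s * g t ^ s ≤ m / k ^ s * (k * N t) ^ s := by
        have := hg t ht
        gcongr
        exact hN t ht
    _ = m * N t ^ s := by
        rw [Real.mul_rpow hk.le hN0]; field_simp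

theorem exists_le_rpow {ν N g : ℝ → ℝ} {M k s : ℝ} (hs : 0 ≤ s) (hM : 0 < M) (hk : 0 < k)
    (h : ∀ t, ν t ≤ M * N t ^ s) (hN0 : ∀ t, 0 ≤ N t) (hg : ∀ t, 0 ≤ g t)
    (hN : ∀ t, 0 ≤ t → N t ≤ k * g t) : ∃ M', 0 < M' ∧ ∀ t, 0 ≤ t → ν t ≤ M' * g t ^ s := by
  have hks : 0 < k ^ s := by positivity
  refine ⟨M * k ^ s, by positivity, fun t ht => (h t).trans ?_⟩
  calc M * N t ^ s ≤ M * (k * g t) ^ s := by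
        have := hN0 t
        gcongr
        exact hN t ht
    _ = _ := by
        rw [Real.mul_rpow hk.le (hg t)]; ring

theorem IsSimilar.det_eq_zero {B : Matrix (Fin 2) (Fin 2) ℝ} {κ : ℝ}
    (h : IsSimilar B !![0, 0; κ, 0]) : B.det = 0 := by
  obtain ⟨P, -, rfl⟩ := h
  rw [Matrix.det_mul, Matrix.det_mul]
  simp [Matrix.det_fin_two]

theorem IsSimilar.ne_zero {B : Matrix (Fin 2) (Fin 2) ℝ} {κ : ℝ} (hκ : κ ≠ 0)
    (h : IsSimilar B !![0, 0; κ, 0]) : B ≠ 0 := by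
  obtain ⟨P, hP, rfl⟩ := h
  intro h0
  have h1 : P⁻¹ * (P * !![0, 0; κ, 0] * P⁻¹) * P = !![0, 0; κ, 0] := by
    calc _ = (P⁻¹ * P) * !![0, 0; κ, 0] * (P⁻¹ * P) := by simp only [mul_assoc]
      _ = _ := by rw [Matrix.nonsing_inv_mul _ hP, one_mul, mul_one]
  rw [h0, mul_zero, zero_mul] at h1
  exact hκ (by simpa using (congrFun (congrFun h1 1) 0).symm)

end QuadraticSchrodinger

open QuadraticSchrodinger in
theorem theorem3p2 {d : ℕ} (hd : 1 ≤ d) (ω : Fin d → ℝ)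
    (a b c : (Fin d → ℝ) → ℝ) (ha : IsAnalyticPeriodic 1 a) (hb : IsAnalyticPeriodic 1 b)
    (hc : IsAnalyticPeriodic 1 c)
    (B : Matrix (Fin 2) (Fin 2) ℝ) (hB : B.trace = 0)
    (K : ℕ) (Z : Fin (K + 1) → (Fin d → ℝ) → Matrix (Fin 2) (Fin 2) ℝ)
    (hZ : ∀ j, IsAnalyticSl (Z j))
    (hconj : IsConjugatedBy ω (systemMatrix a b c) (fun _ => B) (expProd Z))
    (s : ℝ) (hs : 0 ≤ s) (u₀ : L2R) (hu₀ : u₀ ∈ sobolevSpace s) (hne : u₀ ≠ 0) :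
    ∃ u : ℝ → L2R,
      -- `u` is the solution with initial condition `u₀`
      IsSolution ω a b c u ∧ u 0 = u₀ ∧
      (∀ w : ℝ → L2R, IsSolution ω a b c w → w 0 = u₀ → ∀ t : ℝ, 0 ≤ t → w t = u t) ∧
      (∀ t : ℝ, 0 ≤ t → u t ∈ sobolevSpace s) ∧
      -- elliptic or zero case
      (0 < B.det ∨ B = 0 →
        ∃ m M : ℝ, 0 < m ∧ 0 < M ∧ ∀ t : ℝ, 0 ≤ t →
          m ≤ sobolevNorm s (u t) ∧ sobolevNorm s (u t) ≤ M) ∧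
      -- hyperbolic case
      (B.det < 0 →
        ∃ m M : ℝ, 0 < m ∧ 0 < M ∧ ∀ t : ℝ, 0 ≤ t →
          m * Real.exp (Real.sqrt (-B.det) * s * t) ≤ sobolevNorm s (u t) ∧
          sobolevNorm s (u t) ≤ M * Real.exp (Real.sqrt (-B.det) * s * t)) ∧
      -- parabolic case
      (∀ κ : ℝ, κ ≠ 0 → IsSimilar B !![0, 0; κ, 0] →
        ∃ m M : ℝ, 0 < m ∧ 0 < M ∧ ∀ t : ℝ, 0 ≤ t →
          m * |κ| ^ s * t ^ s ≤ sobolevNorm s (u t) ∧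
          sobolevNorm s (u t) ≤ M * |κ| ^ s * (1 + t ^ 2) ^ (s / 2)) := by
  let _ : NormedRing (Matrix (Fin 2) (Fin 2) ℝ) := Matrix.frobeniusNormedRing
  let _ : NormedAlgebra ℝ (Matrix (Fin 2) (Fin 2) ℝ) := Matrix.frobeniusNormedAlgebra
  have hcont : ∀ {f : (Fin d → ℝ) → ℝ}, IsAnalyticPeriodic 1 f → Continuous fun t : ℝ => f (t • ω) :=
    fun hf => (continuousOn_univ.mp hf.1.continuousOn).comp (continuous_id.smul continuous_const)
  obtain ⟨C, S, hC0, hS0, hC, hS, hneg, hpos, hzero⟩ := exists_cosh_sinh (-B.det)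
  set Y : ℝ → Matrix (Fin 2) (Fin 2) ℝ := fun t => expProd Z (t • ω) with hY
  have hYu : ∀ t, IsUnit (Y t).det := fun t => isUnit_det_expProd _
  set E : ℝ → Matrix (Fin 2) (Fin 2) ℝ := fun t => C t • 1 + S t • B with hE
  set F : ℝ → Matrix (Fin 2) (Fin 2) ℝ := fun t => Y t * E t * (Y 0)⁻¹ with hF
  have hfund : IsFundamental (fun t => a (t • ω)) (fun t => b (t • ω)) (fun t => c (t • ω)) F :=
    isFundamental_of_conj hB (hYu 0) hconj hC0 hS0 hC hS
  obtain ⟨u, hu, hu0, huniq, hmem, m, M, hm, hM, hbd⟩ :=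
    hfund.exists_solution (hcont ha) (hcont hb) (hcont hc) hs hu₀ hne
  obtain ⟨L, hL, hYL⟩ := exists_norm_expProd_le hZ
  have hFE : ∀ t, ‖F t‖ ≤ L * L * ‖E t‖ ∧ ‖E t‖ ≤ L * L * ‖F t‖ := fun t =>
    norm_le_of_eq_mul_mul rfl (Matrix.nonsing_inv_mul _ (hYu t)) (Matrix.nonsing_inv_mul _ (hYu 0))
      (hYL _).1 (hYL _).2 (hYL _).2 (hYL _).1
  have hF1 : ∀ t, 1 ≤ ‖F t‖ := fun t => one_le_norm_of_det_eq_one (hfund.det_eq_one t)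
  have hEle : ∀ t, ‖E t‖ ≤ |C t| * ‖(1 : Matrix (Fin 2) (Fin 2) ℝ)‖ + |S t| * ‖B‖ := fun t =>
    (norm_add_le _ _).trans (by rw [norm_smul, norm_smul, Real.norm_eq_abs, Real.norm_eq_abs])
  set I := ‖(1 : Matrix (Fin 2) (Fin 2) ℝ)‖ with hI
  have hI1 : 1 ≤ I := one_le_norm_of_det_eq_one Matrix.det_one
  have hI0 : 0 < I := by linarith
  have lower : ∀ {k : ℝ} {g : ℝ → ℝ}, 0 < k → (∀ t, 0 ≤ t → 0 ≤ g t) →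
      (∀ t, 0 ≤ t → g t ≤ k * ‖F t‖) →
      ∃ m', 0 < m' ∧ ∀ t, 0 ≤ t → m' * g t ^ s ≤ sobolevNorm s (u t) := fun hk hg h =>
    exists_rpow_le hs hm hk (fun t => (hbd t).1) hg h
  have upper : ∀ {k : ℝ} {g : ℝ → ℝ}, 0 < k → (∀ t, 0 ≤ g t) →
      (∀ t, 0 ≤ t → ‖E t‖ ≤ k * g t) →
      ∃ M', 0 < M' ∧ ∀ t, 0 ≤ t → sobolevNorm s (u t) ≤ M' * g t ^ s := fun {k} {g} hk hg h =>
    exists_le_rpow (k := L * L * k) hs hM (by positivity) (fun t => (hbd t).2)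
      (fun t => norm_nonneg _) hg fun t ht => (hFE t).1.trans (by
        rw [mul_assoc (L * L)]; exact mul_le_mul_of_nonneg_left (h t ht) (by positivity))
  refine ⟨u, (isSolution_iff ω a b c u).mpr hu, hu0,
    fun w hw => huniq w ((isSolution_iff ω a b c w).mp hw), fun t _ => hmem t, ?_, ?_, ?_⟩
  · intro hcase
    have hb : ∃ k, 0 < k ∧ ∀ t, ‖E t‖ ≤ k := by
      rcases hcase with hdet | h0
      · obtain ⟨k, hk⟩ := hneg (by linarith)
        have hk0 : 0 ≤ k := (abs_nonneg _).trans (hk 0).1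
        refine ⟨k * I + k * ‖B‖ + 1, by positivity, fun t => (hEle t).trans ?_⟩
        have h1 : |C t| * I ≤ k * I := by gcongr; exact (hk t).1
        have h2 : |S t| * ‖B‖ ≤ k * ‖B‖ := by gcongr; exact (hk t).2
        linarith
      · refine ⟨I, by linarith, fun t => (hEle t).trans ?_⟩
        rw [(hzero (by simp [h0]) t).1, h0, norm_zero]
        simp
    obtain ⟨k, hk, hb⟩ := hb
    obtain ⟨m', hm', hlo⟩ := lower (k := 1) (g := fun _ => 1) one_pos (fun _ _ => zero_le_one)
      fun t _ => by simpa using hF1 t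
    obtain ⟨M', hM', hup⟩ := upper (g := fun _ => 1) hk (fun _ => zero_le_one)
      fun t _ => by simpa using hb t
    simp only [Real.one_rpow, mul_one] at hlo hup
    exact ⟨m', M', hm', hM', fun t ht => ⟨hlo t ht, hup t ht⟩⟩
  · intro hdet
    obtain ⟨k, hk⟩ := hpos (by linarith)
    have hk0 : 0 ≤ k := by
      have := (abs_nonneg _).trans (hk 0 le_rfl).1
      simpa using this
    have hexp : ∀ t, Real.exp (Real.sqrt (-B.det) * t) ^ s = Real.exp (Real.sqrt (-B.det) * s * t) :=
      fun t => by rw [← Real.exp_mul]; congr 1; ring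
    obtain ⟨m', hm', hlo⟩ := lower (k := 2 * (L * L))
      (g := fun t => Real.exp (Real.sqrt (-B.det) * t)) (by positivity)
      (fun _ _ => (Real.exp_pos _).le) fun t ht => by
        refine (hk t ht).2.2.trans ?_
        -- `2 C(t)` is the trace of `E(t)`
        have htr : E t 0 0 + E t 1 1 = 2 * C t := by
          rw [Matrix.trace_fin_two] at hB
          simp only [hE, Matrix.add_apply, Matrix.smul_apply, Matrix.one_apply_eq, smul_eq_mul]
          linear_combination S t * hB
        have h1 : 2 * C t ≤ 2 * ‖E t‖ := by
          rw [← htr]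
          have := frobenius_sq (E t)
          nlinarith [sq_nonneg (E t 0 0 - E t 1 1), sq_nonneg (E t 0 1), sq_nonneg (E t 1 0),
            norm_nonneg (E t)]
        linarith [(hFE t).2]
    obtain ⟨M', hM', hup⟩ := upper (k := k * I + k * ‖B‖ + 1)
      (g := fun t => Real.exp (Real.sqrt (-B.det) * t)) (by positivity)
      (fun _ => (Real.exp_pos _).le) fun t ht => by
        refine (hEle t).trans ?_
        have h1 : |C t| * I ≤ k * Real.exp (Real.sqrt (-B.det) * t) * I := by
          gcongr; exact (hk t ht).1
        have h2 : |S t| * ‖B‖ ≤ k * Real.exp (Real.sqrt (-B.det) * t) * ‖B‖ := by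
          gcongr; exact (hk t ht).2.1
        nlinarith [Real.exp_pos (Real.sqrt (-B.det) * t)]
    simp only [hexp] at hlo hup
    exact ⟨m', M', hm', hM', fun t ht => ⟨hlo t ht, hup t ht⟩⟩
  · intro κ hκ hsim
    have hκs : 0 < |κ| ^ s := Real.rpow_pos_of_pos (abs_pos.mpr hκ) s
    have hB0 : 0 < ‖B‖ := norm_pos_iff.mpr (hsim.ne_zero hκ)
    have hCS := hzero (by rw [hsim.det_eq_zero, neg_zero])
    obtain ⟨m', hm', hlo⟩ := lower (k := (L * L + I) / ‖B‖) (g := fun t => t) (by positivity)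
      (fun _ h => h) fun t ht => by
        rw [div_mul_eq_mul_div, le_div_iff₀ hB0]
        have e : t • B = E t - 1 := by simp [hE, (hCS t).1, (hCS t).2]
        calc t * ‖B‖ = ‖t • B‖ := by rw [norm_smul, Real.norm_eq_abs, abs_of_nonneg ht]
          _ ≤ ‖E t‖ + I := by rw [e]; exact norm_sub_le _ _
          _ ≤ L * L * ‖F t‖ + I * ‖F t‖ :=
            add_le_add (hFE t).2 (le_mul_of_one_le_right (by linarith) (hF1 t))
          _ = _ := by ring
    obtain ⟨M', hM', hup⟩ := upper (k := I + ‖B‖) (g := fun t => Real.sqrt (1 + t ^ 2))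
      (by positivity) (fun _ => Real.sqrt_nonneg _) fun t ht => by
        refine (hEle t).trans ?_
        rw [(hCS t).1, (hCS t).2, abs_one, abs_of_nonneg ht, add_mul]
        have h1 : 1 ≤ Real.sqrt (1 + t ^ 2) := Real.one_le_sqrt.mpr (by nlinarith)
        have h2 : t ≤ Real.sqrt (1 + t ^ 2) := Real.le_sqrt_of_sq_le (by linarith)
        rw [mul_comm 1 I, mul_comm t]
        gcongr
    refine ⟨m' / |κ| ^ s, M' / |κ| ^ s, by positivity, by positivity, fun t ht => ?_⟩
    rw [div_mul_cancel₀ _ hκs.ne', div_mul_cancel₀ _ hκs.ne']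
    refine ⟨hlo t ht, (hup t ht).trans_eq ?_⟩
    rw [Real.sqrt_eq_rpow, ← Real.rpow_mul (by positivity), one_div_mul_eq_div]
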